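/- Let $R$ be a unital associative ring and $A\subseteq R$ a two-sided ideal (for instance, $A$ an arbitrary nonunital ring and $R=\tilde A=\mathbb Z\ltimes A$ the ring obtained by adjoining an identity). A left $R$-module $M$ is *h-unitary* if the evaluation map $A\otimes_R M\to M$, $a\otimes m\mapsto am$, is an isomorphism and $\mathrm{Tor}_i^R(A,M)=0$ for all $i\ge 1$. Let $\mathfrak M(A)$ be the full subcategory of $R$-Mod of h-unitary modules; its exact sequences are the short exact sequences of $R$-modules with all terms in $\mathfrak M(A)$. Let $\mathcal F$ be the class of h-unitary modules that are flat over $R$, and $\mathcal C$ the class of those $C\in\mathfrak M(A)$ with $\mathrm{Ext}^1_{\mathfrak M(A)}(F,C)=0$ for all $F\in\mathcal F$, i.e. such that every exact sequence $0\to C\to E\to F\to 0$ in $\mathfrak M(A)$ with $F\in\mathcal F$ splits. Let $\mathbb C(\mathfrak M(A))$ be the category of unbounded complexes $X=(X^n,\delta^n)_{n\in\mathbb Z}$ of left $R$-modules such that $X^n$, $\ker\delta^n$ and $\mathrm{Im}\,\delta^n$ are h-unitary for all $n$; its exact sequences are the (degreewise) short exact sequences of complexes with all terms in $\mathbb C(\mathfrak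 M(A))$, and $\mathrm{Ext}^1_{\mathbb C(\mathfrak M(A))}(X,Y)=0$ means that every such sequence $0\to Y\to E\to X\to 0$ splits. Let $\widetilde{\mathcal F}$ be the class of exact complexes $X\in\mathbb C(\mathfrak M(A))$ with $\ker\delta^n\in\mathcal F$ for all $n$, and let $dg\widetilde{\mathcal C}$ be the class of complexes $Y\in\mathbb C(\mathfrak M(A))$ such that $Y^n\in\mathcal C$ for all $n$ and the complex of abelian groups $Hom(X,Y)$, with $Hom(X,Y)^n=\prod_{t\in\mathbb Z}\mathrm{Hom}_R(X^t,Y^{n+t})$, is exact for every $X\in\widetilde{\mathcal F}$. **Theorem.** The pair $(\widetilde{\mathcal F},dg\widetilde{\mathcal C})$ is a complete cotorsion pair in $\mathbb C(\mathfrak M(A))$. That is: 1. for $Y\in\mathbb C(\mathfrak M(A))$, one has $Y\in dg\widetilde{\mathcal C}$ if and only if $\mathrm{Ext}^1_{\mathbb C(\mathfrak M(A))}(X,Y)=0$ for all $X\in\widetilde{\mathcal F}$; and for $X\in\mathbb C(\mathfrak M(A))$, one has $X\in\widetilde{\mathcal F}$ if and only if $\mathrm{Ext}^1_{\mathbb C(\mathfrak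 M(A))}(X,Y)=0$ for all $Y\in dg\widetilde{\mathcal C}$; 2. for every $Y\in\mathbb C(\mathfrak M(A))$ there is an exact sequence $0\to Y\to C\to F\to 0$ in $\mathbb C(\mathfrak M(A))$ with $C\in dg\widetilde{\mathcal C}$ and $F\in\widetilde{\mathcal F}$; 3. for every $Z\in\mathbb C(\mathfrak M(A))$ there is an exact sequence $0\to C'\to F'\to Z\to 0$ in $\mathbb C(\mathfrak M(A))$ with $C'\in dg\widetilde{\mathcal C}$ and $F'\in\widetilde{\mathcal F}$. -/

import Mathlib

open CategoryTheory

universe u v w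

/-! ### Tensor products, flatness and Tor over a noncommutative ring -/

section Tensor

open scoped TensorProduct
open MulOpposite

/-- The relations `n r ⊗ m = n ⊗ r m` imposed on `N ⊗_ℤ M`, for a right `R`-module `N`
and a left `R`-module `M`. -/
def balancedRelations (R : Type u) [Ring R] (N : Type v) [AddCommGroup N] [Module Rᵐᵒᵖ N]
    (M : Type w) [AddCommGroup M] [Module R M] : AddSubgroup (N ⊗[ℤ] M) :=
  AddSubgroup.closure {t | ∃ (n : N) (r : R) (m : M),
    t = (op r • n) ⊗ₜ[ℤ] m - n ⊗ₜ[ℤ] (r • m)}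

/-- The tensor product `N ⊗_R M` of a right `R`-module `N` (a module over `Rᵐᵒᵖ`) and a
left `R`-module `M`, as an abelian group. -/
abbrev BalancedTensor (R : Type u) [Ring R] (N : Type v) [AddCommGroup N] [Module Rᵐᵒᵖ N]
    (M : Type w) [AddCommGroup M] [Module R M] : Type (max v w) :=
  (N ⊗[ℤ] M) ⧸ balancedRelations R N M

/-- The class of the pure tensor `n ⊗ m` in `N ⊗_R M`. -/
def BalancedTensor.tmul (R : Type u) [Ring R] {N : Type v} [AddCommGroup N] [Module Rᵐᵒᵖ N]
    {M : Type w} [AddCommGroup M] [Module R M] (n : N) (m : M) : BalancedTensor R N M :=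
  QuotientAddGroup.mk' (balancedRelations R N M) (n ⊗ₜ[ℤ] m)

/-- The map `g ⊗_R f` induced by a right `R`-linear map `g` and a left `R`-linear map `f`. -/
def BalancedTensor.map {R : Type u} [Ring R] {N N' : Type v}
    [AddCommGroup N] [Module Rᵐᵒᵖ N] [AddCommGroup N'] [Module Rᵐᵒᵖ N']
    {M M' : Type w} [AddCommGroup M] [Module R M] [AddCommGroup M'] [Module R M']
    (g : N →ₗ[Rᵐᵒᵖ] N') (f : M →ₗ[R] M') :
    BalancedTensor R N M →+ BalancedTensor R N' M' :=
  QuotientAddGroup.map _ _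
    (TensorProduct.map g.toAddMonoidHom.toIntLinearMap
      f.toAddMonoidHom.toIntLinearMap).toAddMonoidHom <| by
    rw [balancedRelations, AddSubgroup.closure_le]
    rintro _ ⟨n, r, m, rfl⟩
    refine AddSubgroup.subset_closure ⟨g n, r, f m, ?_⟩
    rw [map_sub]
    change g (op r • n) ⊗ₜ[ℤ] f m - g n ⊗ₜ[ℤ] f (r • m) = _
    rw [map_smul, map_smul]

@[simp]
theorem BalancedTensor.map_tmul {R : Type u} [Ring R] {N N' : Type v}
    [AddCommGroup N] [Module Rᵐᵒᵖ N] [AddCommGroup N'] [Module Rᵐᵒᵖ N']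
    {M M' : Type w} [AddCommGroup M] [Module R M] [AddCommGroup M'] [Module R M']
    (g : N →ₗ[Rᵐᵒᵖ] N') (f : M →ₗ[R] M') (n : N) (m : M) :
    BalancedTensor.map g f (BalancedTensor.tmul R n m) = BalancedTensor.tmul R (g n) (f m) :=
  rfl

theorem BalancedTensor.hom_ext {R : Type u} [Ring R] {N : Type v} [AddCommGroup N]
    [Module Rᵐᵒᵖ N] {M : Type w} [AddCommGroup M] [Module R M] {B : Type*} [AddCommGroup B]
    {f g : BalancedTensor R N M →+ B}
    (h : ∀ (n : N) (m : M), f (tmul R n m) = g (tmul R n m)) : f = g := by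
  apply QuotientAddGroup.addMonoidHom_ext
  ext t
  induction t using TensorProduct.induction_on with
  | zero => rw [map_zero, map_zero]
  | tmul n m => exact h n m
  | add x y hx hy => rw [map_add, map_add, hx, hy]

/-- A left `R`-module `M` is flat if `- ⊗_R M` preserves injections of right `R`-modules. -/
def IsFlatModule (R : Type u) [Ring R] (M : Type u) [AddCommGroup M] [Module R M] : Prop :=
  ∀ (N N' : Type u) [AddCommGroup N] [Module Rᵐᵒᵖ N] [AddCommGroup N'] [Module Rᵐᵒᵖ N']
    (g : N →ₗ[Rᵐᵒᵖ] N'), Function.Injective g →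
    Function.Injective (BalancedTensor.map g (LinearMap.id : M →ₗ[R] M))

/-- The functor `N ⊗_R -` from left `R`-modules to abelian groups. -/
def tensorLeftFunctor (R : Type u) [Ring R] (N : Type u) [AddCommGroup N] [Module Rᵐᵒᵖ N] :
    ModuleCat.{u} R ⥤ AddCommGrpCat.{u} where
  obj M := AddCommGrpCat.of (BalancedTensor R N M)
  map f := AddCommGrpCat.ofHom (BalancedTensor.map (LinearMap.id : N →ₗ[Rᵐᵒᵖ] N) f.hom)
  map_id M := by
    apply AddCommGrpCat.hom_ext
    apply BalancedTensor.hom_ext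
    intro n m
    rfl
  map_comp f g := by
    apply AddCommGrpCat.hom_ext
    apply BalancedTensor.hom_ext
    intro n m
    rfl

instance tensorLeftFunctor_additive (R : Type u) [Ring R] (N : Type u) [AddCommGroup N]
    [Module Rᵐᵒᵖ N] : (tensorLeftFunctor R N).Additive where
  map_add {X Y f g} := by
    apply AddCommGrpCat.hom_ext
    apply BalancedTensor.hom_ext
    intro n m
    change QuotientAddGroup.mk' (balancedRelations R N Y) (n ⊗ₜ[ℤ] (f.hom m + g.hom m)) =
      QuotientAddGroup.mk' (balancedRelations R N Y) (n ⊗ₜ[ℤ] f.hom m) +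
        QuotientAddGroup.mk' (balancedRelations R N Y) (n ⊗ₜ[ℤ] g.hom m)
    rw [TensorProduct.tmul_add, map_add]

/-- `Tor_i^R(N, M)`: the `i`-th left derived functor of `N ⊗_R -`, evaluated at `M`. -/
noncomputable def torGroup (R : Type u) [Ring R] (i : ℕ) (N : Type u) [AddCommGroup N]
    [Module Rᵐᵒᵖ N] (M : ModuleCat.{u} R) : AddCommGrpCat.{u} :=
  ((tensorLeftFunctor R N).leftDerived i).obj M

end Tensor

/-! ### h-unitary modules -/

section HUnitary

variable {R : Type u} [Ring R]

/-- The evaluation map `μ : A ⊗_R M → M`, `a ⊗ m ↦ a m`, for a two-sided ideal `A` of `R`. -/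
noncomputable def evaluationMap (A : TwoSidedIdeal R) (M : Type u) [AddCommGroup M]
    [Module R M] : BalancedTensor R A M →+ M :=
  QuotientAddGroup.lift (balancedRelations R A M)
    (TensorProduct.lift (LinearMap.mk₂ ℤ (fun (a : A) (m : M) => (a : R) • m)
      (fun a b m => by simp [add_smul])
      (fun c a m => by simp [mul_smul, Int.cast_smul_eq_zsmul])
      (fun a m m' => by simp)
      (fun c a m => smul_comm _ _ _))).toAddMonoidHom <| by
    rw [balancedRelations, AddSubgroup.closure_le]
    rintro _ ⟨a, r, m, rfl⟩
    rw [SetLike.mem_coe, AddMonoidHom.mem_ker, map_sub, sub_eq_zero]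
    change ((a : R) * r) • m = (a : R) • r • m
    exact mul_smul _ _ _

@[simp]
theorem evaluationMap_tmul (A : TwoSidedIdeal R) (M : Type u) [AddCommGroup M] [Module R M]
    (a : A) (m : M) : evaluationMap A M (BalancedTensor.tmul R a m) = (a : R) • m :=
  rfl

/-- `𝔐(A)`: a left `R`-module `M` is h-unitary (with respect to the two-sided ideal `A` of `R`)
if the evaluation map `A ⊗_R M → M` is an isomorphism and `Tor_i^R(A, M) = 0` for `i ≥ 1`. -/
def hUnitary (A : TwoSidedIdeal R) : ObjectProperty (ModuleCat.{u} R) := fun M =>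
  Function.Bijective (evaluationMap A M) ∧
    ∀ i : ℕ, 1 ≤ i → Limits.IsZero (torGroup R i A M)

/-- `𝓕`: the h-unitary flat modules. -/
def hUnitaryFlat (A : TwoSidedIdeal R) : ObjectProperty (ModuleCat.{u} R) := fun M =>
  hUnitary A M ∧ IsFlatModule R M

end HUnitary

/-! ### Cotorsion pairs in a full subcategory of an abelian category

Below `P` is a full subcategory of an abelian category `𝒜`; its exact sequences are the short
exact sequences of `𝒜` all of whose terms lie in `P`. -/

section Cotorsion

variable {𝒜 : Type v} [Category.{w} 𝒜] [Abelian 𝒜]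

/-- `Ext¹_P(X, Y) = 0` for the relative (Yoneda) extension group: every short exact sequence
`0 ⟶ Y ⟶ E ⟶ X ⟶ 0` with `E` in `P` splits. It is meant for `X` and `Y` in `P`. -/
def RelExtVanishes (P : ObjectProperty 𝒜) (X Y : 𝒜) : Prop :=
  ∀ (E : 𝒜) (i : Y ⟶ E) (p : E ⟶ X) (zero : i ≫ p = 0), P E →
    (ShortComplex.mk i p zero).ShortExact → Nonempty (ShortComplex.mk i p zero).Splitting

/-- `F^⊥`: the objects `Y` of `P` with `Ext¹_P(X, Y) = 0` for all `X` in `F`. -/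
def rightPerp (P F : ObjectProperty 𝒜) : ObjectProperty 𝒜 := fun Y =>
  P Y ∧ ∀ X, F X → RelExtVanishes P X Y

/-- `^⊥C`: the objects `X` of `P` with `Ext¹_P(X, Y) = 0` for all `Y` in `C`. -/
def leftPerp (P C : ObjectProperty 𝒜) : ObjectProperty 𝒜 := fun X =>
  P X ∧ ∀ Y, C Y → RelExtVanishes P X Y

/-- `(F, C)` is a cotorsion pair in `P`. -/
structure IsCotorsionPair (P F C : ObjectProperty 𝒜) : Prop where
  rightPerp_eq : rightPerp P F = C
  leftPerp_eq : leftPerp P C = F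

/-- Every `Y` in `P` has an exact sequence `0 ⟶ Y ⟶ M ⟶ L ⟶ 0` in `P` with `M` in `C` and
`L` in `F`. -/
def EnoughInjectivesPair (P F C : ObjectProperty 𝒜) : Prop :=
  ∀ Y, P Y → ∃ (M L : 𝒜) (i : Y ⟶ M) (p : M ⟶ L) (zero : i ≫ p = 0),
    P M ∧ P L ∧ C M ∧ F L ∧ (ShortComplex.mk i p zero).ShortExact

/-- Every `Z` in `P` has an exact sequence `0 ⟶ M ⟶ L ⟶ Z ⟶ 0` in `P` with `M` in `C` and
`L` in `F`. -/
def EnoughProjectivesPair (P F C : ObjectProperty 𝒜) : Prop :=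
  ∀ Z, P Z → ∃ (M L : 𝒜) (i : M ⟶ L) (p : L ⟶ Z) (zero : i ≫ p = 0),
    P M ∧ P L ∧ C M ∧ F L ∧ (ShortComplex.mk i p zero).ShortExact

/-- `(F, C)` is a complete cotorsion pair in `P`. -/
structure IsCompleteCotorsionPair (P F C : ObjectProperty 𝒜) : Prop where
  isCotorsionPair : IsCotorsionPair P F C
  enoughInjectives : EnoughInjectivesPair P F C
  enoughProjectives : EnoughProjectivesPair P F C

end Cotorsion

/-! ### Complexes of h-unitary modules -/

section Complexes

variable {R : Type u} [Ring R]

/-- `𝓒`: the h-unitary cotorsion modules, i.e. the h-unitary `C` with `Ext¹_{𝔐(A)}(F, C) = 0`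
for all h-unitary flat `F`. -/
def hUnitaryCotorsion (A : TwoSidedIdeal R) : ObjectProperty (ModuleCat.{u} R) :=
  rightPerp (hUnitary A) (hUnitaryFlat A)

/-- The cycle module `Z_n X = ker (X^n ⟶ X^{n+1})`. -/
abbrev cycleModule (X : CochainComplex (ModuleCat.{u} R) ℤ) (n : ℤ) : ModuleCat.{u} R :=
  ModuleCat.of R (LinearMap.ker (X.d n (n + 1)).hom)

/-- The image module `Im (X^n ⟶ X^{n+1})`. -/
abbrev imageModule (X : CochainComplex (ModuleCat.{u} R) ℤ) (n : ℤ) : ModuleCat.{u} R :=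
  ModuleCat.of R (LinearMap.range (X.d n (n + 1)).hom)

/-- `ℂ(𝔐(A))`: the unbounded complexes `X` of left `R`-modules such that all terms of the exact
sequences `0 ⟶ ker dⁿ ⟶ Xⁿ ⟶ Im dⁿ ⟶ 0` are h-unitary. -/
def hUnitaryComplex (A : TwoSidedIdeal R) :
    ObjectProperty (CochainComplex (ModuleCat.{u} R) ℤ) := fun X =>
  ∀ n : ℤ, hUnitary A (X.X n) ∧ hUnitary A (cycleModule X n) ∧ hUnitary A (imageModule X n)

/-- `𝓕~`: the h-unitary flat complexes, i.e. the exact complexes in `ℂ(𝔐(A))` all of whose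
cycle modules are h-unitary flat. -/
def hUnitaryFlatComplex (A : TwoSidedIdeal R) :
    ObjectProperty (CochainComplex (ModuleCat.{u} R) ℤ) := fun X =>
  hUnitaryComplex A X ∧ X.Acyclic ∧ ∀ n : ℤ, hUnitaryFlat A (cycleModule X n)

/-- `dg𝓒~`: the dg-cotorsion complexes, i.e. the complexes `Y` in `ℂ(𝔐(A))` with all terms
h-unitary cotorsion and such that the complex of abelian groups `Hom(X, Y)` is exact for every
h-unitary flat complex `X`. -/
def dgCotorsionComplex (A : TwoSidedIdeal R) :
    ObjectProperty (CochainComplex (ModuleCat.{u} R) ℤ) := fun Y =>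
  hUnitaryComplex A Y ∧ (∀ n : ℤ, hUnitaryCotorsion A (Y.X n)) ∧
    ∀ X, hUnitaryFlatComplex A X → (CochainComplex.HomComplex X Y).Acyclic

end Complexes

/-! Modules are tested against character modules N^+ = Hom_ℤ(N, ℚ/ℤ) of right modules N. Adjunction
and the injectivity of ℚ/ℤ turn vanishing of Tor_i(N, M), i ≥ 1, into vanishing of Ext^i(M, N^+),
and flatness of M into Ext^1(M, N^+) = 0 for all N. In 0 → (R/A)^+ → R^+ → A^+ → 0 the middle term
is injective, so M is h-unitary iff Ext^i(M, (R/A)^+) = 0 for all i ≥ 0 (`hUnitary_iff`). Hence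
h-unitary modules have the two-out-of-three property in short exact sequences, and a flat M is
h-unitary as soon as Hom(M, (R/A)^+) = 0, that is AM = M (`hUnitaryFlat_iff`). The latter
description passes to pure submodules and their quotients.

The right orthogonal of the flat complexes is the dg-cotorsion class
(`rightPerp_eq_dgCotorsionComplex`). If Y is orthogonal, extending maps over disks shows that its
terms are cotorsion, and extending chain maps over cones of identities makes them null-homotopic.
Conversely, an extension of X by a dg-cotorsion Y splits degreewise, its class is a cocycle of
degree 1 in Hom(X, Y), and a primitive of that cocycle corrects the degreewise section to a chain
map.

For enough injectives, let κ be infinite with |R| ≤ κ, and let L be a projective complex mapping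
onto every complex with terms of cardinality at most κ. The small object argument embeds Y in some C
to which maps extend from every K ⊆ L with L/K flat (`exists_shortExact_extendsFrom`). The cokernel
is flat because flat complexes are characterized by lifting properties (`LiftsToTestDisks`).
Moreover every extension of a flat complex X by C splits (`ExtendsFrom.exists_section`): each
element of X lies in an exact subcomplex with pure cycles and terms of size at most κ
(`exists_pure_hull`), over which a section exists, and Zorn's lemma assembles partial sections by
passing to quotients.

Enough projectives follows by Salce's pushout argument, since every complex in the category is a
quotient of a flat one: a telescope of free modules covers each term, and disks on these covers are
summed. The left orthogonal is then identified by a retract argument. -/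

section

open MulOpposite

/-! ### Character modules of right modules -/

section CharacterDual

/-- The circle group `ℚ/ℤ`. -/
abbrev QModZ : Type := AddCircle (1 : ℚ)

/-- ℚ/ℤ is divisible, hence injective, and `g` descends to X / ker f, which embeds in `Y`. All the
dualities below rest on this. -/
theorem exists_addMonoidHom_comp_eq {X Y : Type*} [AddCommGroup X] [AddCommGroup Y]
    (f : X →+ Y) (g : X →+ QModZ) (h : ∀ x, f x = 0 → g x = 0) :
    ∃ k : Y →+ QModZ, ∀ x, k (f x) = g x := by
  obtain ⟨k, hk⟩ := (Module.Baer.of_divisible QModZ).extension_property_addMonoidHom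
    (QuotientAddGroup.kerLift f) (QuotientAddGroup.kerLift_injective f)
    (QuotientAddGroup.lift f.ker g h)
  exact ⟨k, fun x => DFunLike.congr_fun hk (QuotientAddGroup.mk x)⟩

theorem eq_zero_of_characters {X : Type*} [AddCommGroup X] (x : X)
    (h : ∀ c : X →+ QModZ, c x = 0) : x = 0 :=
  CharacterModule.eq_zero_of_character_apply h

variable (R : Type u) [Ring R]

/-- The character module `Hom_ℤ(N, ℚ/ℤ)` of a right `R`-module, a left `R`-module. -/
def CharDual (N : Type u) [AddCommGroup N] [Module Rᵐᵒᵖ N] : Type u := N →+ QModZ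

namespace CharDual

section

variable (N : Type u) [AddCommGroup N] [Module Rᵐᵒᵖ N]

instance : AddCommGroup (CharDual R N) := inferInstanceAs (AddCommGroup (N →+ QModZ))

instance : FunLike (CharDual R N) N QModZ := inferInstanceAs (FunLike (N →+ QModZ) N QModZ)

instance : AddMonoidHomClass (CharDual R N) N QModZ :=
  inferInstanceAs (AddMonoidHomClass (N →+ QModZ) N QModZ)

instance : SMul R (CharDual R N) where
  smul r f := AddMonoidHom.comp (f : N →+ QModZ) (DistribSMul.toAddMonoidHom N (op r))

variable {R N}

@[ext]
theorem ext {f g : CharDual R N} (h : ∀ n, f n = g n) : f = g := DFunLike.ext _ _ h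

@[simp] theorem smul_apply (r : R) (f : CharDual R N) (n : N) : (r • f) n = f (op r • n) := rfl
@[simp] theorem add_apply (f g : CharDual R N) (n : N) : (f + g) n = f n + g n := rfl
@[simp] theorem zero_apply (n : N) : (0 : CharDual R N) n = 0 := rfl
@[simp] theorem sub_apply (f g : CharDual R N) (n : N) : (f - g) n = f n - g n := rfl

instance : Module R (CharDual R N) where
  one_smul f := by ext; simp
  mul_smul r s f := by ext; simp [mul_smul]
  smul_zero r := by ext; simp
  smul_add r f g := by ext; simp
  add_smul r s f := by ext; simp [add_smul]
  zero_smul f := by ext; simp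

/-- A character, as an element of the character module. -/
def mk (c : N →+ QModZ) : CharDual R N := c

@[simp] theorem mk_apply (c : N →+ QModZ) (n : N) : (mk c : CharDual R N) n = c n := rfl

/-- A character module element, as a character. -/
def toHom (c : CharDual R N) : N →+ QModZ := c

@[simp] theorem toHom_apply (c : CharDual R N) (n : N) : c.toHom n = c n := rfl

/-- The restriction of characters along a map of right modules. -/
def restrict {N' : Type u} [AddCommGroup N'] [Module Rᵐᵒᵖ N'] (g : N →ₗ[Rᵐᵒᵖ] N') :
    CharDual R N' →ₗ[R] CharDual R N where
  toFun f := mk (f.toHom.comp g.toAddMonoidHom)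
  map_add' _ _ := rfl
  map_smul' r f := by ext; simp

@[simp] theorem restrict_apply {N' : Type u} [AddCommGroup N'] [Module Rᵐᵒᵖ N']
    (g : N →ₗ[Rᵐᵒᵖ] N') (f : CharDual R N') (n : N) : restrict g f n = f (g n) := rfl

theorem restrict_injective {N' : Type u} [AddCommGroup N'] [Module Rᵐᵒᵖ N']
    (g : N →ₗ[Rᵐᵒᵖ] N') (hg : Function.Surjective g) :
    Function.Injective (restrict g) := by
  intro f f' h
  ext n
  obtain ⟨n, rfl⟩ := hg n
  exact DFunLike.congr_fun h n

theorem restrict_surjective {N' : Type u} [AddCommGroup N'] [Module Rᵐᵒᵖ N']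
    (g : N →ₗ[Rᵐᵒᵖ] N') (hg : Function.Injective g) :
    Function.Surjective (restrict g) := by
  intro f
  obtain ⟨k, hk⟩ := exists_addMonoidHom_comp_eq g.toAddMonoidHom f.toHom
    (fun x hx => by rw [hg (hx.trans (map_zero g).symm), map_zero])
  exact ⟨mk k, ext hk⟩

theorem restrict_eq_zero_iff {N₁ N₂ : Type u} [AddCommGroup N₁] [Module Rᵐᵒᵖ N₁]
    [AddCommGroup N₂] [Module Rᵐᵒᵖ N₂] (g : N →ₗ[Rᵐᵒᵖ] N₁) (h : N₁ →ₗ[Rᵐᵒᵖ] N₂)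
    (hgh : Function.Exact g h) (f : CharDual R N₁) :
    restrict g f = 0 ↔ ∃ f', restrict h f' = f := by
  constructor
  · intro hf
    obtain ⟨k, hk⟩ := exists_addMonoidHom_comp_eq h.toAddMonoidHom f.toHom (fun x hx => by
      obtain ⟨y, rfl⟩ := (hgh x).1 hx
      exact DFunLike.congr_fun hf y)
    exact ⟨mk k, ext hk⟩
  · rintro ⟨f', rfl⟩
    ext n
    simp [hgh.apply_apply_eq_zero]

end

end CharDual

end CharacterDual

/-! ### Tensor-hom adjunction and flatness -/

section Adjunction

variable {R : Type u} [Ring R]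

/-- `Hom_R(M, N^+) → Hom_ℤ(N ⊗_R M, ℚ/ℤ)`. -/
noncomputable def BalancedTensor.uncurry {N M : Type u} [AddCommGroup N] [Module Rᵐᵒᵖ N]
    [AddCommGroup M] [Module R M] (f : M →ₗ[R] CharDual R N) : BalancedTensor R N M →+ QModZ :=
  QuotientAddGroup.lift (balancedRelations R N M)
    (TensorProduct.lift (LinearMap.mk₂ ℤ (fun (n : N) (m : M) => f m n)
      (fun a b m => by simp)
      (fun c a m => by simp)
      (fun a m m' => by simp)
      (fun c a m => by
        rw [map_zsmul]
        exact AddMonoidHom.zsmul_apply (M := N) (f m).toHom c a))).toAddMonoidHom <| by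
    rw [balancedRelations, AddSubgroup.closure_le]
    rintro _ ⟨a, r, m, rfl⟩
    rw [SetLike.mem_coe, AddMonoidHom.mem_ker, map_sub, sub_eq_zero]
    change f m (op r • a) = f (r • m) a
    simp

section
variable {N M : Type u} [AddCommGroup N] [Module Rᵐᵒᵖ N] [AddCommGroup M] [Module R M]

theorem BalancedTensor.tmul_add (n : N) (m m' : M) :
    tmul R n (m + m') = tmul R n m + tmul R n m' := by
  simp only [tmul, TensorProduct.tmul_add, map_add]

theorem BalancedTensor.add_tmul (n n' : N) (m : M) :
    tmul R (n + n') m = tmul R n m + tmul R n' m := by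
  simp only [tmul, TensorProduct.add_tmul, map_add]

theorem BalancedTensor.smul_tmul (n : N) (r : R) (m : M) :
    tmul R (op r • n) m = tmul R n (r • m) := by
  rw [← sub_eq_zero, tmul, tmul, ← map_sub]
  exact (QuotientAddGroup.eq_zero_iff _).2 (AddSubgroup.subset_closure ⟨n, r, m, rfl⟩)

/-- Additivity of `n ↦ n ⊗ m`, bundled. -/
noncomputable def BalancedTensor.tmulHom (m : M) : N →+ BalancedTensor R N M :=
  AddMonoidHom.mk' (fun n => tmul R n m) (fun n n' => add_tmul n n' m)

/-- `Hom_ℤ(N ⊗_R M, ℚ/ℤ) → Hom_R(M, N^+)`. -/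
noncomputable def BalancedTensor.curry (c : BalancedTensor R N M →+ QModZ) :
    M →ₗ[R] CharDual R N where
  toFun m := CharDual.mk (c.comp (tmulHom m))
  map_add' m m' := by
    ext n
    change c (tmul R n (m + m')) = c (tmul R n m) + c (tmul R n m')
    rw [tmul_add, map_add]
  map_smul' r m := by
    ext n
    change c (tmul R n (r • m)) = c (tmul R (op r • n) m)
    rw [smul_tmul]

end

/-- By adjunction Hom_R(M, N^+) is the character group of N ⊗ M, and a map of abelian groups is
injective exactly when its dual is surjective. -/
theorem isFlatModule_iff_lift {M : Type u} [AddCommGroup M] [Module R M] :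
    IsFlatModule R M ↔ ∀ (N N' : Type u) [AddCommGroup N] [Module Rᵐᵒᵖ N] [AddCommGroup N']
      [Module Rᵐᵒᵖ N'] (g : N →ₗ[Rᵐᵒᵖ] N'), Function.Injective g →
      ∀ f : M →ₗ[R] CharDual R N, ∃ f' : M →ₗ[R] CharDual R N',
        ∀ m, CharDual.restrict g (f' m) = f m := by
  constructor
  · intro h N N' _ _ _ _ g hg f
    obtain ⟨k, hk⟩ := exists_addMonoidHom_comp_eq (BalancedTensor.map g (LinearMap.id : M →ₗ[R] M))
      (BalancedTensor.uncurry f)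
      (fun x hx => by rw [h N N' g hg (hx.trans (map_zero _).symm), map_zero])
    exact ⟨BalancedTensor.curry k, fun m => CharDual.ext fun n =>
      hk (BalancedTensor.tmul R n m)⟩
  · intro h N N' _ _ _ _ g hg
    rw [injective_iff_map_eq_zero]
    intro x hx
    refine eq_zero_of_characters x fun c => ?_
    obtain ⟨f', hf'⟩ := h N N' g hg (BalancedTensor.curry c)
    have : c = (BalancedTensor.uncurry f').comp (BalancedTensor.map g LinearMap.id) := by
      apply BalancedTensor.hom_ext
      intro n m
      exact (DFunLike.congr_fun (hf' m) n).symm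
    rw [this, AddMonoidHom.comp_apply, hx, map_zero]

end Adjunction

/-! ### Injectivity of duals of free modules, and exactness of duals -/

section InjectiveDual

variable {R : Type u} [Ring R]

theorem CharDual.finsupp_ext {I : Type u} {f g : CharDual R (I →₀ Rᵐᵒᵖ)}
    (h : ∀ j s, f (Finsupp.single j s) = g (Finsupp.single j s)) : f = g :=
  CharDual.ext fun n => DFunLike.congr_fun (Finsupp.addHom_ext (f := f.toHom) (g := g.toHom) h) n

/-- Characters of a free right module form an injective left module. -/
theorem CharDual.exists_extension_of_free (I : Type u) {K G : Type u} [AddCommGroup K] [Module R K]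
    [AddCommGroup G] [Module R G] (i : K →ₗ[R] G) (hi : Function.Injective i)
    (f : K →ₗ[R] CharDual R (I →₀ Rᵐᵒᵖ)) :
    ∃ f' : G →ₗ[R] CharDual R (I →₀ Rᵐᵒᵖ), ∀ k, f' (i k) = f k := by
  -- A linear map to the dual of a free module amounts to one character of its source for each basis
  -- element, and characters extend along injections.
  have key (j : I) : ∃ c : G →+ QModZ, ∀ k, c (i k) = f k (Finsupp.single j 1) := by
    apply exists_addMonoidHom_comp_eq i.toAddMonoidHom
      (AddMonoidHom.mk' (fun k => f k (Finsupp.single j 1)) (fun a b => by simp))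
    intro x hx
    rw [hi (hx.trans (map_zero i).symm), map_zero]
  choose c hc using key
  let F (g : G) : CharDual R (I →₀ Rᵐᵒᵖ) := CharDual.mk (Finsupp.liftAddHom fun j =>
    AddMonoidHom.mk' (fun r : Rᵐᵒᵖ => c j (unop r • g)) fun r s => by simp [add_smul])
  have hF (g : G) (j : I) (s : Rᵐᵒᵖ) : F g (Finsupp.single j s) = c j (unop s • g) := by
    simp [F]
  refine ⟨⟨⟨F, fun g g' => ?_⟩, fun r g => ?_⟩, fun k => ?_⟩ <;>
    refine CharDual.finsupp_ext fun j s => ?_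
  · simp [hF]
  · rw [RingHom.id_apply, CharDual.smul_apply, Finsupp.smul_single]
    change F (r • g) _ = F g _
    rw [hF, hF, ← mul_smul]
    rfl
  · change F (i k) _ = _
    rw [hF, ← map_smul, hc, map_smul, CharDual.smul_apply]
    simp

end InjectiveDual

section Ext

variable {R : Type u} [Ring R]

/-- The character module as an object of the category of left modules. -/
abbrev charObj (N : Type u) [AddCommGroup N] [Module Rᵐᵒᵖ N] : ModuleCat.{u} R :=
  ModuleCat.of R (CharDual R N)

instance injective_charObj_free (I : Type u) :
    Injective (charObj (R := R) (I →₀ Rᵐᵒᵖ)) where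
  factors {X Y} g f hf := by
    obtain ⟨k, hk⟩ := CharDual.exists_extension_of_free I f.hom
      ((ModuleCat.mono_iff_injective f).1 hf) g.hom
    exact ⟨ModuleCat.ofHom k, ModuleCat.hom_ext (LinearMap.ext hk)⟩

open Abelian

/-- The complex of left modules dual to an exact sequence of right modules. -/
def restrictComplex {N₁ N₂ N₃ : Type u} [AddCommGroup N₁] [Module Rᵐᵒᵖ N₁]
    [AddCommGroup N₂] [Module Rᵐᵒᵖ N₂] [AddCommGroup N₃] [Module Rᵐᵒᵖ N₃]
    (g : N₁ →ₗ[Rᵐᵒᵖ] N₂) (h : N₂ →ₗ[Rᵐᵒᵖ] N₃) (hgh : Function.Exact g h) :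
    ShortComplex (ModuleCat.{u} R) :=
  ShortComplex.mk (X₁ := charObj N₃) (X₂ := charObj N₂) (X₃ := charObj N₁)
    (ModuleCat.ofHom (CharDual.restrict h)) (ModuleCat.ofHom (CharDual.restrict g)) (by
      ext x
      exact (CharDual.restrict_eq_zero_iff g h hgh _).2 ⟨x, rfl⟩)

theorem shortExact_restrict {N₁ N₂ N₃ : Type u} [AddCommGroup N₁] [Module Rᵐᵒᵖ N₁]
    [AddCommGroup N₂] [Module Rᵐᵒᵖ N₂] [AddCommGroup N₃] [Module Rᵐᵒᵖ N₃]
    (g : N₁ →ₗ[Rᵐᵒᵖ] N₂) (h : N₂ →ₗ[Rᵐᵒᵖ] N₃) (hgh : Function.Exact g h)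
    (hg : Function.Injective g) (hh : Function.Surjective h) :
    (restrictComplex (R := R) g h hgh).ShortExact where
  exact := by
    rw [ShortComplex.ShortExact.moduleCat_exact_iff_function_exact]
    exact fun f => CharDual.restrict_eq_zero_iff g h hgh f
  mono_f := (ModuleCat.mono_iff_injective _).2 (CharDual.restrict_injective h hh)
  epi_g := (ModuleCat.epi_iff_surjective _).2 (CharDual.restrict_surjective g hg)

variable (R) in
/-- The canonical free cover of a right module. -/
noncomputable def freeCover (N : Type u) [AddCommGroup N] [Module Rᵐᵒᵖ N] :
    (N →₀ Rᵐᵒᵖ) →ₗ[Rᵐᵒᵖ] N := Finsupp.linearCombination Rᵐᵒᵖ id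

theorem shortExact_restrict_freeCover (N : Type u) [AddCommGroup N] [Module Rᵐᵒᵖ N] :
    (restrictComplex (R := R) (N₁ := LinearMap.ker (freeCover R N))
      (LinearMap.ker (freeCover R N)).subtype (freeCover R N)
      (LinearMap.exact_subtype_ker_map _)).ShortExact :=
  shortExact_restrict _ _ _ (Submodule.subtype_injective _)
    (Finsupp.linearCombination_id_surjective _ _)

end Ext

/-! ### Long exact sequence arguments for Ext -/

section ExtLemmas

open Abelian

variable {𝒜 : Type v} [Category.{w} 𝒜] [Abelian 𝒜] [HasExt.{u} 𝒜]

theorem exists_extension_of_ext_subsingleton {S : ShortComplex 𝒜} (hS : S.ShortExact) {Y : 𝒜}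
    (h : Subsingleton (Ext S.X₃ Y 1)) (f : S.X₁ ⟶ Y) : ∃ k : S.X₂ ⟶ Y, S.f ≫ k = f := by
  obtain ⟨k, hk⟩ := Ext.contravariant_sequence_exact₁ hS Y (Ext.mk₀ f) (add_zero 1)
    (Subsingleton.elim _ _)
  obtain ⟨k, rfl⟩ := Ext.homEquiv₀.symm.surjective k
  exact ⟨k, (Ext.mk₀_bijective _ _).1 (by simpa using hk)⟩

theorem exists_lift_of_ext_subsingleton {S : ShortComplex 𝒜} (hS : S.ShortExact) {X : 𝒜}
    (h : Subsingleton (Ext X S.X₁ 1)) (f : X ⟶ S.X₃) : ∃ k : X ⟶ S.X₂, k ≫ S.g = f := by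
  obtain ⟨k, hk⟩ := Ext.covariant_sequence_exact₃ X hS (Ext.mk₀ f) (zero_add 1)
    (Subsingleton.elim _ _)
  obtain ⟨k, rfl⟩ := Ext.homEquiv₀.symm.surjective k
  exact ⟨k, (Ext.mk₀_bijective _ _).1 (by simpa using hk)⟩

/-- Each class dies in Ext^1(X, X₂), so it is the connecting image of a map to X₃; such a map lifts
to X₂, and its connecting image is then zero. -/
theorem ext_subsingleton_of_lift {S : ShortComplex 𝒜} (hS : S.ShortExact) {X : 𝒜}
    (h₂ : Subsingleton (Ext X S.X₂ 1)) (h : ∀ f : X ⟶ S.X₃, ∃ k : X ⟶ S.X₂, k ≫ S.g = f) :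
    Subsingleton (Ext X S.X₁ 1) := by
  refine subsingleton_of_forall_eq 0 fun x => ?_
  obtain ⟨y, rfl⟩ := Ext.covariant_sequence_exact₁ X hS x (Subsingleton.elim _ _) (zero_add 1)
  obtain ⟨y, rfl⟩ := Ext.homEquiv₀.symm.surjective y
  obtain ⟨k, rfl⟩ := h y
  simp only [Ext.homEquiv₀_symm_apply, ← Ext.mk₀_comp_mk₀]
  rw [Ext.comp_assoc _ _ _ _ (zero_add 1) (by omega), hS.comp_extClass, Ext.comp_zero]

theorem ext_subsingleton_X₁_of_covariant {S : ShortComplex 𝒜} (hS : S.ShortExact) {X : 𝒜}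
    {n m : ℕ} (hn : n + 1 = m) (h₂ : Subsingleton (Ext X S.X₂ m))
    (h₃ : Subsingleton (Ext X S.X₃ n)) : Subsingleton (Ext X S.X₁ m) := by
  refine subsingleton_of_forall_eq 0 fun x => ?_
  obtain ⟨y, rfl⟩ := Ext.covariant_sequence_exact₁ X hS x (Subsingleton.elim _ _) hn
  rw [Subsingleton.elim y 0, Ext.zero_comp]

theorem ext_subsingleton_X₃_of_covariant {S : ShortComplex 𝒜} (hS : S.ShortExact) {X : 𝒜}
    {n m : ℕ} (hn : n + 1 = m) (h₂ : Subsingleton (Ext X S.X₂ n))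
    (h₁ : Subsingleton (Ext X S.X₁ m)) : Subsingleton (Ext X S.X₃ n) := by
  refine subsingleton_of_forall_eq 0 fun x => ?_
  obtain ⟨y, rfl⟩ := Ext.covariant_sequence_exact₃ X hS x hn (Subsingleton.elim _ _)
  rw [Subsingleton.elim y 0, Ext.zero_comp]

theorem ext_subsingleton_X₂_of_contravariant {S : ShortComplex 𝒜} (hS : S.ShortExact) {Y : 𝒜}
    {n : ℕ} (h₁ : Subsingleton (Ext S.X₁ Y n)) (h₃ : Subsingleton (Ext S.X₃ Y n)) :
    Subsingleton (Ext S.X₂ Y n) := by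
  refine subsingleton_of_forall_eq 0 fun x => ?_
  obtain ⟨y, rfl⟩ := Ext.contravariant_sequence_exact₂ hS Y x (Subsingleton.elim _ _)
  rw [Subsingleton.elim y 0, Ext.comp_zero]

theorem ext_subsingleton_X₁_of_contravariant {S : ShortComplex 𝒜} (hS : S.ShortExact) {Y : 𝒜}
    {n m : ℕ} (hn : 1 + n = m) (h₂ : Subsingleton (Ext S.X₂ Y n))
    (h₃ : Subsingleton (Ext S.X₃ Y m)) : Subsingleton (Ext S.X₁ Y n) := by
  refine subsingleton_of_forall_eq 0 fun x => ?_
  obtain ⟨y, rfl⟩ := Ext.contravariant_sequence_exact₁ hS Y x hn (Subsingleton.elim _ _)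
  rw [Subsingleton.elim y 0, Ext.comp_zero]

theorem ext_subsingleton_X₃_of_contravariant {S : ShortComplex 𝒜} (hS : S.ShortExact) {Y : 𝒜}
    {n m : ℕ} (hn : 1 + n = m) (h₁ : Subsingleton (Ext S.X₁ Y n))
    (h₂ : Subsingleton (Ext S.X₂ Y m)) : Subsingleton (Ext S.X₃ Y m) := by
  refine subsingleton_of_forall_eq 0 fun x => ?_
  obtain ⟨y, rfl⟩ := Ext.contravariant_sequence_exact₃ hS Y x (Subsingleton.elim _ _) hn
  rw [Subsingleton.elim y 0, Ext.comp_zero]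

theorem ext_subsingleton_zero_iff {X Y : 𝒜} :
    Subsingleton (Ext X Y 0) ↔ ∀ f : X ⟶ Y, f = 0 := by
  rw [Ext.homEquiv₀.subsingleton_congr]
  exact ⟨fun h f => Subsingleton.elim _ _, fun h => subsingleton_of_forall_eq 0 h⟩

theorem ext_subsingleton_of_retract_left {X X' Y : 𝒜} (r : Retract X X') {n : ℕ}
    (h : Subsingleton (Ext X' Y n)) : Subsingleton (Ext X Y n) := by
  refine subsingleton_of_forall_eq 0 fun x => ?_
  have : (Ext.mk₀ r.i).comp ((Ext.mk₀ r.r).comp x (zero_add n)) (zero_add n) = x := by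
    rw [Ext.mk₀_comp_mk₀_assoc, r.retract, Ext.mk₀_id_comp]
  rw [← this, Subsingleton.elim ((Ext.mk₀ r.r).comp x (zero_add n)) 0, Ext.comp_zero]

end ExtLemmas

/-! ### Flatness as vanishing of Ext into character modules -/

section Flat

open Abelian

variable {R : Type u} [Ring R]

/-- One direction uses the dual of 0 → K → F → N → 0 with F free, where F^+ is injective and lifting
along K → F kills Ext^1. The other uses the dual of 0 → N → N' → N'/N → 0, where the obstruction to
lifting lies in Ext^1(M, (N'/N)^+). -/
theorem isFlatModule_iff_ext_one {M : ModuleCat.{u} R} :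
    IsFlatModule R M ↔ ∀ (N : Type u) [AddCommGroup N] [Module Rᵐᵒᵖ N],
      Subsingleton (Ext M (charObj (R := R) N) 1) := by
  rw [isFlatModule_iff_lift]
  constructor
  · intro h N _ _
    have hS := shortExact_restrict_freeCover (R := R) N
    refine ext_subsingleton_of_lift hS (Ext.subsingleton_of_injective _ (charObj (N →₀ Rᵐᵒᵖ)) _) fun f => ?_
    obtain ⟨f', hf'⟩ := h _ _ (freeCover R N).ker.subtype (Submodule.subtype_injective _) f.hom
    exact ⟨ModuleCat.ofHom f', ModuleCat.hom_ext (LinearMap.ext hf')⟩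
  · intro h N N' _ _ _ _ g hg f
    have hS := shortExact_restrict (R := R) g g.range.mkQ (LinearMap.exact_map_mkQ_range g) hg
      (Submodule.mkQ_surjective _)
    obtain ⟨k, hk⟩ := exists_lift_of_ext_subsingleton hS (h (N' ⧸ g.range)) (ModuleCat.ofHom f)
    exact ⟨k.hom, fun m => congrArg (fun c => c.hom m) hk⟩

theorem IsFlatModule.ext_subsingleton {M : ModuleCat.{u} R} (hM : IsFlatModule R M) {i : ℕ}
    (hi : 1 ≤ i) (N : Type u) [AddCommGroup N] [Module Rᵐᵒᵖ N] :
    Subsingleton (Ext M (charObj (R := R) N) i) := by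
  induction i, hi using Nat.le_induction generalizing N with
  | base => exact isFlatModule_iff_ext_one.1 hM N
  | succ i hi ih =>
    have hS := shortExact_restrict_freeCover (R := R) N
    exact ext_subsingleton_X₁_of_covariant hS rfl (Ext.subsingleton_of_injective _ (charObj (N →₀ Rᵐᵒᵖ)) _) (ih _)

theorem isFlatModule_of_projective (M : ModuleCat.{u} R) [Projective M] : IsFlatModule R M :=
  isFlatModule_iff_ext_one.2 fun _ => Ext.subsingleton_of_projective _ _ _

theorem isFlatModule_of_shortExact {S : ShortComplex (ModuleCat.{u} R)} (hS : S.ShortExact)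
    (h₁ : IsFlatModule R S.X₁) (h₃ : IsFlatModule R S.X₃) : IsFlatModule R S.X₂ :=
  isFlatModule_iff_ext_one.2 fun N => ext_subsingleton_X₂_of_contravariant hS
    (isFlatModule_iff_ext_one.1 h₁ N) (isFlatModule_iff_ext_one.1 h₃ N)

theorem IsFlatModule.of_retract {M M' : ModuleCat.{u} R} (r : Retract M M')
    (h : IsFlatModule R M') : IsFlatModule R M :=
  isFlatModule_iff_ext_one.2 fun N => ext_subsingleton_of_retract_left r
    (isFlatModule_iff_ext_one.1 h N)

end Flat

end

section

open MulOpposite Abelian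

/-! ### Duality between Tor and Ext -/

section TorExt

theorem exact_iff_characters {X Y Z : Type*} [AddCommGroup X] [AddCommGroup Y] [AddCommGroup Z]
    (f : X →+ Y) (g : Y →+ Z) (hfg : ∀ x, g (f x) = 0) :
    Function.Exact f g ↔ ∀ c : Y →+ QModZ, (∀ x, c (f x) = 0) →
      ∃ c' : Z →+ QModZ, ∀ y, c' (g y) = c y := by
  constructor
  · intro h c hc
    refine exists_addMonoidHom_comp_eq g c fun y hy => ?_
    obtain ⟨x, rfl⟩ := (h y).1 hy
    exact hc x
  · intro h y
    refine ⟨fun hy => ?_, by rintro ⟨x, rfl⟩; exact hfg x⟩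
    change y ∈ f.range
    rw [← QuotientAddGroup.eq_zero_iff]
    refine eq_zero_of_characters _ fun c => ?_
    obtain ⟨c', hc'⟩ := h (c.comp (QuotientAddGroup.mk' f.range)) (fun x =>
      (congrArg c ((QuotientAddGroup.eq_zero_iff _).2 (AddMonoidHom.mem_range.2 ⟨x, rfl⟩))).trans
        (map_zero c))
    rw [← QuotientAddGroup.mk'_apply, ← AddMonoidHom.comp_apply, ← hc', hy, map_zero]

variable {R : Type u} [Ring R]

theorem tensor_exact_iff_characters (N : Type u) [AddCommGroup N] [Module Rᵐᵒᵖ N]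
    {X Y Z : ModuleCat.{u} R} (f : X ⟶ Y) (g : Y ⟶ Z) (hfg : f ≫ g = 0) :
    Function.Exact ((tensorLeftFunctor R N).map f) ((tensorLeftFunctor R N).map g) ↔
      ∀ c : Y ⟶ charObj (R := R) N, f ≫ c = 0 → ∃ c' : Z ⟶ charObj (R := R) N, g ≫ c' = c := by
  have H (x) : (tensorLeftFunctor R N).map g ((tensorLeftFunctor R N).map f x) = 0 := by
    rw [← ConcreteCategory.comp_apply, ← Functor.map_comp, hfg, Functor.map_zero]
    rfl
  refine (exact_iff_characters ((tensorLeftFunctor R N).map f).hom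
    ((tensorLeftFunctor R N).map g).hom H).trans ⟨fun h c hc => ?_, fun h c hc => ?_⟩
  · obtain ⟨c', hc'⟩ := h (BalancedTensor.uncurry c.hom) (DFunLike.congr_fun
      (BalancedTensor.hom_ext (f := (BalancedTensor.uncurry c.hom).comp
        ((tensorLeftFunctor R N).map f).hom) (g := 0) fun n m =>
          DFunLike.congr_fun (LinearMap.congr_fun (congrArg ModuleCat.Hom.hom hc) m) n))
    exact ⟨ModuleCat.ofHom (BalancedTensor.curry c'), ModuleCat.hom_ext (LinearMap.ext fun m =>
      CharDual.ext (R := R) fun n => hc' (BalancedTensor.tmul R n m))⟩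
  · obtain ⟨c', hc'⟩ := h (ModuleCat.ofHom (BalancedTensor.curry c)) (ModuleCat.hom_ext
      (LinearMap.ext fun m => CharDual.ext (R := R) fun n => hc (BalancedTensor.tmul R n m)))
    exact ⟨BalancedTensor.uncurry c'.hom, DFunLike.congr_fun
      (BalancedTensor.hom_ext (f := (BalancedTensor.uncurry c'.hom).comp
        ((tensorLeftFunctor R N).map g).hom) fun n m =>
          DFunLike.congr_fun (LinearMap.congr_fun (congrArg ModuleCat.Hom.hom hc') m) n)⟩

theorem ext_subsingleton_iff_projectiveResolution {𝒜 : Type v} [Category.{w} 𝒜] [Abelian 𝒜]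
    [HasExt.{u} 𝒜] {M : 𝒜} (P : ProjectiveResolution M) (Y : 𝒜) (n : ℕ) :
    Subsingleton (Ext M Y (n + 1)) ↔ ∀ c : P.complex.X (n + 1) ⟶ Y,
      P.complex.d (n + 1 + 1) (n + 1) ≫ c = 0 →
        ∃ c' : P.complex.X n ⟶ Y, P.complex.d (n + 1) n ≫ c' = c := by
  constructor
  · intro h c hc
    exact (P.extMk_eq_zero_iff c _ rfl hc n rfl).1 (Subsingleton.elim _ _)
  · intro h
    refine subsingleton_of_forall_eq 0 fun x => ?_
    obtain ⟨c, hc, rfl⟩ := P.extMk_surjective x _ rfl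
    exact (P.extMk_eq_zero_iff c _ rfl hc n rfl).2 (h c hc)

/-- Both sides are computed on one projective resolution, and exactness after tensoring with `N` is
tested by characters, that is, by maps of the resolution into N^+. -/
theorem isZero_torGroup_iff (N : Type u) [AddCommGroup N] [Module Rᵐᵒᵖ N] (M : ModuleCat.{u} R)
    (n : ℕ) : Limits.IsZero (torGroup R (n + 1) N M) ↔
      Subsingleton (Ext M (charObj (R := R) N) (n + 1)) := by
  let P := ProjectiveResolution.of M
  rw [ext_subsingleton_iff_projectiveResolution P, ← tensor_exact_iff_characters _ _ _
    (P.complex.d_comp_d _ _ _), torGroup,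
    (P.isoLeftDerivedObj (tensorLeftFunctor R N) (n + 1)).isZero_iff]
  refine (HomologicalComplex.exactAt_iff_isZero_homology _ _).symm.trans ?_
  rw [HomologicalComplex.exactAt_iff' _ (n + 1 + 1) (n + 1) n (by simp) (by simp),
    ShortComplex.ab_exact_iff_function_exact]
  rfl

end TorExt

/-! ### h-unitary modules as an orthogonal class -/

section HUnitary

variable {R : Type u} [Ring R] (A : TwoSidedIdeal R)

/-- The inclusion `A → R` of right modules. -/
def idealInclusion : A →ₗ[Rᵐᵒᵖ] R where
  toFun a := a
  map_add' _ _ := rfl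
  map_smul' _ _ := rfl

theorem idealInclusion_injective : Function.Injective (idealInclusion A) :=
  Subtype.val_injective

/-- The left module `(R/A)^+` of the characters of `R` that vanish on `A`. -/
abbrev annihilatedChars : ModuleCat.{u} R :=
  charObj (R := R) (R ⧸ LinearMap.range (idealInclusion A))

/-- The complex `0 → (R/A)^+ → R^+ → A^+ → 0`. -/
def annihilatedCharsComplex : ShortComplex (ModuleCat.{u} R) :=
  restrictComplex (idealInclusion A) (LinearMap.range (idealInclusion A)).mkQ
    (LinearMap.exact_map_mkQ_range _)

theorem shortExact_annihilatedCharsComplex : (annihilatedCharsComplex A).ShortExact :=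
  shortExact_restrict _ _ _ (idealInclusion_injective A) (Submodule.mkQ_surjective _)

theorem CharDual.exists_extension_self {K G : Type u} [AddCommGroup K] [Module R K]
    [AddCommGroup G] [Module R G] (i : K →ₗ[R] G) (hi : Function.Injective i)
    (f : K →ₗ[R] CharDual R R) : ∃ f' : G →ₗ[R] CharDual R R, ∀ k, f' (i k) = f k := by
  obtain ⟨c, hc⟩ := exists_addMonoidHom_comp_eq i.toAddMonoidHom
    (AddMonoidHom.mk' (fun k => f k 1) (fun a b => by simp)) (fun x hx => by
      rw [hi (hx.trans (map_zero i).symm), map_zero])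
  refine ⟨{ toFun := fun g => CharDual.mk (AddMonoidHom.mk' (fun r : R => c (r • g)) fun r s => by
              simp [add_smul])
            map_add' := fun g g' => CharDual.ext fun r => ?_
            map_smul' := fun s g => CharDual.ext fun r => ?_ }, fun k => CharDual.ext fun r => ?_⟩
  · simp
  · simp [mul_smul]
  · refine (congrArg c (map_smul i r k).symm).trans ((hc (r • k)).trans ?_)
    simp

instance injective_charObj_self : Injective (charObj (R := R) R) where
  factors {X Y} g f hf := by
    obtain ⟨k, hk⟩ := CharDual.exists_extension_self f.hom
      ((ModuleCat.mono_iff_injective f).1 hf) g.hom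
    exact ⟨ModuleCat.ofHom k, ModuleCat.hom_ext (LinearMap.ext hk)⟩

/-- Characters of a left module are the linear maps to `R^+`. -/
def homToCharSelf {M : Type u} [AddCommGroup M] [Module R M] (c : M →+ QModZ) :
    M →ₗ[R] CharDual R R where
  toFun m := CharDual.mk (AddMonoidHom.mk' (fun r : R => c (r • m)) fun r s => by simp [add_smul])
  map_add' m m' := CharDual.ext fun r => by simp
  map_smul' s m := CharDual.ext fun r => by simp [mul_smul]

theorem homToCharSelf_apply_one {M : Type u} [AddCommGroup M] [Module R M]
    (f : M →ₗ[R] CharDual R R) (m : M) (r : R) : f m r = f (r • m) 1 := by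
  simp

/-- The evaluation map is bijective iff restriction `Hom_R(M, R^+) → Hom_R(M, A^+)` is. -/
theorem evaluationMap_injective_iff (M : Type u) [AddCommGroup M] [Module R M] :
    Function.Injective (evaluationMap A M) ↔ ∀ f : M →ₗ[R] CharDual R A,
      ∃ f' : M →ₗ[R] CharDual R R, ∀ m, CharDual.restrict (idealInclusion A) (f' m) = f m := by
  constructor
  · intro h f
    obtain ⟨c, hc⟩ := exists_addMonoidHom_comp_eq (evaluationMap A M) (BalancedTensor.uncurry f)
      (fun x hx => by rw [h (hx.trans (map_zero _).symm), map_zero])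
    exact ⟨homToCharSelf c, fun m => CharDual.ext fun a => hc (BalancedTensor.tmul R a m)⟩
  · intro h
    rw [injective_iff_map_eq_zero]
    intro x hx
    refine eq_zero_of_characters x fun c => ?_
    obtain ⟨f', hf'⟩ := h (BalancedTensor.curry c)
    have : c = (AddMonoidHom.mk' (fun m => f' m 1) (fun a b => by simp)).comp
        (evaluationMap A M) := by
      apply BalancedTensor.hom_ext
      intro a m
      refine (DFunLike.congr_fun (hf' m) a).symm.trans ?_
      exact homToCharSelf_apply_one f' m a
    rw [this, AddMonoidHom.comp_apply, hx, map_zero]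

/-- Maps to R^+ are characters of `M`, and those landing in (R/A)^+ are the characters that vanish
on AM. -/
theorem evaluationMap_surjective_iff (M : Type u) [AddCommGroup M] [Module R M] :
    Function.Surjective (evaluationMap A M) ↔ ∀ f : M →ₗ[R] annihilatedChars A, f = 0 := by
  constructor
  · intro h f
    ext m : 1
    refine CharDual.restrict_injective _ (Submodule.mkQ_surjective _) (CharDual.ext fun r => ?_)
    let f₁ : M →ₗ[R] CharDual R R :=
      (CharDual.restrict (LinearMap.range (idealInclusion A)).mkQ).comp f
    refine (homToCharSelf_apply_one f₁ m r).trans ?_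
    have key : ∀ m, f₁ m 1 = 0 := by
      intro m
      obtain ⟨x, rfl⟩ := h m
      have : (AddMonoidHom.mk' (fun m => f₁ m 1) (fun a b => by simp)).comp
          (evaluationMap A M) = 0 := by
        apply BalancedTensor.hom_ext
        intro a m
        refine (homToCharSelf_apply_one f₁ m a).symm.trans ?_
        change f m (Submodule.Quotient.mk (a : R)) = 0
        exact (congrArg (f m) ((Submodule.Quotient.mk_eq_zero _).2
          (LinearMap.mem_range.2 ⟨a, rfl⟩))).trans (map_zero (f m))
      exact DFunLike.congr_fun this x
    exact key _
  · intro h m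
    change m ∈ (evaluationMap A M).range
    rw [← QuotientAddGroup.eq_zero_iff]
    refine eq_zero_of_characters _ fun c => ?_
    let c' := c.comp (QuotientAddGroup.mk' (evaluationMap A M).range)
    have hc' (a : A) (m : M) : c' ((a : R) • m) = 0 := by
      have : ((((a : R) • m : M)) : M ⧸ (evaluationMap A M).range) = 0 :=
        (QuotientAddGroup.eq_zero_iff _).2 ⟨BalancedTensor.tmul R a m, rfl⟩
      exact (congrArg c this).trans (map_zero c)
    obtain ⟨f, hf⟩ : ∃ f : M →ₗ[R] annihilatedChars A, ∀ m,
        CharDual.restrict (LinearMap.range (idealInclusion A)).mkQ (f m) = homToCharSelf c' m := by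
      have hS := shortExact_annihilatedCharsComplex A
      have := hS.mono_f
      let k : ModuleCat.of R M ⟶ (annihilatedCharsComplex A).X₂ :=
        ModuleCat.ofHom (homToCharSelf c')
      have hk : k ≫ (annihilatedCharsComplex A).g = 0 :=
        ModuleCat.hom_ext (LinearMap.ext fun m => CharDual.ext (R := R) fun a => hc' a m)
      exact ⟨(hS.exact.lift k hk).hom, fun m =>
        congrArg (fun c => c.hom m) (hS.exact.lift_f k hk)⟩
    have := DFunLike.congr_fun (hf m) (1 : R)
    rw [h f, LinearMap.zero_apply, map_zero, eq_comm] at this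
    change c' ((1 : R) • m) = 0 at this
    rwa [one_smul] at this

/-- The long exact sequence of 0 → (R/A)^+ → R^+ → A^+ → 0 with R^+ injective gives the dictionary:
degree 0 is surjectivity of evaluation, degree 1 its injectivity, and degree i + 2 is Ext^(i+1)(M,
A^+), which vanishes exactly when Tor_(i+1)(A, M) does. -/
theorem hUnitary_iff {M : ModuleCat.{u} R} :
    hUnitary A M ↔ ∀ i, Subsingleton (Ext M (annihilatedChars A) i) := by
  have hS := shortExact_annihilatedCharsComplex A
  have h0 : Function.Surjective (evaluationMap A M) ↔
      Subsingleton (Ext M (annihilatedChars A) 0) := by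
    rw [evaluationMap_surjective_iff, ext_subsingleton_zero_iff]
    exact ⟨fun h f => ModuleCat.hom_ext (h f.hom), fun h f =>
      congrArg ModuleCat.Hom.hom (h (ModuleCat.ofHom f))⟩
  have h1 : Function.Injective (evaluationMap A M) ↔
      Subsingleton (Ext M (annihilatedChars A) 1) := by
    rw [evaluationMap_injective_iff]
    constructor
    · intro h
      refine ext_subsingleton_of_lift hS
        (Ext.subsingleton_of_injective _ (charObj (R := R) R) _) fun f => ?_
      obtain ⟨f', hf'⟩ := h f.hom
      exact ⟨ModuleCat.ofHom f', ModuleCat.hom_ext (LinearMap.ext hf')⟩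
    · intro h f
      obtain ⟨k, hk⟩ := exists_lift_of_ext_subsingleton hS h (ModuleCat.ofHom f)
      exact ⟨k.hom, fun m => congrArg (fun c => c.hom m) hk⟩
  have h2 (i : ℕ) : Limits.IsZero (torGroup R (i + 1) A M) ↔
      Subsingleton (Ext M (annihilatedChars A) (i + 2)) := by
    rw [isZero_torGroup_iff]
    exact ⟨fun h => ext_subsingleton_X₁_of_covariant hS rfl
        (Ext.subsingleton_of_injective _ (charObj (R := R) R) _) h,
      fun h => ext_subsingleton_X₃_of_covariant hS rfl
        (Ext.subsingleton_of_injective _ (charObj (R := R) R) _) h⟩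
  constructor
  · rintro ⟨⟨hi, hs⟩, ht⟩ (_ | _ | i)
    exacts [h0.1 hs, h1.1 hi, (h2 i).1 (ht _ (by omega))]
  · intro h
    refine ⟨⟨h1.2 (h 1), h0.2 (h 0)⟩, fun i hi => ?_⟩
    obtain ⟨i, rfl⟩ := Nat.exists_eq_add_of_le' hi
    exact (h2 i).2 (h _)

variable {A}

theorem hUnitary_X₂ {S : ShortComplex (ModuleCat.{u} R)} (hS : S.ShortExact)
    (h₁ : hUnitary A S.X₁) (h₃ : hUnitary A S.X₃) : hUnitary A S.X₂ := by
  rw [hUnitary_iff] at *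
  exact fun i => ext_subsingleton_X₂_of_contravariant hS (h₁ i) (h₃ i)

theorem hUnitary_X₁ {S : ShortComplex (ModuleCat.{u} R)} (hS : S.ShortExact)
    (h₂ : hUnitary A S.X₂) (h₃ : hUnitary A S.X₃) : hUnitary A S.X₁ := by
  rw [hUnitary_iff] at *
  exact fun i => ext_subsingleton_X₁_of_contravariant hS rfl (h₂ i) (h₃ _)

theorem hUnitary_X₃ {S : ShortComplex (ModuleCat.{u} R)} (hS : S.ShortExact)
    (h₁ : hUnitary A S.X₁) (h₂ : hUnitary A S.X₂) : hUnitary A S.X₃ := by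
  have h₂' := h₂
  rw [hUnitary_iff] at *
  rintro (_ | i)
  -- Degree 0 has no preceding Ext term; instead, precomposition with an epimorphism is injective on
  -- Hom.
  · rw [ext_subsingleton_zero_iff]
    intro f
    have := hS.epi_g
    rw [← cancel_epi S.g, Limits.comp_zero]
    exact ext_subsingleton_zero_iff.1 (h₂ 0) _
  · exact ext_subsingleton_X₃_of_contravariant hS (Nat.add_comm _ _) (h₁ i) (h₂ _)

theorem hUnitary_of_retract {M M' : ModuleCat.{u} R} (r : Retract M M') (h : hUnitary A M') :
    hUnitary A M := by
  rw [hUnitary_iff] at *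
  exact fun i => ext_subsingleton_of_retract_left r (h i)

theorem hUnitaryFlat_of_retract {M M' : ModuleCat.{u} R} (r : Retract M M')
    (h : hUnitaryFlat A M') : hUnitaryFlat A M :=
  ⟨hUnitary_of_retract r h.1, h.2.of_retract r⟩

theorem hUnitaryFlat_X₂ {S : ShortComplex (ModuleCat.{u} R)} (hS : S.ShortExact)
    (h₁ : hUnitaryFlat A S.X₁) (h₃ : hUnitaryFlat A S.X₃) : hUnitaryFlat A S.X₂ :=
  ⟨hUnitary_X₂ hS h₁.1 h₃.1, isFlatModule_of_shortExact hS h₁.2 h₃.2⟩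

theorem hUnitary.hom_eq_zero {M : ModuleCat.{u} R} (h : hUnitary A M)
    (f : M ⟶ annihilatedChars A) : f = 0 :=
  ext_subsingleton_zero_iff.1 ((hUnitary_iff A).1 h 0) f

/-- Flatness already kills Ext^i into character modules for i ≥ 1, so only the condition in degree 0
remains. It is stable under operations for which Tor or Ext would be hard to control. -/
theorem hUnitaryFlat_iff {M : ModuleCat.{u} R} : hUnitaryFlat A M ↔
    IsFlatModule R M ∧ ∀ f : M ⟶ annihilatedChars A, f = 0 := by
  refine ⟨fun h => ⟨h.2, h.1.hom_eq_zero⟩, fun h => ⟨(hUnitary_iff A).2 ?_, h.1⟩⟩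
  have hS := shortExact_annihilatedCharsComplex A
  rintro (_ | _ | i)
  · exact ext_subsingleton_zero_iff.2 h.2
  · refine ext_subsingleton_of_lift hS
      (Ext.subsingleton_of_injective _ (charObj (R := R) R) _) fun f => ?_
    obtain ⟨f', hf'⟩ := isFlatModule_iff_lift.1 h.1 A R (idealInclusion A)
      (idealInclusion_injective A) f.hom
    exact ⟨ModuleCat.ofHom f', ModuleCat.hom_ext (LinearMap.ext hf')⟩
  · exact ext_subsingleton_X₁_of_covariant hS rfl
      (Ext.subsingleton_of_injective _ (charObj (R := R) R) _)
      (h.1.ext_subsingleton (Nat.le_add_left 1 i) A)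

end HUnitary

/-! ### Purity, tested by characters -/

section Purity

variable {R : Type u} [Ring R] {Z : Type u} [AddCommGroup Z] [Module R Z]

/-- Every finite system of linear relations in the ambient module, some of whose entries lie in the
submodule, can be solved in the submodule with those entries fixed. -/
def SolvesRelations (T : Submodule R Z) : Prop :=
  ∀ K : Finset (Z →₀ R), (∀ k ∈ K, Finsupp.linearCombination R id k = 0) →
    ∃ φ : Z → T, (∀ k ∈ K, ∀ z ∈ k.support, z ∈ T → (φ z : Z) = z) ∧
      ∀ k ∈ K, Finsupp.linearCombination R φ k = 0

variable (R) in
/-- The relations between the elements of `Z`, with coefficients in a right module `N`. -/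
noncomputable def formalRelations (Z : Type u) [AddCommGroup Z] [Module R Z]
    (N : Type u) [AddCommGroup N] [Module Rᵐᵒᵖ N] : AddSubgroup (Z →₀ N) :=
  AddSubgroup.closure {b | ∃ (k : Z →₀ R) (m : N), Finsupp.linearCombination R id k = 0 ∧
    b = k.mapRange (fun r => op r • m) (by simp)}

/-- Isolates the finitely many relations used by one element of `formalRelations`; solving these in
another module `T` is enough to kill the corresponding value there. -/
theorem exists_relations_of_mem {N : Type u} [AddCommGroup N] [Module Rᵐᵒᵖ N]
    {b : Z →₀ N} (hb : b ∈ formalRelations R Z N) :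
    ∃ K : Finset (Z →₀ R), (∀ k ∈ K, Finsupp.linearCombination R id k = 0) ∧
      (∀ z ∈ b.support, ∃ k ∈ K, z ∈ k.support) ∧
      ∀ {T : Type u} [AddCommGroup T] [Module R T] (f : T →ₗ[R] CharDual R N) (φ : Z → T),
        (∀ k ∈ K, Finsupp.linearCombination R φ k = 0) →
        Finsupp.liftAddHom (fun z => (f (φ z)).toHom) b = 0 := by
  classical
  induction hb using AddSubgroup.closure_induction with
  | zero => exact ⟨∅, by simp, by simp, by simp⟩
  | add x y _ _ hx hy =>
    obtain ⟨K, h1, h2, h3⟩ := hx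
    obtain ⟨K', h1', h2', h3'⟩ := hy
    refine ⟨K ∪ K', fun k hk => ?_, fun z hz => ?_, fun f φ h => ?_⟩
    · rcases Finset.mem_union.1 hk with hk | hk
      exacts [h1 k hk, h1' k hk]
    · rcases Finset.mem_union.1 (Finsupp.support_add hz) with hz | hz
      · obtain ⟨k, hk, hkz⟩ := h2 z hz
        exact ⟨k, Finset.mem_union_left _ hk, hkz⟩
      · obtain ⟨k, hk, hkz⟩ := h2' z hz
        exact ⟨k, Finset.mem_union_right _ hk, hkz⟩
    · rw [map_add, h3 f φ fun k hk => h k (Finset.mem_union_left _ hk),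
        h3' f φ fun k hk => h k (Finset.mem_union_right _ hk), add_zero]
  | neg x _ hx =>
    obtain ⟨K, h1, h2, h3⟩ := hx
    exact ⟨K, h1, by simpa using h2, fun f φ h => by rw [map_neg, h3 f φ h, neg_zero]⟩
  | mem x hx =>
    obtain ⟨k, m, hk, rfl⟩ := hx
    refine ⟨{k}, by simpa using hk, fun z hz => ⟨k, by simp, Finsupp.support_mapRange hz⟩,
      fun f φ h => ?_⟩
    have := congrArg (fun t => f t m) (h k (Finset.mem_singleton_self k))
    simp only [map_zero, CharDual.zero_apply] at this
    rw [← this, Finsupp.liftAddHom_apply, Finsupp.sum_mapRange_index (by simp),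
      Finsupp.linearCombination_apply, Finsupp.sum, Finsupp.sum, map_sum]
    refine Eq.trans ?_ (map_sum (AddMonoidHom.mk' (fun c : CharDual R N => c m) fun _ _ => rfl)
      _ _).symm
    exact Finset.sum_congr rfl fun z _ =>
      (congrArg (fun c : CharDual R N => c m) (map_smul f (k z) (φ z))).symm

/-- The quotient of Z →₀ N by `formalRelations` presents N ⊗ Z. The character of T →₀ N given by `f`
kills whatever becomes a relation over `Z`, because the relations involved are solved in `T` with
the entries from `T` fixed. It therefore extends, by injectivity of ℚ/ℤ. -/
theorem SolvesRelations.exists_extension {T : Submodule R Z} (hT : SolvesRelations T)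
    {N : Type u} [AddCommGroup N] [Module Rᵐᵒᵖ N] (f : T →ₗ[R] CharDual R N) :
    ∃ f' : Z →ₗ[R] CharDual R N, ∀ t : T, f' t = f t := by
  let ι : (T →₀ N) →+ (Z →₀ N) := Finsupp.mapDomain.addMonoidHom Subtype.val
  obtain ⟨c, hc⟩ := exists_addMonoidHom_comp_eq
    ((QuotientAddGroup.mk' (formalRelations R Z N)).comp ι)
    (Finsupp.liftAddHom fun t : T => (f t).toHom) (fun x hx => by
      obtain ⟨K, h1, h2, h3⟩ := exists_relations_of_mem ((QuotientAddGroup.eq_zero_iff _).1 hx)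
      obtain ⟨φ, hφ, hφ'⟩ := hT K h1
      rw [← h3 f φ hφ']
      simp only [ι, Finsupp.mapDomain.addMonoidHom_apply, Finsupp.liftAddHom_apply]
      rw [Finsupp.sum_mapDomain_index (by simp) (by simp)]
      refine Finsupp.sum_congr fun t ht => ?_
      obtain ⟨k, hk, hkt⟩ := h2 t (by
        rw [Finsupp.mem_support_iff] at ht ⊢
        simpa [ι, Finsupp.mapDomain_apply Subtype.val_injective] using ht)
      rw [show φ t = t from Subtype.ext (hφ k hk t hkt t.2)])
  let c' := c.comp (QuotientAddGroup.mk' (formalRelations R Z N))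
  have hc' (k : Z →₀ R) (hk : Finsupp.linearCombination R id k = 0) (m : N) :
      c' (k.mapRange (fun r => op r • m) (by simp)) = 0 :=
    (congrArg c ((QuotientAddGroup.eq_zero_iff _).2
      (AddSubgroup.subset_closure ⟨k, m, hk, rfl⟩))).trans (map_zero c)
  refine ⟨{ toFun := fun z => CharDual.mk (c'.comp (Finsupp.singleAddHom z))
            map_add' := fun z z' => CharDual.ext fun n => ?_
            map_smul' := fun r z => CharDual.ext fun n => ?_ }, fun t => CharDual.ext fun n => ?_⟩
  -- Additivity and linearity are instances of relations: [z + z'] - [z] - [z'] here, and [r z] - r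
  -- [z] for scalars.
  · have := hc' (Finsupp.single (z + z') 1 - Finsupp.single z 1 - Finsupp.single z' 1)
      (by simp) n
    rw [Finsupp.mapRange_sub (by simp [sub_smul]), Finsupp.mapRange_sub (by simp [sub_smul]),
      map_sub, map_sub] at this
    simp only [Finsupp.mapRange_single, op_one, one_smul] at this
    rw [sub_sub, sub_eq_zero] at this
    exact this
  · have := hc' (Finsupp.single (r • z) 1 - Finsupp.single z r) (by simp) n
    rw [Finsupp.mapRange_sub (by simp [sub_smul]), map_sub] at this
    simp only [Finsupp.mapRange_single, op_one, one_smul] at this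
    rw [sub_eq_zero] at this
    exact this
  · have := hc (Finsupp.single t n)
    simp only [ι, AddMonoidHom.comp_apply, Finsupp.mapDomain.addMonoidHom_apply,
      Finsupp.mapDomain_single, Finsupp.liftAddHom_apply_single] at this
    exact this

/-- A linear map is pure if all maps from its source to character modules extend to its target. -/
def IsPureMap {T : Type u} [AddCommGroup T] [Module R T] (i : T →ₗ[R] Z) : Prop :=
  ∀ (N : Type u) [AddCommGroup N] [Module Rᵐᵒᵖ N] (f : T →ₗ[R] CharDual R N),
    ∃ f' : Z →ₗ[R] CharDual R N, ∀ t, f' (i t) = f t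

theorem SolvesRelations.isPureMap {T : Submodule R Z} (hT : SolvesRelations T) :
    IsPureMap T.subtype := fun _ _ _ f => hT.exists_extension f

section

variable {T Q : Type u} [AddCommGroup T] [Module R T] [AddCommGroup Q] [Module R Q]
  {i : T →ₗ[R] Z}

theorem exists_factor_of_surjective {C : Type*} [AddCommGroup C] [Module R C] (p : Z →ₗ[R] Q)
    (hp : Function.Surjective p) (k : Z →ₗ[R] C) (h : ∀ z, p z = 0 → k z = 0) :
    ∃ k' : Q →ₗ[R] C, ∀ z, k' (p z) = k z :=
  ⟨((LinearMap.ker p).liftQ k h).comp (p.quotKerEquivOfSurjective hp).symm.toLinearMap, fun z => by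
    rw [LinearMap.comp_apply, LinearEquiv.coe_coe, LinearMap.quotKerEquivOfSurjective_symm_apply]
    exact Submodule.liftQ_apply _ _ _⟩

/-- The same duality as for flatness. The tensor form is the one that suits directed unions. -/
theorem isPureMap_iff_tensor : IsPureMap i ↔ ∀ (N : Type u) [AddCommGroup N] [Module Rᵐᵒᵖ N],
    Function.Injective (BalancedTensor.map (LinearMap.id : N →ₗ[Rᵐᵒᵖ] N) i) := by
  constructor
  · intro h N _ _
    rw [injective_iff_map_eq_zero]
    intro x hx
    refine eq_zero_of_characters x fun c => ?_
    obtain ⟨f', hf'⟩ := h N (BalancedTensor.curry c)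
    have : c = (BalancedTensor.uncurry f').comp (BalancedTensor.map LinearMap.id i) := by
      apply BalancedTensor.hom_ext
      intro n m
      exact (DFunLike.congr_fun (hf' m) n).symm
    rw [this, AddMonoidHom.comp_apply, hx, map_zero]
  · intro h N _ _ f
    obtain ⟨k, hk⟩ := exists_addMonoidHom_comp_eq
      (BalancedTensor.map (LinearMap.id : N →ₗ[Rᵐᵒᵖ] N) i) (BalancedTensor.uncurry f)
      (fun x hx => by rw [h N (hx.trans (map_zero _).symm), map_zero])
    exact ⟨BalancedTensor.curry k, fun m => CharDual.ext fun n =>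
      hk (BalancedTensor.tmul R n m)⟩

theorem IsPureMap.isFlatModule (hi : IsPureMap i) (hZ : IsFlatModule R Z) : IsFlatModule R T := by
  rw [isFlatModule_iff_lift] at hZ ⊢
  intro N N' _ _ _ _ g hg f
  obtain ⟨f₁, hf₁⟩ := hi N f
  obtain ⟨f₂, hf₂⟩ := hZ N N' g hg f₁
  exact ⟨f₂.comp i, fun t => by rw [← hf₁, ← hf₂]; rfl⟩

/-- Lift f ∘ p to N'^+ using flatness of `Z`. On `T` the lift takes values in (N'/N)^+; by purity
this restriction extends to `Z`, and subtracting the extension makes the lift descend to `Q`. -/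
theorem IsPureMap.isFlatModule_coker (hi : IsPureMap i)
    {p : Z →ₗ[R] Q} (hip : Function.Exact i p)
    (hp : Function.Surjective p) (hZ : IsFlatModule R Z) : IsFlatModule R Q := by
  rw [isFlatModule_iff_lift] at hZ ⊢
  intro N N' _ _ _ _ g hg f
  obtain ⟨f₁, hf₁⟩ := hZ N N' g hg (f.comp p)
  have hexact := LinearMap.exact_map_mkQ_range g
  have h (t : T) : ∃ c : CharDual R (N' ⧸ LinearMap.range g),
      CharDual.restrict (LinearMap.range g).mkQ c = f₁ (i t) := by
    rw [← CharDual.restrict_eq_zero_iff g _ hexact, hf₁, LinearMap.comp_apply,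
      hip.apply_apply_eq_zero, map_zero]
  have hinj' := CharDual.restrict_injective (R := R) (LinearMap.range g).mkQ
    (Submodule.mkQ_surjective _)
  choose q hq using h
  obtain ⟨f₂, hf₂⟩ := hi (N' ⧸ LinearMap.range g)
    ⟨⟨q, fun t t' => hinj' (by simp [hq])⟩, fun r t => hinj' (by simp [hq])⟩
  let k : Z →ₗ[R] CharDual R N' := f₁ - (CharDual.restrict (LinearMap.range g).mkQ).comp f₂
  have hk (z : Z) (hz : p z = 0) : k z = 0 := by
    obtain ⟨t, rfl⟩ := (hip z).1 hz
    rw [LinearMap.sub_apply, LinearMap.comp_apply, sub_eq_zero, ← hq t]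
    exact congrArg _ (hf₂ t).symm
  obtain ⟨k', hk'⟩ := exists_factor_of_surjective p hp k hk
  refine ⟨k', fun x => ?_⟩
  obtain ⟨z, rfl⟩ := hp x
  rw [hk', LinearMap.sub_apply, map_sub, hf₁, LinearMap.comp_apply, LinearMap.comp_apply, sub_eq_self,
    CharDual.restrict_eq_zero_iff g _ hexact]
  exact ⟨_, rfl⟩

/-- Purity of a preimage of a pure submodule under a map with pure kernel. -/
theorem IsPureMap.of_fiber {T₁ T₂ Q₁ : Type u} [AddCommGroup T₁] [Module R T₁]
    [AddCommGroup T₂] [Module R T₂] [AddCommGroup Q₁] [Module R Q₁]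
    {i₁ : T₁ →ₗ[R] T₂} {i₂ : T₂ →ₗ[R] Z} {p₁ : T₂ →ₗ[R] Q₁} {p : Z →ₗ[R] Q} {j : Q₁ →ₗ[R] Q}
    (h₁ : IsPureMap (i₂.comp i₁)) (hj : IsPureMap j) (hp₁ : Function.Surjective p₁)
    (hex : Function.Exact i₁ p₁) (comm : ∀ t, p (i₂ t) = j (p₁ t)) : IsPureMap i₂ := by
  intro N _ _ f
  obtain ⟨g, hg⟩ := h₁ N (f.comp i₁)
  -- The error of the extension `g` vanishes on `T₁`, so it lives on `Q₁` and extends along the pure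
  -- map `j`.
  obtain ⟨k, hk⟩ := exists_factor_of_surjective p₁ hp₁ (f - g.comp i₂) (fun t ht => by
    obtain ⟨t, rfl⟩ := (hex t).1 ht
    rw [LinearMap.sub_apply, sub_eq_zero]
    exact (hg t).symm)
  obtain ⟨k', hk'⟩ := hj N k
  refine ⟨g + k'.comp p, fun t => ?_⟩
  rw [LinearMap.add_apply, LinearMap.comp_apply, comm, hk', hk, LinearMap.sub_apply,
    LinearMap.comp_apply, add_sub_cancel]

/-- Purity of a directed union. -/
theorem isPureMap_of_directed {ι : Type*} [Nonempty ι] {T' : ι → Type u}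
    [∀ a, AddCommGroup (T' a)] [∀ a, Module R (T' a)] (j : ∀ a, T' a →ₗ[R] T)
    (hj : ∀ t, ∃ a t', j a t' = t)
    (hdir : ∀ a b, ∃ c, LinearMap.range (j a) ≤ LinearMap.range (j c) ∧
      LinearMap.range (j b) ≤ LinearMap.range (j c))
    (h : ∀ a, IsPureMap (i.comp (j a))) : IsPureMap i := by
  rw [isPureMap_iff_tensor]
  intro N _ _
  have mono {a c : ι} (hac : LinearMap.range (j a) ≤ LinearMap.range (j c)) :
      (BalancedTensor.map (LinearMap.id : N →ₗ[Rᵐᵒᵖ] N) (j a)).range ≤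
        (BalancedTensor.map (LinearMap.id : N →ₗ[Rᵐᵒᵖ] N) (j c)).range := by
    rintro _ ⟨x, rfl⟩
    induction x using QuotientAddGroup.induction_on with | _ x
    induction x using TensorProduct.induction_on with
    | zero => exact zero_mem _
    | tmul n t =>
      obtain ⟨t', ht'⟩ := hac ⟨t, rfl⟩
      refine ⟨BalancedTensor.tmul R n t', ?_⟩
      rw [BalancedTensor.map_tmul, ht']
      rfl
    | add x y hx hy =>
      exact (congrArg (· ∈ _) (map_add (BalancedTensor.map (LinearMap.id : N →ₗ[Rᵐᵒᵖ] N) (j a))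
        (QuotientAddGroup.mk x) (QuotientAddGroup.mk y))).mpr (add_mem hx hy)
  have key (x : BalancedTensor R N T) :
      ∃ a, x ∈ (BalancedTensor.map (LinearMap.id : N →ₗ[Rᵐᵒᵖ] N) (j a)).range := by
    induction x using QuotientAddGroup.induction_on with | _ x
    induction x using TensorProduct.induction_on with
    | zero => exact ⟨Classical.arbitrary ι, zero_mem _⟩
    | tmul n t =>
      obtain ⟨a, t', rfl⟩ := hj t
      exact ⟨a, BalancedTensor.tmul R n t', rfl⟩
    | add x y hx hy =>
      obtain ⟨a, ha⟩ := hx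
      obtain ⟨b, hb⟩ := hy
      obtain ⟨c, hac, hbc⟩ := hdir a b
      exact ⟨c, add_mem (mono hac ha) (mono hbc hb)⟩
  rw [injective_iff_map_eq_zero]
  intro x hx
  obtain ⟨a, y, rfl⟩ := key x
  have : BalancedTensor.map (LinearMap.id : N →ₗ[Rᵐᵒᵖ] N) (i.comp (j a)) =
      (BalancedTensor.map (LinearMap.id : N →ₗ[Rᵐᵒᵖ] N) i).comp
        (BalancedTensor.map LinearMap.id (j a)) :=
    BalancedTensor.hom_ext fun _ _ => rfl
  have hy : y = 0 := isPureMap_iff_tensor.1 (h a) N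
    ((DFunLike.congr_fun this y).trans (hx.trans (map_zero _).symm))
  rw [hy, map_zero]

end

variable {A : TwoSidedIdeal R}

/-- Maps to any character module, (R/A)^+ included, extend to `Z`, so both conditions of
`hUnitaryFlat_iff` are inherited. -/
theorem IsPureMap.mem_hUnitaryFlat {T Z : ModuleCat.{u} R} {i : T ⟶ Z} (hi : IsPureMap i.hom)
    (hZ : hUnitaryFlat A Z) : hUnitaryFlat A T := by
  rw [hUnitaryFlat_iff] at hZ ⊢
  refine ⟨hi.isFlatModule hZ.1, fun f => ?_⟩
  obtain ⟨f', hf'⟩ := hi _ f.hom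
  have := congrArg ModuleCat.Hom.hom (hZ.2 (ModuleCat.ofHom f'))
  ext t : 2
  exact (hf' t).symm.trans (LinearMap.congr_fun this _)

theorem IsPureMap.mem_hUnitaryFlat_X₃ {S : ShortComplex (ModuleCat.{u} R)} (hS : S.ShortExact)
    (hi : IsPureMap S.f.hom) (hZ : hUnitaryFlat A S.X₂) : hUnitaryFlat A S.X₃ := by
  have := hS.epi_g
  rw [hUnitaryFlat_iff] at hZ ⊢
  refine ⟨hi.isFlatModule_coker
    ((ShortComplex.ShortExact.moduleCat_exact_iff_function_exact _).1 hS.exact)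
    ((ModuleCat.epi_iff_surjective _).1 hS.epi_g) hZ.1, fun f => ?_⟩
  rw [← cancel_epi S.g, hZ.2 (S.g ≫ f), Limits.comp_zero]

end Purity

/-! ### Telescopes and h-unitary flat covers -/

section Telescope

variable {R : Type u} [Ring R] {P : Type u} [AddCommGroup P] [Module R P] (φ : P →ₗ[R] P)

/-- The endomorphism `e_i p ↦ e_{i+1} φ(p)` of `P^(ℕ)`. -/
noncomputable def telescopeShift : (ℕ →₀ P) →ₗ[R] (ℕ →₀ P) :=
  Finsupp.lsum ℕ fun i => (Finsupp.lsingle (i + 1)).comp φ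

@[simp] theorem telescopeShift_single (i : ℕ) (p : P) :
    telescopeShift φ (Finsupp.single i p) = Finsupp.single (i + 1) (φ p) := by
  simp [telescopeShift]

/-- The submodule of `P^(ℕ)` with quotient the colimit of `P → P → ⋯`. -/
noncomputable def telescopeRelations : Submodule R (ℕ →₀ P) :=
  LinearMap.range (LinearMap.id - telescopeShift φ)

theorem single_sub_single_mem_telescopeRelations (i j : ℕ) (p : P) :
    Finsupp.single i p - Finsupp.single (i + j) ((φ ^ j) p) ∈ telescopeRelations φ := by
  induction j with
  | zero => simp
  | succ j ih =>
    have : Finsupp.single (i + j) ((φ ^ j) p) - Finsupp.single (i + j + 1) (φ ((φ ^ j) p)) ∈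
        telescopeRelations φ := ⟨Finsupp.single (i + j) ((φ ^ j) p), by simp⟩
    convert add_mem ih this using 1
    rw [pow_succ', Module.End.mul_apply, ← add_assoc]
    abel

/-- A retraction of `P^{≤ m}` onto the relations it contains. -/
noncomputable def telescopeRetraction (m : ℕ) : (ℕ →₀ P) →ₗ[R] (ℕ →₀ P) :=
  Finsupp.lsum ℕ fun i =>
    if i ≤ m then Finsupp.lsingle i - (Finsupp.lsingle m).comp (φ ^ (m - i)) else 0

theorem telescopeRetraction_single {m i : ℕ} (h : i ≤ m) (p : P) :
    telescopeRetraction φ m (Finsupp.single i p) =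
      Finsupp.single i p - Finsupp.single m ((φ ^ (m - i)) p) := by
  simp [telescopeRetraction, h]

theorem telescopeRetraction_mem (m : ℕ) (z : ℕ →₀ P) :
    telescopeRetraction φ m z ∈ telescopeRelations φ := by
  induction z using Finsupp.induction_linear with
  | zero => simp
  | add x y hx hy => rw [map_add]; exact add_mem hx hy
  | single i p =>
    by_cases h : i ≤ m
    · rw [telescopeRetraction_single φ h]
      obtain ⟨j, rfl⟩ := Nat.exists_eq_add_of_le h
      rw [Nat.add_sub_cancel_left]
      exact single_sub_single_mem_telescopeRelations φ i j p
    · simp [telescopeRetraction, h]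

theorem telescopeRetraction_sub {m : ℕ} (y : ℕ →₀ P) (hy : ∀ i ∈ y.support, i < m) :
    telescopeRetraction φ m (y - telescopeShift φ y) = y - telescopeShift φ y := by
  suffices (telescopeRetraction φ m ∘ₗ (LinearMap.id - telescopeShift φ)) y =
      (LinearMap.id - telescopeShift φ : (ℕ →₀ P) →ₗ[R] (ℕ →₀ P)) y from this
  conv_lhs => rw [← Finsupp.sum_single y]
  conv_rhs => rw [← Finsupp.sum_single y]
  rw [Finsupp.sum, map_sum, map_sum]
  refine Finset.sum_congr rfl fun i hi => ?_
  have := hy i hi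
  rw [LinearMap.comp_apply, LinearMap.sub_apply, LinearMap.id_apply, telescopeShift_single,
    map_sub, telescopeRetraction_single φ this.le, telescopeRetraction_single φ this,
    ← Module.End.mul_apply, ← pow_succ, show m - (i + 1) + 1 = m - i by omega]
  abel

/-- The inclusion of the relations is locally split: a retraction at a late enough stage fixes the
given finitely many elements and, being linear, preserves the relations among the entries. -/
theorem solvesRelations_telescopeRelations : SolvesRelations (telescopeRelations φ) := by
  classical
  intro K hK
  have h (z : ℕ →₀ P) : ∃ m : ℕ, z ∈ telescopeRelations φ →
      ∀ m' ≥ m, telescopeRetraction φ m' z = z := by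
    by_cases hz : z ∈ telescopeRelations φ
    · obtain ⟨y, rfl⟩ := hz
      exact ⟨y.support.sup id + 1, fun _ m' hm' => telescopeRetraction_sub φ y fun i hi =>
        (Nat.lt_succ_of_le (Finset.le_sup (f := id) hi)).trans_le hm'⟩
    · exact ⟨0, fun h => absurd h hz⟩
  choose m hm using h
  let M := K.sup fun k => k.support.sup m
  let ρ : (ℕ →₀ P) →ₗ[R] telescopeRelations φ :=
    (telescopeRetraction φ M).codRestrict _ (telescopeRetraction_mem φ M)
  refine ⟨ρ, fun k hk z hz hzT => hm z hzT M ?_, fun k hk => ?_⟩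
  · exact (Finset.le_sup (f := m) hz).trans (Finset.le_sup (f := fun k => k.support.sup m) hk)
  · have : Finsupp.linearCombination R ρ k = ρ (Finsupp.linearCombination R id k) := by
      rw [Finsupp.apply_linearCombination, Function.comp_id]
    rw [this, hK k hk, map_zero]

/-- A map out of the colimit of `P → P → ⋯`. -/
noncomputable def telescopeDesc {M : Type u} [AddCommGroup M] [Module R M] (f : P →ₗ[R] M)
    (hf : ∀ p, f (φ p) = f p) : ((ℕ →₀ P) ⧸ telescopeRelations φ) →ₗ[R] M :=
  (telescopeRelations φ).liftQ (Finsupp.lsum ℕ fun _ => f) (by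
    rintro _ ⟨z, rfl⟩
    have : (Finsupp.lsum ℕ fun _ => f) ∘ₗ (LinearMap.id - telescopeShift φ) = 0 := by
      ext i p
      simp [hf, LinearMap.sub_apply, map_sub, -Finsupp.coe_lsum, Finsupp.lsum_single]
    exact LinearMap.congr_fun this z)

theorem telescopeDesc_single {M : Type u} [AddCommGroup M] [Module R M] (f : P →ₗ[R] M)
    (hf : ∀ p, f (φ p) = f p) (i : ℕ) (p : P) :
    telescopeDesc φ f hf (Submodule.Quotient.mk (Finsupp.single i p)) = f p := by
  simp [telescopeDesc]

/-- In the colimit the class of p at stage i equals that of φ p at stage i + 1, so everything comes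
from the image of `φ`. -/
theorem telescope_hom_eq_zero {M : Type u} [AddCommGroup M] [Module R M]
    (f : ((ℕ →₀ P) ⧸ telescopeRelations φ) →ₗ[R] M)
    (hf : ∀ i p, f (Submodule.Quotient.mk (Finsupp.single i (φ p))) = 0) : f = 0 := by
  refine Submodule.linearMap_qext _ ?_
  ext i p
  have h := (Submodule.Quotient.eq _).2 (single_sub_single_mem_telescopeRelations φ i 1 p)
  exact (congrArg f h).trans (hf _ _)

end Telescope

section EnoughFlats

variable {R : Type u} [Ring R] {A : TwoSidedIdeal R}

theorem exists_linearCombination_eq_of_surjective {M : Type u} [AddCommGroup M] [Module R M]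
    (h : Function.Surjective (evaluationMap A M)) (m : M) :
    ∃ y : M →₀ R, (∀ z, y z ∈ A) ∧ Finsupp.linearCombination R id y = m := by
  obtain ⟨x, rfl⟩ := h m
  induction x using QuotientAddGroup.induction_on with | _ x
  induction x using TensorProduct.induction_on with
  | zero => exact ⟨0, fun z => A.zero_mem, by simp⟩
  | tmul a m =>
    classical
    refine ⟨Finsupp.single m a, fun z => ?_, by simp; rfl⟩
    rw [Finsupp.single_apply]
    split_ifs
    exacts [a.2, A.zero_mem]
  | add x y hx hy =>
    obtain ⟨x', h1, h2⟩ := hx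
    obtain ⟨y', h1', h2'⟩ := hy
    exact ⟨x' + y', fun z => A.add_mem (h1 z) (h1' z), by
      rw [map_add, h2, h2', ← map_add]; rfl⟩

theorem annihilatedChars_smul (a : R) (ha : a ∈ A) (b : annihilatedChars A) : a • b = 0 := by
  refine CharDual.ext (R := R) fun r => ?_
  induction r using Submodule.Quotient.induction_on with | _ r
  exact (congrArg b ((Submodule.Quotient.mk_eq_zero _).2
    (LinearMap.mem_range.2 ⟨⟨r * a, A.mul_mem_left _ _ ha⟩, rfl⟩))).trans (map_zero _)

/-- Every h-unitary module is a quotient of an h-unitary flat module. -/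
theorem exists_epi_from_hUnitaryFlat {M : ModuleCat.{u} R} (hM : hUnitary A M) :
    ∃ (G : ModuleCat.{u} R) (p : G ⟶ M), hUnitaryFlat A G ∧ Epi p := by
  choose y hyA hy using exists_linearCombination_eq_of_surjective hM.1.2
  -- Since M = AM, each basis element m can be sent to a preimage of m with coefficients in `A`. The
  -- colimit along `φ` still maps onto `M`, and it equals `A` times itself.
  let φ : (M →₀ R) →ₗ[R] (M →₀ R) := Finsupp.linearCombination R y
  have hφ (p : M →₀ R) : Finsupp.linearCombination R id (φ p) =
      Finsupp.linearCombination R id p := by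
    have : (Finsupp.linearCombination R id).comp φ = Finsupp.linearCombination R (id : M → M) := by
      ext m
      simp [φ, hy]
    exact LinearMap.congr_fun this p
  refine ⟨ModuleCat.of R ((ℕ →₀ (M →₀ R)) ⧸ telescopeRelations φ),
    ModuleCat.ofHom (telescopeDesc φ (Finsupp.linearCombination R id) hφ), ?_, ?_⟩
  · rw [hUnitaryFlat_iff]
    refine ⟨(solvesRelations_telescopeRelations φ).isPureMap.isFlatModule_coker
      (LinearMap.exact_subtype_mkQ _)
      (Submodule.mkQ_surjective _) ?_, fun f => ?_⟩
    · have : Projective (ModuleCat.of R (ℕ →₀ (M →₀ R))) :=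
        (IsProjective.iff_projective _).1 inferInstance
      exact isFlatModule_of_projective (ModuleCat.of R (ℕ →₀ (M →₀ R)))
    · refine ModuleCat.hom_ext (telescope_hom_eq_zero φ f.hom fun i p => ?_)
      let g : (M →₀ R) →ₗ[R] annihilatedChars A :=
        f.hom.comp ((telescopeRelations φ).mkQ.comp (Finsupp.lsingle i))
      suffices g.comp φ = 0 from LinearMap.congr_fun this p
      ext m : 2
      change g (φ (Finsupp.single m 1)) = 0
      rw [show φ (Finsupp.single m 1) = y m by simp [φ], ← Finsupp.sum_single (y m), Finsupp.sum,
        map_sum]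
      refine Finset.sum_eq_zero fun z _ => ?_
      rw [← mul_one (y m z), ← smul_eq_mul, ← Finsupp.smul_single, map_smul,
        annihilatedChars_smul _ (hyA m z)]
  · rw [ModuleCat.epi_iff_surjective]
    intro m
    refine ⟨Submodule.Quotient.mk (Finsupp.single 0 (Finsupp.single m 1)), ?_⟩
    refine (telescopeDesc_single φ (Finsupp.linearCombination R id) hφ _ _).trans ?_
    simp

end EnoughFlats

end

/-! ### Cardinality bounds and small pure hulls -/

section Skolem

open Cardinal

theorem mk_finset_le_of_infinite {α : Type u} {κ : Cardinal.{u}} (hκ : ℵ₀ ≤ κ) (h : #α ≤ κ) :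
    #(Finset α) ≤ κ := by
  classical
  have : Function.Surjective (List.toFinset (α := α)) := fun s => ⟨s.toList, s.toList_toFinset⟩
  exact (mk_le_of_surjective this).trans ((mk_list_le_max α).trans (max_le hκ h))

theorem mk_finsupp_le_of_infinite {α β : Type u} [Zero β] {κ : Cardinal.{u}} (hκ : ℵ₀ ≤ κ)
    (h : #α ≤ κ) (h' : #β ≤ κ) : #(α →₀ β) ≤ κ :=
  (mk_le_of_injective (Finsupp.graph_injective α β)).trans (mk_finset_le_of_infinite hκ (by
    rw [mk_prod, lift_id, lift_id]
    exact (mul_le_mul' h h').trans (mul_eq_self hκ).le))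

variable {R : Type u} [Ring R]

theorem mk_span_le_of_infinite {M : Type u} [AddCommGroup M] [Module R M] {κ : Cardinal.{u}}
    (hκ : ℵ₀ ≤ κ) (hR : #R ≤ κ) {S : Set M} (hS : #S ≤ κ) : #(Submodule.span R S) ≤ κ := by
  have h : Function.Surjective ((Finsupp.linearCombination R ((↑) : S → M)).codRestrict
      (Submodule.span R S) fun x =>
        (Finsupp.mem_span_iff_linearCombination R S _).2 ⟨x, rfl⟩) := by
    rintro ⟨x, hx⟩
    obtain ⟨y, hy⟩ := (Finsupp.mem_span_iff_linearCombination R S x).1 hx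
    exact ⟨y, Subtype.ext hy⟩
  exact (mk_le_of_surjective h).trans (mk_finsupp_le_of_infinite hκ hS hR)

theorem mk_iUnion_le_of_infinite {α : Type u} {ι : Type u} {κ : Cardinal.{u}} (hκ : ℵ₀ ≤ κ)
    (hι : #ι ≤ κ) {f : ι → Set α} (hf : ∀ i, #(f i) ≤ κ) : #(⋃ i, f i) ≤ κ :=
  (mk_iUnion_le f).trans ((mul_le_mul' hι (ciSup_le' hf)).trans (mul_eq_self hκ).le)

/-- The purification operation: a submodule closed under it is pure. -/
theorem exists_skolem_solutions (Z : Type u) [AddCommGroup Z] [Module R Z] {κ : Cardinal.{u}}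
    (hκ : ℵ₀ ≤ κ) (hR : #R ≤ κ) : ∃ sol : List Z → Set Z, (∀ l, #(sol l) ≤ κ) ∧
      ∀ T : Submodule R Z, (∀ l : List Z, (∀ z ∈ l, z ∈ T) → sol l ⊆ T) → SolvesRelations T := by
  classical
  let Admissible (l : List Z) (F : Finset (ULift.{u} ℕ →₀ R)) (v : ULift.{u} ℕ → Z) : Prop :=
    (∀ i, ∀ z ∈ l[i]?, v ⟨i⟩ = z) ∧ ∀ k ∈ F, Finsupp.linearCombination R v k = 0
  -- A chosen solution of the system `F`, in variables numbered by ℕ, with first variables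
  -- prescribed by `l`. The default 0 is used only for unsolvable systems. Numbering the variables
  -- leaves at most κ systems.
  let s (l : List Z) (F : Finset (ULift.{u} ℕ →₀ R)) : ULift.{u} ℕ → Z :=
    if h : ∃ v, Admissible l F v then h.choose else 0
  refine ⟨fun l => ⋃ F, Set.range (s l F), fun l => ?_, fun T hT K hK => ?_⟩
  · refine mk_iUnion_le_of_infinite hκ ?_ fun F => ?_
    · exact mk_finset_le_of_infinite hκ (mk_finsupp_le_of_infinite hκ (by simpa using hκ) hR)
    · exact mk_range_le.trans (by simpa using hκ)
  · let S : Finset Z := K.sup Finsupp.support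
    let l := (S.filter (· ∈ T)).toList
    -- Entries from `T` come first, so each has the same index in `l` and in `L`, and an admissible
    -- solution keeps it fixed.
    let L := l ++ (S.filter (· ∉ T)).toList
    have hL (z) (hz : z ∈ S) : z ∈ L := by
      by_cases h : z ∈ T
      · exact List.mem_append_left _ (by simp [l, hz, h])
      · exact List.mem_append_right _ (by simp [hz, h])
    let e (z : Z) : ULift.{u} ℕ := ⟨L.idxOf z⟩
    let v₀ (i : ULift.{u} ℕ) : Z := L.getD i.down 0
    have hv₀ (z) (hz : z ∈ S) : v₀ (e z) = z := by
      simp only [v₀, e]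
      rw [List.getD_eq_getElem _ _ (List.idxOf_lt_length_of_mem (hL z hz)), List.getElem_idxOf]
    let F := K.image (Finsupp.mapDomain e)
    have hex : ∃ v, Admissible l F v := by
      refine ⟨v₀, fun i z hz => ?_, fun k hk => ?_⟩
      · obtain ⟨hi, rfl⟩ := List.getElem?_eq_some_iff.1 hz
        simp only [v₀, L]
        rw [List.getD_append _ _ _ _ hi, List.getD_eq_getElem]
      · obtain ⟨k, hkK, rfl⟩ := Finset.mem_image.1 hk
        rw [Finsupp.linearCombination_mapDomain, ← hK k hkK, Finsupp.linearCombination_apply,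
          Finsupp.linearCombination_apply]
        refine Finsupp.sum_congr fun z hz => ?_
        rw [Function.comp_apply, hv₀ z ((Finset.le_sup (f := Finsupp.support) hkK) hz), id]
    have hs : Admissible l F (s l F) := by
      simp only [s, dif_pos hex]
      exact hex.choose_spec
    have hmem (i) : s l F i ∈ T := hT l (fun z hz => by simp [l] at hz; exact hz.2)
      (Set.mem_iUnion.2 ⟨F, i, rfl⟩)
    refine ⟨fun z => ⟨s l F (e z), hmem _⟩, fun k hk z hz hzT => ?_, fun k hk => ?_⟩
    · have hzS : z ∈ S := (Finset.le_sup (f := Finsupp.support) hk) hz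
      have hzl : z ∈ l := by simp [l, hzS, hzT]
      refine hs.1 (L.idxOf z) z ?_
      rw [List.idxOf_append_of_mem hzl]
      exact List.getElem?_idxOf hzl
    · apply Subtype.val_injective
      have := hs.2 _ (Finset.mem_image_of_mem _ hk)
      rw [Finsupp.linearCombination_mapDomain] at this
      rw [← Submodule.subtype_apply, Finsupp.apply_linearCombination]
      exact this

/-- Every small family of elements of an exact complex lies in a small exact subcomplex whose cycles
are pure. -/
theorem exists_pure_hull (X : CochainComplex (ModuleCat.{u} R) ℤ)
    (hX : ∀ i j k, i + 1 = j → j + 1 = k → ∀ z : X.X j, X.d j k z = 0 → ∃ y, X.d i j y = z)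
    {κ : Cardinal.{u}} (hκ : ℵ₀ ≤ κ) (hR : #R ≤ κ)
    (S : ∀ n, Set (X.X n)) (hS : ∀ n, #(S n) ≤ κ) :
    ∃ U : ∀ n, Submodule R (X.X n), (∀ n, #(U n) ≤ κ) ∧ (∀ n, S n ⊆ U n) ∧
      (∀ i j, ∀ x ∈ U i, X.d i j x ∈ U j) ∧
      (∀ i j k, i + 1 = j → j + 1 = k → ∀ z ∈ U j, X.d j k z = 0 → ∃ y ∈ U i, X.d i j y = z) ∧
      ∀ n, SolvesRelations ((U n).comap (LinearMap.ker (X.d n (n + 1)).hom).subtype) := by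
  classical
  choose sol hsol hsol' using fun n : ℤ =>
    exists_skolem_solutions (R := R) (LinearMap.ker (X.d n (n + 1)).hom) hκ hR
  let σ (i j : ℤ) (z : X.X j) : X.X i := if h : ∃ y, X.d i j y = z then h.choose else 0
  have hσ (i j : ℤ) (z : X.X j) (h : ∃ y, X.d i j y = z) : X.d i j (σ i j z) = z := by
    simp only [σ, dif_pos h]
    exact h.choose_spec
  -- One round adjoins differentials, chosen preimages under the differential, and solutions of
  -- linear systems in the cycles. The union of ω rounds is closed under all three operations.
  let step (T : ∀ n, Submodule R (X.X n)) (n : ℤ) : Submodule R (X.X n) :=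
    Submodule.span R (T n ∪ (⋃ i : ULift.{u} ℤ, X.d i.down n '' T i.down) ∪
      (⋃ i : ULift.{u} ℤ, σ n i.down '' T i.down) ∪
      ⋃ l : List ((T n).comap (LinearMap.ker (X.d n (n + 1)).hom).subtype),
        Subtype.val '' sol n (l.map Subtype.val))
  have le_step (T) (n : ℤ) : T n ≤ step T n := fun x hx =>
    Submodule.subset_span (Or.inl (Or.inl (Or.inl hx)))
  have card_step (T : ∀ n, Submodule R (X.X n)) (hT : ∀ n, #(T n) ≤ κ) (n : ℤ) :
      #(step T n) ≤ κ := by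
    have hZ : #(ULift.{u} ℤ) ≤ κ := by simpa using hκ
    refine mk_span_le_of_infinite hκ hR ?_
    refine (mk_union_le _ _).trans (add_le_of_le hκ ((mk_union_le _ _).trans (add_le_of_le hκ
      ((mk_union_le _ _).trans (add_le_of_le hκ (hT n) ?_)) ?_)) ?_)
    · exact mk_iUnion_le_of_infinite hκ hZ fun i => mk_image_le.trans (hT _)
    · exact mk_iUnion_le_of_infinite hκ hZ fun i => mk_image_le.trans (hT _)
    · refine mk_iUnion_le_of_infinite hκ ((mk_list_le_max _).trans (max_le hκ ?_))
        fun l => mk_image_le.trans (hsol n _)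
      exact (mk_le_of_injective (f := fun z => (⟨z.1.1, z.2⟩ : T n)) fun a b h =>
        Subtype.ext (Subtype.ext (congrArg (fun z => z.1) h))).trans (hT n)
  let T (k : ℕ) : ∀ n, Submodule R (X.X n) := step^[k] fun n => Submodule.span R (S n)
  have hTsucc (k : ℕ) : T (k + 1) = step (T k) := Function.iterate_succ_apply' _ _ _
  have hTcard (k : ℕ) : ∀ n, #(T k n) ≤ κ := by
    induction k with
    | zero => exact fun n => mk_span_le_of_infinite hκ hR (hS n)
    | succ k ih => rw [hTsucc]; exact card_step _ ih
  let C (n : ℤ) : ℕ →o Submodule R (X.X n) :=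
    ⟨fun k => T k n, monotone_nat_of_le_succ fun k => by rw [hTsucc]; exact le_step _ n⟩
  have hmem (n : ℤ) (x : X.X n) : x ∈ (⨆ k, C n k) ↔ ∃ k, x ∈ T k n :=
    Submodule.mem_iSup_of_chain (C n) x
  have hsub (n : ℤ) (k : ℕ) : T (k + 1) n ≤ ⨆ k, C n k := le_iSup (fun k => C n k) (k + 1)
  refine ⟨fun n => ⨆ k, C n k, fun n => ?_, fun n x hx => ?_, fun i j x hx => ?_,
    fun i j k hij hjk z hz hdz => ?_, fun n => hsol' n _ fun l hl z hz => ?_⟩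
  · have : ((⨆ k, C n k : Submodule R (X.X n)) : Set (X.X n)) =
        ⋃ k : ULift.{u} ℕ, (T k.down n : Set (X.X n)) := by
      ext x
      simp only [SetLike.mem_coe, hmem, Set.mem_iUnion]
      exact ⟨fun ⟨k, hk⟩ => ⟨⟨k⟩, hk⟩, fun ⟨k, hk⟩ => ⟨k.down, hk⟩⟩
    change #((⨆ k, C n k : Submodule R (X.X n)) : Set (X.X n)) ≤ κ
    rw [this]
    exact mk_iUnion_le_of_infinite hκ (by simpa using hκ) fun k => hTcard _ _
  · exact (hmem _ _).2 ⟨0, Submodule.subset_span hx⟩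
  · obtain ⟨k, hk⟩ := (hmem _ _).1 hx
    refine hsub j k ?_
    rw [hTsucc]
    exact Submodule.subset_span (Or.inl (Or.inl (Or.inr (Set.mem_iUnion.2 ⟨⟨i⟩, x, hk, rfl⟩))))
  · obtain ⟨m, hm⟩ := (hmem _ _).1 hz
    refine ⟨σ i j z, hsub i m ?_, hσ i j z (hX i j k hij hjk z hdz)⟩
    rw [hTsucc]
    exact Submodule.subset_span (Or.inl (Or.inr (Set.mem_iUnion.2 ⟨⟨j⟩, z, hm, rfl⟩)))
  -- A finite list of parameters already lies in one stage, so the next stage contains the required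
  -- solutions.
  · have : ∃ k, ∀ z ∈ l, z.1 ∈ T k n := by
      clear hz
      induction l with
      | nil => exact ⟨0, by simp⟩
      | cons a l ih =>
        obtain ⟨k, hk⟩ := ih fun z hz => hl z (List.mem_cons_of_mem _ hz)
        obtain ⟨k', hk'⟩ := (hmem n a.1).1 (hl a List.mem_cons_self)
        refine ⟨max k k', fun z hz => ?_⟩
        rcases List.mem_cons.1 hz with rfl | hz
        · exact (C n).monotone (le_max_right k k') hk'
        · exact (C n).monotone (le_max_left k k') (hk z hz)
    obtain ⟨k, hk⟩ := this
    refine hsub n k ?_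
    rw [hTsucc]
    refine Submodule.subset_span (Or.inr (Set.mem_iUnion.2
      ⟨l.attach.map fun z => ⟨z.1, hk z.1 z.2⟩, z, ?_, rfl⟩))
    convert hz using 2
    rw [List.map_map]
    exact List.attach_map_subtype_val l

end Skolem

/-! ### Cycles and images in complexes -/

section CycleLemmas

attribute [local irreducible] hUnitary

variable {R : Type u} [Ring R] {X Y : CochainComplex (ModuleCat.{u} R) ℤ}

theorem hom_d_apply (f : X ⟶ Y) (i j : ℤ) (x : X.X i) :
    Y.d i j (f.f i x) = f.f j (X.d i j x) :=
  congrArg (fun c => c.hom x) (f.comm i j)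

theorem d_d_apply (X : CochainComplex (ModuleCat.{u} R) ℤ) (i j k : ℤ) (x : X.X i) :
    X.d j k (X.d i j x) = 0 :=
  congrArg (fun c => c.hom x) (X.d_comp_d i j k)

/-- The map induced on cycles. -/
def cycleMap (f : X ⟶ Y) (n : ℤ) : cycleModule X n ⟶ cycleModule Y n :=
  ModuleCat.ofHom ((f.f n).hom.restrict fun x hx => by
    rw [LinearMap.mem_ker] at hx ⊢
    exact (hom_d_apply f n (n + 1) x).trans ((congrArg _ hx).trans (map_zero _)))

/-- A retract of complexes induces a retract of cycles. -/
def Retract.cycles (r : Retract X Y) (n : ℤ) : Retract (cycleModule X n) (cycleModule Y n) where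
  i := cycleMap r.i n
  r := cycleMap r.r n
  retract := by
    exact ModuleCat.hom_ext (LinearMap.ext fun z =>
      Subtype.ext (congrArg (fun c => (c.f n).hom z.1) r.retract))

theorem acyclic_iff : X.Acyclic ↔ ∀ i j k, i + 1 = j → j + 1 = k → ∀ z : X.X j,
    X.d j k z = 0 → ∃ y, X.d i j y = z := by
  constructor
  · rintro h i j k rfl rfl z hz
    have := (HomologicalComplex.exactAt_iff' X i (i + 1) (i + 1 + 1) (by simp) (by simp)).1 (h _)
    exact (ShortComplex.moduleCat_exact_iff _).1 this z hz
  · intro h j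
    rw [HomologicalComplex.exactAt_iff' X (j - 1) j (j + 1) (by simp) (by simp),
      ShortComplex.moduleCat_exact_iff]
    exact h _ _ _ (by omega) rfl

theorem acyclic_of_retract (r : Retract X Y) (h : Y.Acyclic) : X.Acyclic := by
  rw [acyclic_iff] at h ⊢
  intro i j k hij hjk z hz
  obtain ⟨y, hy⟩ := h i j k hij hjk (r.i.f j z) (by rw [hom_d_apply, hz, map_zero])
  refine ⟨r.r.f i y, ?_⟩
  rw [hom_d_apply, hy]
  exact congrArg (fun c => (c.f j).hom z) r.retract

variable (X) in
/-- The sequence `0 → ker dⁿ → Xⁿ → ker dⁿ⁺¹ → 0`. -/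
def cycleSequence (n : ℤ) : ShortComplex (ModuleCat.{u} R) :=
  ShortComplex.mk (X₁ := cycleModule X n) (X₂ := X.X n) (X₃ := cycleModule X (n + 1))
    (ModuleCat.ofHom (LinearMap.ker (X.d n (n + 1)).hom).subtype)
    (ModuleCat.ofHom ((X.d n (n + 1)).hom.codRestrict _ fun x => d_d_apply X _ _ _ x))
    (ModuleCat.hom_ext (LinearMap.ext fun x => Subtype.ext x.2))

theorem shortExact_cycleSequence (h : X.Acyclic) (n : ℤ) : (cycleSequence X n).ShortExact where
  exact := by
    rw [ShortComplex.moduleCat_exact_iff]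
    exact fun x hx => ⟨⟨x, congrArg Subtype.val hx⟩, rfl⟩
  mono_f := (ModuleCat.mono_iff_injective _).2 (Submodule.subtype_injective _)
  epi_g := by
    rw [ModuleCat.epi_iff_surjective]
    rintro ⟨z, hz⟩
    obtain ⟨y, hy⟩ := acyclic_iff.1 h n _ _ rfl rfl z hz
    exact ⟨y, Subtype.ext hy⟩

variable (X) in
/-- The sequence `0 → ker dⁿ → Xⁿ → Im dⁿ → 0`. -/
def imageSequence (n : ℤ) : ShortComplex (ModuleCat.{u} R) :=
  ShortComplex.mk (X₁ := cycleModule X n) (X₂ := X.X n) (X₃ := imageModule X n)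
    (ModuleCat.ofHom (LinearMap.ker (X.d n (n + 1)).hom).subtype)
    (ModuleCat.ofHom (X.d n (n + 1)).hom.rangeRestrict)
    (ModuleCat.hom_ext (LinearMap.ext fun x => Subtype.ext x.2))

theorem shortExact_imageSequence (n : ℤ) : (imageSequence X n).ShortExact where
  exact := by
    rw [ShortComplex.moduleCat_exact_iff]
    exact fun x hx => ⟨⟨x, congrArg Subtype.val hx⟩, rfl⟩
  mono_f := (ModuleCat.mono_iff_injective _).2 (Submodule.subtype_injective _)
  epi_g := by
    rw [ModuleCat.epi_iff_surjective]
    rintro ⟨_, x, rfl⟩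
    exact ⟨x, rfl⟩

variable {A : TwoSidedIdeal R}

/-- The image is the cokernel of the inclusion of the cycles, so two out of three covers it. -/
theorem hUnitaryComplex_iff :
    hUnitaryComplex A X ↔ ∀ n, hUnitary A (X.X n) ∧ hUnitary A (cycleModule X n) :=
  ⟨fun h n => ⟨(h n).1, (h n).2.1⟩, fun h n => ⟨(h n).1, (h n).2,
    hUnitary_X₃ (shortExact_imageSequence (X := X) n) (h n).2 (h n).1⟩⟩

theorem hUnitaryFlatComplex_iff :
    hUnitaryFlatComplex A X ↔ X.Acyclic ∧ ∀ n, hUnitaryFlat A (cycleModule X n) :=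
  ⟨fun h => h.2, fun h => ⟨hUnitaryComplex_iff.2 fun n =>
    ⟨(hUnitaryFlat_X₂ (shortExact_cycleSequence h.1 n) (h.2 n) (h.2 (n + 1))).1, (h.2 n).1⟩, h⟩⟩

theorem hUnitaryFlatComplex.flat (h : hUnitaryFlatComplex A X) (n : ℤ) : hUnitaryFlat A (X.X n) :=
  hUnitaryFlat_X₂ (shortExact_cycleSequence h.2.1 n) (h.2.2 n) (h.2.2 (n + 1))

theorem hUnitaryFlatComplex_of_retract (r : Retract X Y) (h : hUnitaryFlatComplex A Y) :
    hUnitaryFlatComplex A X :=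
  hUnitaryFlatComplex_iff.2 ⟨acyclic_of_retract r h.2.1, fun n =>
    hUnitaryFlat_of_retract (Retract.cycles r n) (h.2.2 n)⟩

theorem hUnitaryFlatComplex_of_iso (e : X ≅ Y) (h : hUnitaryFlatComplex A Y) :
    hUnitaryFlatComplex A X :=
  hUnitaryFlatComplex_of_retract (Retract.ofIso e) h

end CycleLemmas

/-! ### Short exact sequences of complexes -/

section ShortExactComplexes

attribute [local irreducible] hUnitary

variable {R : Type u} [Ring R] {S : ShortComplex (CochainComplex (ModuleCat.{u} R) ℤ)}

theorem shortExact_eval (hS : S.ShortExact) (n : ℤ) :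
    (S.map (HomologicalComplex.eval _ _ n)).ShortExact :=
  hS.map_of_exact (HomologicalComplex.eval _ _ n)

theorem shortExact_f_injective (hS : S.ShortExact) (n : ℤ) : Function.Injective (S.f.f n) :=
  (ModuleCat.mono_iff_injective _).1 (shortExact_eval hS n).mono_f

theorem shortExact_g_surjective (hS : S.ShortExact) (n : ℤ) : Function.Surjective (S.g.f n) :=
  (ModuleCat.epi_iff_surjective _).1 (shortExact_eval hS n).epi_g

theorem shortExact_exists (hS : S.ShortExact) (n : ℤ) (x : S.X₂.X n) (hx : S.g.f n x = 0) :
    ∃ y, S.f.f n y = x :=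
  (ShortComplex.moduleCat_exact_iff _).1 (shortExact_eval hS n).exact x hx

theorem g_f_apply (S : ShortComplex (CochainComplex (ModuleCat.{u} R) ℤ)) (n : ℤ) (y : S.X₁.X n) :
    S.g.f n (S.f.f n y) = 0 :=
  congrArg (fun c => (c.f n).hom y) S.zero

variable (S) in
/-- The sequence of cycles of a short complex of complexes. -/
def cyclesShortComplex (n : ℤ) : ShortComplex (ModuleCat.{u} R) :=
  ShortComplex.mk (cycleMap S.f n) (cycleMap S.g n) (ModuleCat.hom_ext
    (LinearMap.ext fun z => Subtype.ext (g_f_apply S n z.1)))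

theorem shortExact_cyclesShortComplex (hS : S.ShortExact) (n : ℤ)
    (h : Function.Surjective (cycleMap S.g n)) : (cyclesShortComplex S n).ShortExact where
  exact := by
    rw [ShortComplex.moduleCat_exact_iff]
    rintro ⟨z, hz⟩ hgz
    obtain ⟨y, rfl⟩ := shortExact_exists hS n z (congrArg Subtype.val hgz)
    refine ⟨⟨y, ?_⟩, rfl⟩
    refine shortExact_f_injective hS (n + 1) ?_
    rw [map_zero]
    exact (hom_d_apply S.f n (n + 1) y).symm.trans hz
  mono_f := (ModuleCat.mono_iff_injective _).2 fun a b hab =>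
    Subtype.ext (shortExact_f_injective hS n (congrArg Subtype.val hab))
  epi_g := (ModuleCat.epi_iff_surjective _).2 h

/-- The differential of a lift of a cycle is a cycle of X₁, hence a boundary there; subtracting a
primitive turns the lift into a cycle. -/
theorem cycleMap_surjective_of_acyclic_X₁ (hS : S.ShortExact) (h : S.X₁.Acyclic) (n : ℤ) :
    Function.Surjective (cycleMap S.g n) := by
  rintro ⟨z, hz⟩
  obtain ⟨x, rfl⟩ := shortExact_g_surjective hS n z
  obtain ⟨v, hv⟩ := shortExact_exists hS (n + 1) (S.X₂.d n (n + 1) x) (by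
    rw [← hom_d_apply]; exact hz)
  obtain ⟨w, rfl⟩ := acyclic_iff.1 h n (n + 1) (n + 1 + 1) rfl rfl v (by
    apply shortExact_f_injective hS
    rw [← hom_d_apply, hv, d_d_apply, map_zero])
  refine ⟨⟨x - S.f.f n w, ?_⟩, Subtype.ext ?_⟩
  · rw [LinearMap.mem_ker, map_sub, sub_eq_zero, ← hv]
    exact (hom_d_apply S.f n (n + 1) w).symm
  · change S.g.f n (x - S.f.f n w) = S.g.f n x
    rw [map_sub, g_f_apply, sub_zero]

theorem cycleMap_surjective_of_acyclic_X₃ (hS : S.ShortExact) (h : S.X₃.Acyclic) (n : ℤ) :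
    Function.Surjective (cycleMap S.g n) := by
  rintro ⟨z, hz⟩
  obtain ⟨x, rfl⟩ := acyclic_iff.1 h (n - 1) n (n + 1) (by omega) rfl z hz
  obtain ⟨y, rfl⟩ := shortExact_g_surjective hS _ x
  exact ⟨⟨S.X₂.d _ n y, d_d_apply _ _ _ _ _⟩, Subtype.ext (hom_d_apply S.g _ _ y).symm⟩

theorem acyclic_X₂ (hS : S.ShortExact) (h₁ : S.X₁.Acyclic) (h₃ : S.X₃.Acyclic) :
    S.X₂.Acyclic := by
  rw [acyclic_iff] at *
  intro i j k hij hjk z hz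
  obtain ⟨x, hx⟩ := h₃ i j k hij hjk (S.g.f j z) (by rw [hom_d_apply, hz, map_zero])
  obtain ⟨x, rfl⟩ := shortExact_g_surjective hS _ x
  obtain ⟨y, hy⟩ := shortExact_exists hS j (z - S.X₂.d i j x) (by
    rw [map_sub, ← hx, hom_d_apply, sub_self])
  obtain ⟨w, rfl⟩ := h₁ i j k hij hjk y (by
    apply shortExact_f_injective hS
    rw [← hom_d_apply, hy, map_sub, hz, d_d_apply, sub_zero, map_zero])
  refine ⟨x + S.f.f i w, ?_⟩
  rw [map_add, hom_d_apply, hy, add_sub_cancel]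

theorem acyclic_X₃ (hS : S.ShortExact) (h₁ : S.X₁.Acyclic) (h₂ : S.X₂.Acyclic) :
    S.X₃.Acyclic := by
  have := cycleMap_surjective_of_acyclic_X₁ hS h₁
  rw [acyclic_iff] at *
  rintro i j _ hij rfl z hz
  obtain ⟨⟨x, hx⟩, hxz⟩ := this j ⟨z, hz⟩
  obtain ⟨y, rfl⟩ := h₂ i j _ hij rfl x hx
  exact ⟨S.g.f i y, (hom_d_apply _ _ _ _).trans (congrArg Subtype.val hxz)⟩

variable {A : TwoSidedIdeal R}

theorem hUnitaryFlatComplex_X₂ (hS : S.ShortExact) (h₁ : hUnitaryFlatComplex A S.X₁)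
    (h₃ : hUnitaryFlatComplex A S.X₃) : hUnitaryFlatComplex A S.X₂ :=
  hUnitaryFlatComplex_iff.2 ⟨acyclic_X₂ hS h₁.2.1 h₃.2.1, fun n => hUnitaryFlat_X₂
    (shortExact_cyclesShortComplex hS n (cycleMap_surjective_of_acyclic_X₁ hS h₁.2.1 n))
    (h₁.2.2 n) (h₃.2.2 n)⟩

/-- An extension of an h-unitary flat complex by a complex of `ℂ(𝔐(A))` lies in `ℂ(𝔐(A))`. -/
theorem hUnitaryComplex_X₂ (hS : S.ShortExact) (h₁ : hUnitaryComplex A S.X₁)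
    (h₃ : hUnitaryFlatComplex A S.X₃) : hUnitaryComplex A S.X₂ :=
  hUnitaryComplex_iff.2 fun n => ⟨hUnitary_X₂ (shortExact_eval hS n) (h₁ n).1 (h₃.1 n).1,
    hUnitary_X₂ (shortExact_cyclesShortComplex hS n
      (cycleMap_surjective_of_acyclic_X₃ hS h₃.2.1 n)) (h₁ n).2.1 (h₃.1 n).2.1⟩

theorem hUnitaryFlatComplex_of_pure (hS : S.ShortExact) (h₁ : S.X₁.Acyclic)
    (hpure : ∀ n, IsPureMap (cycleMap S.f n).hom) (h₂ : hUnitaryFlatComplex A S.X₂) :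
    hUnitaryFlatComplex A S.X₁ ∧ hUnitaryFlatComplex A S.X₃ :=
  ⟨hUnitaryFlatComplex_iff.2 ⟨h₁, fun n => (hpure n).mem_hUnitaryFlat (h₂.2.2 n)⟩,
    hUnitaryFlatComplex_iff.2 ⟨acyclic_X₃ hS h₁ h₂.2.1, fun n =>
      IsPureMap.mem_hUnitaryFlat_X₃ (shortExact_cyclesShortComplex hS n
        (cycleMap_surjective_of_acyclic_X₁ hS h₁ n)) (hpure n) (h₂.2.2 n)⟩⟩

/-- The kernel of an epimorphism from an exact complex. -/
theorem hUnitaryComplex_X₁ (hS : S.ShortExact) (h₂ : hUnitaryFlatComplex A S.X₂)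
    (h₃ : hUnitaryComplex A S.X₃) : hUnitaryComplex A S.X₁ := by
  refine hUnitaryComplex_iff.2 fun n =>
    ⟨hUnitary_X₁ (shortExact_eval hS n) (h₂.1 n).1 (h₃ n).1, ?_⟩
  obtain ⟨n, rfl⟩ : ∃ m, n = m + 1 := ⟨n - 1, by omega⟩
  -- Cycles of the exact complex X₂ are boundaries, so their image in X₃ is Im d rather than all the
  -- cycles. This is where h-unitarity of the images of X₃ enters.
  let p : cycleModule S.X₂ (n + 1) ⟶ imageModule S.X₃ n :=
    ModuleCat.ofHom (((S.g.f (n + 1)).hom.comp (Submodule.subtype _)).codRestrict _ (by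
      rintro ⟨z, hz⟩
      obtain ⟨y, rfl⟩ := acyclic_iff.1 h₂.2.1 n _ _ rfl rfl z hz
      exact ⟨S.g.f n y, hom_d_apply S.g _ _ y⟩))
  have hT : (ShortComplex.mk (cycleMap S.f (n + 1)) p (ModuleCat.hom_ext
      (LinearMap.ext fun z => Subtype.ext (g_f_apply S _ z.1)))).ShortExact :=
    { exact := by
        rw [ShortComplex.moduleCat_exact_iff]
        rintro ⟨z, hz⟩ hgz
        obtain ⟨y, rfl⟩ := shortExact_exists hS _ z (congrArg Subtype.val hgz)
        refine ⟨⟨y, ?_⟩, rfl⟩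
        refine shortExact_f_injective hS _ ?_
        rw [map_zero]
        exact (hom_d_apply S.f _ _ y).symm.trans hz
      mono_f := (ModuleCat.mono_iff_injective _).2 fun a b hab =>
        Subtype.ext (shortExact_f_injective hS _ (congrArg Subtype.val hab))
      epi_g := by
        rw [ModuleCat.epi_iff_surjective]
        rintro ⟨_, x, rfl⟩
        obtain ⟨y, rfl⟩ := shortExact_g_surjective hS _ x
        exact ⟨⟨S.X₂.d _ _ y, d_d_apply _ _ _ _ _⟩, Subtype.ext (hom_d_apply S.g _ _ y).symm⟩ }
  exact hUnitary_X₁ hT (h₂.1 _).2.1 (h₃ n).2.2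

end ShortExactComplexes

/-! ### A lifting criterion, and maps into spheres and disks -/

section Lifting

/-- Extend the upper map to X₂; the failure of the lower triangle factors through X₃, where it can
be lifted and added back. -/
theorem hasLiftingProperty_of_shortExact {𝒜 : Type v} [Category.{w} 𝒜] [Abelian 𝒜]
    {S : ShortComplex 𝒜} (hS : S.ShortExact) {E Q : 𝒜} (p : E ⟶ Q)
    (hE : ∀ a : S.X₁ ⟶ E, ∃ b : S.X₂ ⟶ E, S.f ≫ b = a)
    (hQ : ∀ q : S.X₃ ⟶ Q, ∃ e : S.X₃ ⟶ E, e ≫ p = q) : HasLiftingProperty S.f p where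
  sq_hasLift {a q} sq := by
    obtain ⟨b, hb⟩ := hE a
    have := hS.epi_g
    have hz : S.f ≫ (q - b ≫ p) = 0 := by
      rw [Preadditive.comp_sub, ← sq.w, ← hb, Category.assoc, sub_self]
    obtain ⟨e, he⟩ := hQ (hS.exact.desc _ hz)
    refine ⟨⟨b + S.g ≫ e, ?_, ?_⟩⟩
    · rw [Preadditive.comp_add, hb, S.zero_assoc, Limits.zero_comp, add_zero]
    · rw [Preadditive.add_comp, Category.assoc, he, hS.exact.g_desc, add_sub_cancel]

end Lifting

section Spheres

variable {R : Type u} [Ring R]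

/-- The complex `C` concentrated in degree `n`. -/
noncomputable abbrev sphere (n : ℤ) (C : ModuleCat.{u} R) : CochainComplex (ModuleCat.{u} R) ℤ :=
  (HomologicalComplex.single _ _ n).obj C

theorem upRel (n : ℤ) : (ComplexShape.up ℤ).Rel n (n + 1) := rfl

/-- The complex `C → C` concentrated in degrees `n` and `n + 1`. -/
noncomputable abbrev disk (n : ℤ) (C : ModuleCat.{u} R) : CochainComplex (ModuleCat.{u} R) ℤ :=
  HomologicalComplex.double (𝟙 C) (upRel n)

/-- The bottom component of a disk. -/
noncomputable abbrev diskIso₀ (n : ℤ) (C : ModuleCat.{u} R) : (disk n C).X n ≅ C :=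
  HomologicalComplex.doubleXIso₀ (𝟙 C) (upRel n)

/-- The top component of a disk. -/
noncomputable abbrev diskIso₁ (n : ℤ) (C : ModuleCat.{u} R) : (disk n C).X (n + 1) ≅ C :=
  HomologicalComplex.doubleXIso₁ (𝟙 C) (upRel n) (by simp)

theorem disk_d (n : ℤ) (C : ModuleCat.{u} R) :
    (disk n C).d n (n + 1) = (diskIso₀ n C).hom ≫ (diskIso₁ n C).inv := by
  rw [HomologicalComplex.double_d (𝟙 C) (upRel n) (by simp), Category.id_comp]

theorem disk_d_eq_zero {n i : ℤ} (h : i ≠ n) (C : ModuleCat.{u} R) (j : ℤ) :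
    (disk n C).d i j = 0 :=
  HomologicalComplex.double_d_eq_zero₀ _ _ _ _ h

variable {X : CochainComplex (ModuleCat.{u} R) ℤ} {n : ℤ} {C C' : ModuleCat.{u} R}

/-- Maps to a sphere. -/
noncomputable def toSphere (f : X.X n ⟶ C) (hf : ∀ i, (ComplexShape.up ℤ).Rel i n → X.d i n ≫ f = 0) :
    X ⟶ sphere n C :=
  HomologicalComplex.mkHomToSingle f hf

/-- The component of a map to a sphere. -/
noncomputable def ofToSphere (q : X ⟶ sphere n C) : X.X n ⟶ C :=
  q.f n ≫ (HomologicalComplex.singleObjXSelf _ n C).hom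

@[simp] theorem ofToSphere_toSphere (f : X.X n ⟶ C) (hf) : ofToSphere (toSphere f hf) = f := by
  rw [ofToSphere, toSphere, HomologicalComplex.mkHomToSingle_f, Category.assoc,
    Iso.inv_hom_id, Category.comp_id]

theorem d_ofToSphere (q : X ⟶ sphere n C) (i : ℤ) : X.d i n ≫ ofToSphere q = 0 := by
  rw [ofToSphere, ← q.comm_assoc]
  simp

theorem comp_ofToSphere {Y : CochainComplex (ModuleCat.{u} R) ℤ} (g : Y ⟶ X)
    (q : X ⟶ sphere n C) : ofToSphere (g ≫ q) = g.f n ≫ ofToSphere q := by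
  simp [ofToSphere]

theorem ofToSphere_comp (q : X ⟶ sphere n C) (f : C ⟶ C') :
    ofToSphere (q ≫ (HomologicalComplex.single _ _ n).map f) = ofToSphere q ≫ f := by
  rw [ofToSphere, ofToSphere, HomologicalComplex.comp_f, HomologicalComplex.single_map_f_self]
  simp

theorem toSphere_ext {q q' : X ⟶ sphere n C} (h : ofToSphere q = ofToSphere q') : q = q' := by
  apply HomologicalComplex.to_single_hom_ext
  rwa [ofToSphere, ofToSphere, cancel_mono] at h

/-- Maps to a disk. -/
noncomputable def toDisk (g : X.X (n + 1) ⟶ C) : X ⟶ disk n C where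
  f k :=
    if hk₀ : k = n then
      X.d k (n + 1) ≫ g ≫ (diskIso₀ n C).inv ≫ eqToHom (congrArg (disk n C).X hk₀.symm)
    else if hk₁ : k = n + 1 then
      eqToHom (congrArg X.X hk₁) ≫ g ≫ (diskIso₁ n C).inv ≫
        eqToHom (congrArg (disk n C).X hk₁.symm)
    else 0
  comm' k₀ k₁ hk := by
    obtain rfl : k₀ + 1 = k₁ := hk
    by_cases h₀ : k₀ = n
    · subst h₀
      rw [dif_pos rfl, dif_neg (by simp), dif_pos rfl, disk_d]
      simp
    · rw [dif_neg h₀, disk_d_eq_zero h₀, Limits.comp_zero]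
      by_cases h₁ : k₀ + 1 = n
      · subst h₁
        simp
      · rw [dif_neg h₁, dif_neg (by omega), Limits.comp_zero]

/-- The top component of a map to a disk. -/
noncomputable def ofToDisk (q : X ⟶ disk n C) : X.X (n + 1) ⟶ C :=
  q.f (n + 1) ≫ (diskIso₁ n C).hom

@[simp] theorem ofToDisk_toDisk (g : X.X (n + 1) ⟶ C) : ofToDisk (toDisk g) = g := by
  simp [ofToDisk, toDisk]

theorem f_eq_of_toDisk (q : X ⟶ disk n C) :
    q.f n ≫ (diskIso₀ n C).hom = X.d n (n + 1) ≫ ofToDisk q := by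
  rw [ofToDisk, ← q.comm_assoc, disk_d]
  simp

theorem toDisk_ext {q q' : X ⟶ disk n C} (h : ofToDisk q = ofToDisk q') : q = q' := by
  apply HomologicalComplex.to_double_hom_ext
  · rw [← cancel_mono (diskIso₀ n C).hom, f_eq_of_toDisk, f_eq_of_toDisk, h]
  · rwa [ofToDisk, ofToDisk, cancel_mono] at h

theorem comp_ofToDisk {Y : CochainComplex (ModuleCat.{u} R) ℤ} (g : Y ⟶ X)
    (q : X ⟶ disk n C) : ofToDisk (g ≫ q) = g.f (n + 1) ≫ ofToDisk q := by
  simp [ofToDisk]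

variable (n C) in
/-- The projection of a disk onto its bottom sphere. -/
noncomputable def diskToSphere : disk n C ⟶ sphere n C :=
  toSphere (diskIso₀ n C).hom fun i hi => by
    rw [disk_d_eq_zero (by have : i + 1 = n := hi; omega), Limits.zero_comp]

theorem ofToSphere_diskToSphere (q : X ⟶ disk n C) :
    ofToSphere (q ≫ diskToSphere n C) = X.d n (n + 1) ≫ ofToDisk q := by
  rw [comp_ofToSphere, diskToSphere, ofToSphere_toSphere, f_eq_of_toDisk]

end Spheres

/-! ### Flat complexes characterized by lifting properties -/

section FlatComplexLifts

open Abelian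

variable {R : Type u} [Ring R] {A : TwoSidedIdeal R} {X : CochainComplex (ModuleCat.{u} R) ℤ}

variable (X) in
/-- The differential, as a map to the cycles. -/
def toCycles (n : ℤ) : X.X n ⟶ cycleModule X (n + 1) := (cycleSequence X n).g

variable (X) in
theorem d_toCycles (i n : ℤ) : X.d i n ≫ toCycles X n = 0 :=
  ModuleCat.hom_ext (LinearMap.ext fun y => Subtype.ext (d_d_apply X i n (n + 1) y))

theorem epi_toCycles (hX : X.Acyclic) (n : ℤ) : Epi (toCycles X n) :=
  (shortExact_cycleSequence hX n).epi_g

theorem exists_comp_d_of_acyclic (hX : X.Acyclic) {i j : ℤ} (hij : i + 1 = j)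
    {C : ModuleCat.{u} R} (h : X.X j ⟶ C) (w : X.d i j ≫ h = 0) :
    ∃ g : cycleModule X (j + 1) ⟶ C, toCycles X j ≫ g = h := by
  have hS := shortExact_cycleSequence hX j
  have := hS.epi_g
  refine ⟨hS.exact.desc h (ModuleCat.hom_ext (LinearMap.ext ?_)), hS.exact.g_desc _ _⟩
  rintro ⟨z, hz⟩
  obtain ⟨y, rfl⟩ := acyclic_iff.1 hX i j _ hij rfl z hz
  exact congrArg (fun c => c.hom y) w

namespace hUnitaryFlatComplex

/-- By exactness `h` comes from the cycles in degree j + 1, which embed in the next term with flat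
cokernel; so the map on cycles extends. -/
theorem exists_factor (hX : hUnitaryFlatComplex A X) {i j : ℤ} (hij : i + 1 = j)
    {N : Type u} [AddCommGroup N] [Module Rᵐᵒᵖ N] (h : X.X j ⟶ charObj (R := R) N)
    (w : X.d i j ≫ h = 0) : ∃ g : X.X (j + 1) ⟶ charObj (R := R) N, X.d j (j + 1) ≫ g = h := by
  obtain ⟨g, rfl⟩ := exists_comp_d_of_acyclic hX.2.1 hij h w
  obtain ⟨k, rfl⟩ := exists_extension_of_ext_subsingleton
    (shortExact_cycleSequence hX.2.1 (j + 1))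
    (isFlatModule_iff_ext_one.1 (hX.2.2 (j + 1 + 1)).2 N) g
  exact ⟨k, rfl⟩

theorem exists_lift (hX : hUnitaryFlatComplex A X) {i j : ℤ} (hij : i + 1 = j)
    {N N' : Type u} [AddCommGroup N] [Module Rᵐᵒᵖ N] [AddCommGroup N'] [Module Rᵐᵒᵖ N']
    (g : N →ₗ[Rᵐᵒᵖ] N') (hg : Function.Injective g) (h : X.X j ⟶ charObj (R := R) N)
    (w : X.d i j ≫ h = 0) : ∃ h' : X.X j ⟶ charObj (R := R) N', X.d i j ≫ h' = 0 ∧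
      h' ≫ ModuleCat.ofHom (CharDual.restrict g) = h := by
  obtain ⟨k, rfl⟩ := exists_comp_d_of_acyclic hX.2.1 hij h w
  obtain ⟨f, hf⟩ := isFlatModule_iff_lift.1 (hX.2.2 (j + 1)).2 N N' g hg k.hom
  refine ⟨toCycles X j ≫ ModuleCat.ofHom f, ?_, ?_⟩
  · rw [reassoc_of% d_toCycles, Limits.zero_comp]
  · rw [Category.assoc]
    congr 1
    exact ModuleCat.hom_ext (LinearMap.ext hf)

theorem hom_annihilatedChars_eq_zero (hX : hUnitaryFlatComplex A X) {j : ℤ}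
    (f : X.X j ⟶ annihilatedChars A) : f = 0 :=
  (hUnitaryFlat_iff.1 (hX.flat j)).2 f

/-- Flatness of the term of X₃ gives an extension that may fail to kill boundaries. The failure
factors through X₃ and there through the differential, by `exists_factor`, so it can be subtracted.
-/
theorem exists_extension {S : ShortComplex (CochainComplex (ModuleCat.{u} R) ℤ)}
    (hS : S.ShortExact) (h₃ : hUnitaryFlatComplex A S.X₃) {j : ℤ}
    {N : Type u} [AddCommGroup N] [Module Rᵐᵒᵖ N] (f : S.X₁.X j ⟶ charObj (R := R) N)
    (w : ∀ i, i + 1 = j → S.X₁.d i j ≫ f = 0) : ∃ k : S.X₂.X j ⟶ charObj (R := R) N,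
      S.f.f j ≫ k = f ∧ ∀ i, i + 1 = j → S.X₂.d i j ≫ k = 0 := by
  obtain ⟨i, rfl⟩ : ∃ i, j = i + 1 := ⟨j - 1, by omega⟩
  replace w := w i rfl
  obtain ⟨k, hk⟩ : ∃ k : S.X₂.X (i + 1) ⟶ charObj (R := R) N, S.f.f (i + 1) ≫ k = f :=
    exists_extension_of_ext_subsingleton (shortExact_eval hS (i + 1))
      (isFlatModule_iff_ext_one.1 (h₃.flat (i + 1)).2 N) f
  have hi := shortExact_eval hS i
  have hepi := hi.epi_g
  have hepi' : Epi (S.g.f (i - 1)) := (shortExact_eval hS (i - 1)).epi_g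
  have hz : S.f.f i ≫ S.X₂.d i (i + 1) ≫ k = 0 := by
    rw [S.f.comm_assoc, hk, w]
  obtain ⟨e₀, he₀⟩ : ∃ e₀ : S.X₃.X i ⟶ charObj (R := R) N,
      S.g.f i ≫ e₀ = S.X₂.d i (i + 1) ≫ k := ⟨hi.exact.desc _ hz, hi.exact.g_desc _ _⟩
  obtain ⟨e, rfl⟩ := h₃.exists_factor (i := i - 1) (by omega) e₀ (by
    rw [← cancel_epi (S.g.f (i - 1)), S.g.comm_assoc, he₀]
    simp)
  refine ⟨k - S.g.f (i + 1) ≫ e, ?_, ?_⟩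
  · rw [Preadditive.comp_sub, hk, ← Category.assoc, ← HomologicalComplex.comp_f, S.zero]
    simp
  · intro i' hi'
    obtain rfl : i' = i := by omega
    rw [Preadditive.comp_sub, ← he₀, S.g.comm_assoc, sub_self]

end hUnitaryFlatComplex

/-- The lifting properties characterizing h-unitary flat complexes. -/
structure LiftsToTestDisks (A : TwoSidedIdeal R) (X : CochainComplex (ModuleCat.{u} R) ℤ) :
    Prop where
  disk : ∀ (n : ℤ) (q : X ⟶ sphere n (charObj (R := R) R)), ∃ e, e ≫ diskToSphere n _ = q
  sphere : ∀ (n : ℤ) {N N' : Type u} [AddCommGroup N] [Module Rᵐᵒᵖ N] [AddCommGroup N']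
    [Module Rᵐᵒᵖ N'] (g : N →ₗ[Rᵐᵒᵖ] N'), Function.Injective g →
    ∀ q : X ⟶ sphere n (charObj (R := R) N), ∃ e : X ⟶ sphere n (charObj (R := R) N'),
      e ≫ (HomologicalComplex.single _ _ n).map
        (ModuleCat.ofHom (CharDual.restrict (R := R) g)) = q
  zero : ∀ (n : ℤ) (q : X ⟶ _root_.disk n (annihilatedChars A)), q = 0

theorem hUnitaryFlatComplex.liftsToTestDisks (hX : hUnitaryFlatComplex A X) :
    LiftsToTestDisks A X where
  disk n q := by
    obtain ⟨g, hg⟩ := hX.exists_factor (i := n - 1) (by omega) (ofToSphere q) (d_ofToSphere _ _)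
    refine ⟨toDisk g, toSphere_ext ?_⟩
    rw [ofToSphere_diskToSphere, ofToDisk_toDisk, hg]
  sphere n N N' _ _ _ _ g hg q := by
    obtain ⟨h', w, hh'⟩ := hX.exists_lift (i := n - 1) (by omega) g hg (ofToSphere q)
      (d_ofToSphere _ _)
    refine ⟨toSphere h' fun i hi => ?_, toSphere_ext ?_⟩
    · obtain rfl : i = n - 1 := by have : i + 1 = n := hi; omega
      exact w
    · rw [ofToSphere_comp, ofToSphere_toSphere, hh']
  zero n q := toDisk_ext (by
    rw [hX.hom_annihilatedChars_eq_zero (ofToDisk q), hX.hom_annihilatedChars_eq_zero (ofToDisk 0)])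

/-- A nonzero cohomology class would be detected by a character killing boundaries, that is, by a
map to a sphere on R^+. Its lift to the disk factors it through the differential, which kills
cycles. -/
theorem LiftsToTestDisks.acyclic (h : LiftsToTestDisks A X) : X.Acyclic := by
  rw [acyclic_iff]
  rintro i j _ rfl rfl z hz
  change z ∈ LinearMap.range (X.d i (i + 1)).hom
  rw [← Submodule.Quotient.mk_eq_zero]
  refine eq_zero_of_characters _ fun c => ?_
  let c' : X.X (i + 1) →+ QModZ :=
    c.comp (LinearMap.range (X.d i (i + 1)).hom).mkQ.toAddMonoidHom
  let f : X.X (i + 1) ⟶ charObj (R := R) R := ModuleCat.ofHom (homToCharSelf c')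
  have hf : X.d i (i + 1) ≫ f = 0 := ModuleCat.hom_ext (LinearMap.ext fun x =>
    CharDual.ext (R := R) fun r => by
      refine (congrArg c ((Submodule.Quotient.mk_eq_zero _).2
        (LinearMap.mem_range.2 ⟨r • x, map_smul _ _ _⟩))).trans (map_zero c))
  obtain ⟨e, he⟩ := h.disk (i + 1) (toSphere f fun i' hi' => by
    obtain rfl : i' = i := by have : i' + 1 = i + 1 := hi'; omega
    exact hf)
  have he' := congrArg ofToSphere he
  rw [ofToSphere_diskToSphere, ofToSphere_toSphere] at he'
  have h0 : f z = 0 := by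
    rw [← he']
    exact (congrArg (ofToDisk e).hom hz).trans (map_zero (ofToDisk e).hom)
  have h1 : c' ((1 : R) • z) = 0 := congrArg (fun c : CharDual R R => c (1 : R)) h0
  rw [one_smul] at h1
  exact h1

/-- By exactness, maps out of the cycles in degree n + 1 are maps from degree n that kill
boundaries, hence maps to spheres. The sphere condition therefore gives flat cycles, and the
vanishing of maps to disks on (R/A)^+ gives the rest of `hUnitaryFlat_iff`. -/
theorem LiftsToTestDisks.hUnitaryFlatComplex (h : LiftsToTestDisks A X) :
    hUnitaryFlatComplex A X := by
  have hac := h.acyclic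
  refine hUnitaryFlatComplex_iff.2 ⟨hac, fun n => ?_⟩
  obtain ⟨n, rfl⟩ : ∃ m, n = m + 1 := ⟨n - 1, by omega⟩
  have hepi := epi_toCycles hac n
  refine hUnitaryFlat_iff.2 ⟨isFlatModule_iff_lift.2 ?_, fun f => ?_⟩
  · intro N N' _ _ _ _ g hg f
    obtain ⟨e, he⟩ := h.sphere n g hg (toSphere (toCycles X n ≫ ModuleCat.ofHom f)
      fun i hi => by rw [reassoc_of% d_toCycles, Limits.zero_comp])
    have he' := congrArg ofToSphere he
    rw [ofToSphere_comp, ofToSphere_toSphere] at he'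
    obtain ⟨k, hk⟩ := exists_comp_d_of_acyclic hac (i := n - 1) (by omega) (ofToSphere e)
      (d_ofToSphere e _)
    rw [← hk, Category.assoc, cancel_epi] at he'
    exact ⟨k.hom, fun m => congrArg (fun c => c.hom m) he'⟩
  · have : f = 0 ↔ toCycles X n ≫ f = 0 := by
      rw [← cancel_epi (toCycles X n), Limits.comp_zero]
    rw [this]
    obtain ⟨i, rfl⟩ : ∃ m, n = m + 1 := ⟨n - 1, by omega⟩
    have := congrArg ofToDisk (h.zero i (toDisk (toCycles X (i + 1) ≫ f)))
    rw [ofToDisk_toDisk] at this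
    rw [this, ofToDisk]
    simp

end FlatComplexLifts

/-! ### The small object argument -/

section SmallObject

open Limits ZeroObject MorphismProperty IsGrothendieckAbelian

variable {𝒜 : Type v} [Category.{w} 𝒜]

/-- The inclusions of the subobjects of `L` that satisfy `Φ`. -/
def inclusions {L : 𝒜} (Φ : Subobject L → Prop) : MorphismProperty 𝒜 :=
  MorphismProperty.ofHoms fun K : { K : Subobject L // Φ K } => K.1.arrow

theorem inclusions_le {L : 𝒜} (Φ : Subobject L → Prop) :
    inclusions Φ ≤ generatingMonomorphisms L := by
  rintro _ _ _ ⟨K⟩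
  exact ⟨K.1⟩

theorem inclusions_le_monomorphisms {L : 𝒜} (Φ : Subobject L → Prop) :
    inclusions Φ ≤ monomorphisms 𝒜 :=
  (inclusions_le Φ).trans (generatingMonomorphisms_le_monomorphisms L)

variable [Abelian 𝒜] [IsGrothendieckAbelian.{u} 𝒜]

instance isSmall_inclusions {L : 𝒜} (Φ : Subobject L → Prop) :
    MorphismProperty.IsSmall.{u} (inclusions Φ) := by
  have : Small.{u} { K : Subobject L // Φ K } := small_of_injective Subtype.val_injective
  dsimp [inclusions]
  infer_instance

/-- For regular κ above the number of subobjects of `L`, maps out of subobjects of `L` commute with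
colimits of κ-chains of monomorphisms, and the cell attachments are such chains. -/
instance hasSmallObjectArgument_inclusions {L : 𝒜} (Φ : Subobject L → Prop) :
    HasSmallObjectArgument.{u} (inclusions Φ) := by
  obtain ⟨κ, hκ', hκ⟩ := HasCardinalLT.exists_regular_cardinal.{u} (Subobject L)
  have : Fact κ.IsRegular := ⟨hκ'⟩
  have : Nonempty κ.ord.ToType := by simpa using hκ'.ne_zero
  have := WellFoundedLT.toOrderBot κ.ord.ToType
  exact ⟨κ, inferInstance, inferInstance,
    { preservesColimit {A B X Y} i hi f hf := by
        let hf' : (monomorphisms 𝒜).TransfiniteCompositionOfShape κ.ord.ToType f :=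
          { toTransfiniteCompositionOfShape := hf.toTransfiniteCompositionOfShape
            map_mem j hj := by
              have := (hf.attachCells j hj).pushouts_coproducts
              simp only [ofHoms_homFamily] at this
              refine (?_ : _ ≤ monomorphisms 𝒜) _ this
              simp only [pushouts_le_iff, coproducts_le_iff]
              exact inclusions_le_monomorphisms Φ }
        have (j j' : κ.ord.ToType) (φ : j ⟶ j') : Mono (hf'.F.map φ) := hf'.mem_map φ
        apply preservesColimit_coyoneda_obj_of_mono (Y := hf'.F) (κ := κ)
        obtain ⟨S⟩ := hi
        exact Subobject.hasCardinalLT_of_mono hκ S.1.arrow }⟩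

/-- Every object embeds into one to which the maps from the subobjects satisfying `Φ` extend,
with a cokernel that lifts along the maps having the right lifting property. -/
theorem exists_mono_extension_property {L : 𝒜} (Φ : Subobject L → Prop) (Y : 𝒜) :
    ∃ (C : 𝒜) (i : Y ⟶ C), Mono i ∧
      (∀ {E Q : 𝒜} (p : E ⟶ Q),
        (∀ K : Subobject L, Φ K → HasLiftingProperty K.arrow p) →
        ∀ q : cokernel i ⟶ Q, ∃ e, e ≫ p = q) ∧
      ∀ K : Subobject L, Φ K → ∀ q : (K : 𝒜) ⟶ C, ∃ h : L ⟶ C, K.arrow ≫ h = q := by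
  -- Factor Y → 0: the right lifting property of the second factor extends maps into the middle
  -- object, and the left lifting property of the first controls its cokernel.
  let fac := (functorialFactorizationData (inclusions Φ).rlp.llp
    (inclusions Φ).rlp).factorizationData (0 : Y ⟶ 0)
  refine ⟨fac.Z, fac.i, ?_, ?_, ?_⟩
  · have := antitone_llp (antitone_rlp (inclusions_le_monomorphisms Φ)) _ fac.hi
    rwa [llp_rlp_monomorphisms (isSeparator_separator 𝒜)] at this
  · intro E Q p hp q
    have := fac.hi p (by
      rintro _ _ _ ⟨K⟩
      exact hp K.1 K.2)
    -- With zero as upper map, the diagonal kills `Y` and descends to a lift of `q`.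
    have sq : CommSq (0 : Y ⟶ E) fac.i p (cokernel.π fac.i ≫ q) := ⟨by simp⟩
    refine ⟨cokernel.desc fac.i sq.lift sq.fac_left, ?_⟩
    rw [← cancel_epi (cokernel.π fac.i), cokernel.π_desc_assoc, sq.fac_right]
  · intro K hK q
    have := fac.hp K.arrow (ofHoms.mk (⟨K, hK⟩ : { K : Subobject L // Φ K }))
    have sq : CommSq q K.arrow fac.p 0 := ⟨(isZero_zero 𝒜).eq_of_tgt _ _⟩
    exact ⟨sq.lift, sq.fac_left⟩

end SmallObject

/-! ### Embeddings with flat cokernel -/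

section ExtendsFrom

open Limits ZeroObject

variable {R : Type u} [Ring R] {A : TwoSidedIdeal R}

/-- The maps from a kernel of `L → T`, for `T` an h-unitary flat quotient of `L`, extend to `L`. -/
def ExtendsFrom (A : TwoSidedIdeal R) (L C : CochainComplex (ModuleCat.{u} R) ℤ) : Prop :=
  ∀ (K T : CochainComplex (ModuleCat.{u} R) ℤ) (k : K ⟶ L) (b : L ⟶ T) (w : k ≫ b = 0),
    (ShortComplex.mk k b w).ShortExact → hUnitaryFlatComplex A T →
    ∀ q : K ⟶ C, ∃ h : L ⟶ C, k ≫ h = q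

/-- Each test map has the right lifting property against monomorphisms with flat cokernel: the
cokernel lifts maps, and maps extend to disks on the injective R^+, to spheres on character modules,
and trivially to 0. -/
theorem LiftsToTestDisks.of_lifts {F : CochainComplex (ModuleCat.{u} R) ℤ}
    (h : ∀ {E Q : CochainComplex (ModuleCat.{u} R) ℤ} (p : E ⟶ Q),
      (∀ S : ShortComplex (CochainComplex (ModuleCat.{u} R) ℤ), S.ShortExact →
        _root_.hUnitaryFlatComplex A S.X₃ → HasLiftingProperty S.f p) →
      ∀ q : F ⟶ Q, ∃ e, e ≫ p = q) : LiftsToTestDisks A F where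
  disk n := h _ fun S hS h₃ => hasLiftingProperty_of_shortExact hS _ (fun a => by
    have := (shortExact_eval hS (n + 1)).mono_f
    have hm : Mono (S.f.f (n + 1)) := this
    refine ⟨toDisk (Injective.factorThru (ofToDisk a) (S.f.f (n + 1))), toDisk_ext ?_⟩
    rw [comp_ofToDisk, ofToDisk_toDisk, Injective.comp_factorThru])
    (h₃.liftsToTestDisks.disk n)
  sphere n N N' _ _ _ _ g hg := h _ fun S hS h₃ =>
    hasLiftingProperty_of_shortExact hS _ (fun a => by
      obtain ⟨k, hk, w⟩ := h₃.exists_extension hS (ofToSphere a) fun i _ => d_ofToSphere a i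
      refine ⟨toSphere k (fun i hi => w i hi), toSphere_ext ?_⟩
      rw [comp_ofToSphere, ofToSphere_toSphere, hk])
    (h₃.liftsToTestDisks.sphere n g hg)
  zero n q := by
    obtain ⟨e, rfl⟩ := h (0 : 0 ⟶ _root_.disk n (annihilatedChars A)) (fun S hS h₃ =>
      hasLiftingProperty_of_shortExact hS _ (fun a => ⟨0, (isZero_zero _).eq_of_tgt _ _⟩)
        fun q => ⟨0, by rw [comp_zero, h₃.liftsToTestDisks.zero n q]⟩) q
    rw [comp_zero]

theorem exists_shortExact_extendsFrom (A : TwoSidedIdeal R)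
    (L Y : CochainComplex (ModuleCat.{u} R) ℤ) :
    ∃ (C F : CochainComplex (ModuleCat.{u} R) ℤ) (i : Y ⟶ C) (p : C ⟶ F) (w : i ≫ p = 0),
      (ShortComplex.mk i p w).ShortExact ∧ hUnitaryFlatComplex A F ∧ ExtendsFrom A L C := by
  obtain ⟨C, i, hi, hF, hC⟩ := exists_mono_extension_property
    (fun K : Subobject L => hUnitaryFlatComplex A (cokernel K.arrow)) Y
  refine ⟨C, cokernel i, i, cokernel.π i, cokernel.condition i,
    { exact := ShortComplex.exact_cokernel i }, ?_, ?_⟩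
  · refine (LiftsToTestDisks.of_lifts fun p hp => hF p fun K hK => ?_).hUnitaryFlatComplex
    exact hp (ShortComplex.mk K.arrow (cokernel.π K.arrow) (cokernel.condition _))
      { exact := ShortComplex.exact_cokernel _ } hK
  · intro K T k b w hS hT q
    have := hS.mono_f
    have hk : Mono k := this
    have he : (Subobject.underlyingIso k).inv ≫ (Subobject.mk k).arrow = k := by simp
    obtain ⟨h, hh⟩ := hC (Subobject.mk k) (hUnitaryFlatComplex_of_iso
      ((cokernelIsoOfEq (Subobject.underlyingIso_hom_comp_eq_mk k).symm ≪≫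
        cokernelEpiComp _ _ ≪≫
        (cokernelIsCokernel k).coconePointUniqueUpToIso hS.gIsCokernel)) hT)
      ((Subobject.underlyingIso k).hom ≫ q)
    refine ⟨h, ?_⟩
    rw [← cancel_epi (Subobject.underlyingIso k).hom, ← hh, ← Category.assoc,
      Subobject.underlyingIso_hom_comp_eq_mk]

end ExtendsFrom

/-! ### Pure exact subcomplexes, their preimages and unions -/

section Subcomplexes

attribute [local irreducible] hUnitary

variable {R : Type u} [Ring R] {A : TwoSidedIdeal R}

theorem shortExact_of_degreewise {S : ShortComplex (CochainComplex (ModuleCat.{u} R) ℤ)}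
    (hf : ∀ n, Function.Injective (S.f.f n)) (hg : ∀ n, Function.Surjective (S.g.f n))
    (h : ∀ n x, S.g.f n x = 0 → ∃ y, S.f.f n y = x) : S.ShortExact :=
  HomologicalComplex.shortExact_of_degreewise_shortExact S fun n =>
    { exact := (ShortComplex.moduleCat_exact_iff _).2 (h n)
      mono_f := (ModuleCat.mono_iff_injective _).2 (hf n)
      epi_g := (ModuleCat.epi_iff_surjective _).2 (hg n) }

theorem IsPureMap.comp_equiv {Z T T' : Type u} [AddCommGroup Z] [Module R Z] [AddCommGroup T]
    [Module R T] [AddCommGroup T'] [Module R T'] {j : T' →ₗ[R] Z} (hj : IsPureMap j)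
    (e : T ≃ₗ[R] T') : IsPureMap (j.comp e.toLinearMap) := by
  intro N _ _ f
  obtain ⟨f', hf'⟩ := hj N (f.comp e.symm.toLinearMap)
  exact ⟨f', fun t => (hf' (e t)).trans (congrArg f (e.symm_apply_apply t))⟩

/-- The family `V` is stable under the differential of `X`. -/
def IsSubcomplex (X : CochainComplex (ModuleCat.{u} R) ℤ) (V : ∀ n, Submodule R (X.X n)) : Prop :=
  ∀ i j, ∀ x ∈ V i, X.d i j x ∈ V j

variable {X : CochainComplex (ModuleCat.{u} R) ℤ} {V : ∀ n, Submodule R (X.X n)}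

/-- The subcomplex with terms `V`. -/
def subcomplex (hV : IsSubcomplex X V) : CochainComplex (ModuleCat.{u} R) ℤ where
  X n := ModuleCat.of R (V n)
  d i j := ModuleCat.ofHom ((X.d i j).hom.restrict (hV i j))
  shape i j h := ModuleCat.hom_ext (LinearMap.ext fun x =>
    Subtype.ext (congrArg (fun c => c.hom x.1) (X.shape i j h)))
  d_comp_d' i j k _ _ := ModuleCat.hom_ext (LinearMap.ext fun x =>
    Subtype.ext (d_d_apply X i j k x.1))

/-- The quotient of `X` by the subcomplex with terms `V`. -/
def quotientComplex (hV : IsSubcomplex X V) : CochainComplex (ModuleCat.{u} R) ℤ where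
  X n := ModuleCat.of R (X.X n ⧸ V n)
  d i j := ModuleCat.ofHom (Submodule.mapQ _ _ (X.d i j).hom (hV i j))
  shape i j h := ModuleCat.hom_ext (Submodule.linearMap_qext _ (LinearMap.ext fun x =>
    congrArg (fun c => (V j).mkQ (c.hom x)) (X.shape i j h)))
  d_comp_d' i j k _ _ := ModuleCat.hom_ext (Submodule.linearMap_qext _ (LinearMap.ext fun x =>
    congrArg (V k).mkQ (d_d_apply X i j k x)))

/-- The inclusion of a subcomplex. -/
def subcomplexι (hV : IsSubcomplex X V) : subcomplex hV ⟶ X where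
  f n := ModuleCat.ofHom (V n).subtype
  comm' _ _ _ := rfl

/-- The projection onto a quotient complex. -/
def quotientπ (hV : IsSubcomplex X V) : X ⟶ quotientComplex hV where
  f n := ModuleCat.ofHom (V n).mkQ
  comm' _ _ _ := rfl

theorem quotientπ_eq_zero_iff (hV : IsSubcomplex X V) (n : ℤ) (x : X.X n) :
    (quotientπ hV).f n x = 0 ↔ x ∈ V n :=
  Submodule.Quotient.mk_eq_zero _

theorem quotientπ_surjective (hV : IsSubcomplex X V) (n : ℤ) :
    Function.Surjective ((quotientπ hV).f n) :=
  Submodule.mkQ_surjective _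

/-- The sequence `0 → V → X → X / V → 0`. -/
def quotientSequence (hV : IsSubcomplex X V) :
    ShortComplex (CochainComplex (ModuleCat.{u} R) ℤ) :=
  ShortComplex.mk (subcomplexι hV) (quotientπ hV) (by
    ext n x
    exact (quotientπ_eq_zero_iff hV n x.1).2 x.2)

theorem shortExact_quotientSequence (hV : IsSubcomplex X V) : (quotientSequence hV).ShortExact :=
  shortExact_of_degreewise (fun _ => Subtype.val_injective) (quotientπ_surjective hV)
    fun n x hx => ⟨⟨x, (quotientπ_eq_zero_iff hV n x).1 hx⟩, rfl⟩

/-- The elements of `V n` that are cycles. -/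
abbrev cyclesIn (X : CochainComplex (ModuleCat.{u} R) ℤ) (V : ∀ n, Submodule R (X.X n)) (n : ℤ) :
    Submodule R (LinearMap.ker (X.d n (n + 1)).hom) :=
  (V n).comap (LinearMap.ker (X.d n (n + 1)).hom).subtype

/-- An exact subcomplex whose cycles are pure in the cycles of `X`. -/
structure IsPureSubcomplex (X : CochainComplex (ModuleCat.{u} R) ℤ)
    (V : ∀ n, Submodule R (X.X n)) : Prop where
  isSubcomplex : IsSubcomplex X V
  exists_d_eq : ∀ i j k, i + 1 = j → j + 1 = k → ∀ z ∈ V j, X.d j k z = 0 →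
    ∃ y ∈ V i, X.d i j y = z
  pure : ∀ n, IsPureMap (cyclesIn X V n).subtype

namespace IsPureSubcomplex

theorem hUnitaryFlatComplex (hV : IsPureSubcomplex X V) (hX : hUnitaryFlatComplex A X) :
    _root_.hUnitaryFlatComplex A (subcomplex hV.isSubcomplex) ∧
      _root_.hUnitaryFlatComplex A (quotientComplex hV.isSubcomplex) := by
  have hac : (subcomplex hV.isSubcomplex).Acyclic := by
    refine acyclic_iff.2 ?_
    rintro i j k hij hjk ⟨z, hz⟩ hdz
    obtain ⟨y, hy, rfl⟩ := hV.exists_d_eq i j k hij hjk z hz (congrArg Subtype.val hdz)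
    exact ⟨⟨y, hy⟩, rfl⟩
  have hpure (n : ℤ) : IsPureMap (cycleMap (subcomplexι hV.isSubcomplex) n).hom := by
    let e : cycleModule (subcomplex hV.isSubcomplex) n ≃ₗ[R] cyclesIn X V n :=
      { toFun z := ⟨⟨z.1.1, congrArg Subtype.val z.2⟩, z.1.2⟩
        invFun z := ⟨⟨z.1.1, z.2⟩, Subtype.ext z.1.2⟩
        map_add' _ _ := rfl
        map_smul' _ _ := rfl
        left_inv _ := rfl
        right_inv _ := rfl }
    exact (hV.pure n).comp_equiv e
  exact hUnitaryFlatComplex_of_pure (S := quotientSequence hV.isSubcomplex)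
    (shortExact_quotientSequence hV.isSubcomplex) hac hpure hX

theorem comap (hV : IsPureSubcomplex X V)
    {T : ∀ n, Submodule R ((quotientComplex hV.isSubcomplex).X n)}
    (hT : IsPureSubcomplex (quotientComplex hV.isSubcomplex) T) :
    IsPureSubcomplex X fun n => (T n).comap ((quotientπ hV.isSubcomplex).f n).hom := by
  -- If d x and the cycle v agree modulo `V`, their difference is a cycle in `V`, hence a boundary
  -- from `V`. Subtracting a primitive gives equality without changing the class of x.
  have key (i j : ℤ) (hij : i + 1 = j) (x : X.X i) (v : X.X j) (hv : X.d j (j + 1) v = 0)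
      (hx : (quotientComplex hV.isSubcomplex).d i j ((quotientπ hV.isSubcomplex).f i x) =
        (quotientπ hV.isSubcomplex).f j v) :
      ∃ x', X.d i j x' = v ∧
        (quotientπ hV.isSubcomplex).f i x' = (quotientπ hV.isSubcomplex).f i x := by
    rw [hom_d_apply, ← sub_eq_zero, ← map_sub, quotientπ_eq_zero_iff] at hx
    obtain ⟨w, hw, hwx⟩ := hV.exists_d_eq i j (j + 1) hij rfl _ hx
      (by rw [map_sub, d_d_apply, hv, sub_zero])
    refine ⟨x - w, by rw [map_sub, hwx, sub_sub_cancel], ?_⟩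
    rw [map_sub, (quotientπ_eq_zero_iff _ _ w).2 hw, sub_zero]
  refine ⟨fun i j x hx => ?_, ?_, fun n => ?_⟩
  · have := hT.isSubcomplex i j _ hx
    rwa [hom_d_apply] at this
  · rintro i j _ hij rfl z hz hdz
    obtain ⟨y, hy, hyz⟩ := hT.exists_d_eq i j _ hij rfl _ hz
      (by rw [hom_d_apply, hdz, map_zero])
    obtain ⟨y, rfl⟩ := quotientπ_surjective hV.isSubcomplex i y
    obtain ⟨x, hx, hxy⟩ := key i j hij y z hdz hyz
    refine ⟨x, ?_, hx⟩
    rw [Submodule.mem_comap]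
    exact hxy ▸ hy
  · set T' := fun n => (T n).comap ((quotientπ hV.isSubcomplex).f n).hom
    let i₁ : cyclesIn X V n →ₗ[R] cyclesIn X T' n := Submodule.inclusion fun z hz => by
      rw [Submodule.mem_comap, Submodule.mem_comap]
      have : (quotientπ hV.isSubcomplex).f n z.1 = 0 := (quotientπ_eq_zero_iff _ _ _).2 hz
      exact this ▸ zero_mem (T n)
    let p := (cycleMap (quotientπ hV.isSubcomplex) n).hom
    let p₁ : cyclesIn X T' n →ₗ[R] cyclesIn (quotientComplex hV.isSubcomplex) T n :=
      p.restrict fun z hz => hz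
    refine IsPureMap.of_fiber (i₁ := i₁) (p := p) (p₁ := p₁) (hV.pure n) (hT.pure n) ?_ ?_
      fun _ => rfl
    · rintro ⟨⟨t, ht⟩, htT⟩
      obtain ⟨x, rfl⟩ := quotientπ_surjective hV.isSubcomplex n t
      obtain ⟨x', hx', hx⟩ := key n (n + 1) rfl x 0 (map_zero _) (ht.trans (map_zero _).symm)
      refine ⟨⟨⟨x', hx'⟩, ?_⟩, Subtype.ext (Subtype.ext hx)⟩
      rw [Submodule.mem_comap, Submodule.mem_comap]
      exact hx ▸ htT
    · rintro ⟨⟨z, hz⟩, hzT⟩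
      constructor
      · intro h
        exact ⟨⟨⟨z, hz⟩, (quotientπ_eq_zero_iff hV.isSubcomplex n z).1
          (congrArg (fun c => c.1.1) h)⟩, rfl⟩
      · rintro ⟨⟨z', hz'⟩, h⟩
        obtain rfl : z' = _ := congrArg Subtype.val h
        exact Subtype.ext (Subtype.ext ((quotientπ_eq_zero_iff hV.isSubcomplex n z).2 hz'))

theorem bot : IsPureSubcomplex X fun _ => ⊥ where
  isSubcomplex i j x hx := by
    obtain rfl := (Submodule.mem_bot R).1 hx
    rw [map_zero]
    exact zero_mem _
  exists_d_eq i j k _ _ z hz _ := by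
    obtain rfl := (Submodule.mem_bot R).1 hz
    exact ⟨0, zero_mem _, map_zero _⟩
  pure n N _ _ f := ⟨0, fun t => by
    obtain rfl : t = 0 := Subtype.ext (Subtype.ext ((Submodule.mem_bot R).1 t.2))
    rw [map_zero f]
    rfl⟩

theorem iSup {ι : Type*} [Nonempty ι] {V : ι → ∀ n, Submodule R (X.X n)}
    (hdir : Directed (· ≤ ·) V) (h : ∀ a, IsPureSubcomplex X (V a)) :
    IsPureSubcomplex X fun n => ⨆ a, V a n := by
  have mem (n : ℤ) (x : X.X n) : x ∈ ⨆ a, V a n ↔ ∃ a, x ∈ V a n :=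
    Submodule.mem_iSup_of_directed _ fun a b =>
      let ⟨c, hac, hbc⟩ := hdir a b
      ⟨c, hac n, hbc n⟩
  refine ⟨fun i j x hx => ?_, fun i j k hij hjk z hz hdz => ?_, fun n => ?_⟩
  · obtain ⟨a, ha⟩ := (mem i x).1 hx
    exact (mem j _).2 ⟨a, (h a).isSubcomplex i j x ha⟩
  · obtain ⟨a, ha⟩ := (mem j z).1 hz
    obtain ⟨y, hy, rfl⟩ := (h a).exists_d_eq i j k hij hjk z ha hdz
    exact ⟨y, (mem i y).2 ⟨a, hy⟩, rfl⟩
  · have hle (a : ι) : cyclesIn X (V a) n ≤ cyclesIn X (fun n => ⨆ a, V a n) n :=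
      Submodule.comap_mono (le_iSup (fun a => V a n) a)
    refine isPureMap_of_directed (fun a => Submodule.inclusion (hle a)) ?_ ?_ fun a => (h a).pure n
    · rintro ⟨z, hz⟩
      obtain ⟨a, ha⟩ := (mem n z.1).1 hz
      exact ⟨a, ⟨z, ha⟩, rfl⟩
    · intro a b
      obtain ⟨c, hac, hbc⟩ := hdir a b
      refine ⟨c, ?_, ?_⟩
      · rintro _ ⟨t, rfl⟩
        exact ⟨⟨t.1, hac n t.2⟩, rfl⟩
      · rintro _ ⟨t, rfl⟩
        exact ⟨⟨t.1, hbc n t.2⟩, rfl⟩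

end IsPureSubcomplex

end Subcomplexes

/-! ### Projective complexes built from disks -/

section Cells

open Cardinal Limits

variable {R : Type u} [Ring R]

/-- The map out of a disk given by its bottom component. -/
noncomputable def ofDisk {X : CochainComplex (ModuleCat.{u} R) ℤ} {n : ℤ} {C : ModuleCat.{u} R}
    (f : C ⟶ X.X n) : disk n C ⟶ X :=
  HomologicalComplex.mkHomFromDouble (upRel n) (by simp) f (f ≫ X.d n (n + 1)) (by simp) (by simp)

theorem ofDisk_f {X : CochainComplex (ModuleCat.{u} R) ℤ} {n : ℤ} {C : ModuleCat.{u} R}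
    (f : C ⟶ X.X n) : (ofDisk f).f n = (diskIso₀ n C).hom ≫ f :=
  HomologicalComplex.mkHomFromDouble_f₀ _ _ _ _ _ _

theorem ofDisk_f_succ {X : CochainComplex (ModuleCat.{u} R) ℤ} {n : ℤ} {C : ModuleCat.{u} R}
    (f : C ⟶ X.X n) : (ofDisk f).f (n + 1) = (diskIso₁ n C).hom ≫ f ≫ X.d n (n + 1) :=
  HomologicalComplex.mkHomFromDouble_f₁ _ _ _ _ _ _

theorem fromDisk_ext {X : CochainComplex (ModuleCat.{u} R) ℤ} {n : ℤ} {C : ModuleCat.{u} R}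
    {g g' : disk n C ⟶ X} (h : g.f n = g'.f n) : g = g' := by
  refine HomologicalComplex.from_double_hom_ext h ?_
  have : IsIso ((disk n C).d n (n + 1)) := by
    rw [disk_d]
    infer_instance
  rw [← cancel_epi ((disk n C).d n (n + 1)), ← g.comm, ← g'.comm, h]

instance projective_disk (n : ℤ) (P : ModuleCat.{u} R) [Projective P] :
    Projective (disk n P) where
  factors {E X} f e _ := by
    have : Epi (e.f n) := inferInstanceAs (Epi ((HomologicalComplex.eval _ _ n).map e))
    refine ⟨ofDisk (Projective.factorThru ((diskIso₀ n P).inv ≫ f.f n) (e.f n)),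
      fromDisk_ext ?_⟩
    rw [HomologicalComplex.comp_f, ofDisk_f, Category.assoc, Projective.factorThru_comp,
      Iso.hom_inv_id_assoc]

theorem projective_sigma {𝒜 : Type v} [Category.{w} 𝒜] {ι : Type*} (D : ι → 𝒜) [HasCoproduct D]
    [∀ a, Projective (D a)] : Projective (∐ D) where
  factors f e _ := ⟨Sigma.desc fun a => Projective.factorThru (Sigma.ι D a ≫ f) e,
    Sigma.hom_ext _ _ fun a => by rw [Sigma.ι_desc_assoc, Projective.factorThru_comp]⟩

variable (R) in
/-- The coproduct of the disks on a free module of with basis `J`. -/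
noncomputable def freeDisks (J : Type u) : CochainComplex (ModuleCat.{u} R) ℤ :=
  ∐ fun n : ℤ => disk n (ModuleCat.of R (J →₀ R))

instance projective_freeDisks (J : Type u) : Projective (freeDisks R J) := by
  have (n : ℤ) : Projective (disk n (ModuleCat.of R (J →₀ R))) := by
    have : Projective (ModuleCat.of R (J →₀ R)) :=
      (IsProjective.iff_projective _).1 inferInstance
    infer_instance
  exact projective_sigma _

theorem exists_surjective_of_mk_le {J : Type u} {M : Type u} [AddCommGroup M] [Module R M]
    (h : #M ≤ #J) : ∃ f : (J →₀ R) →ₗ[R] M, Function.Surjective f := by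
  obtain ⟨e⟩ := h
  refine ⟨Finsupp.linearCombination R (Function.invFun e), ?_⟩
  rw [← LinearMap.range_eq_top, Finsupp.range_linearCombination,
    (Function.invFun_surjective e.injective).range_eq, Submodule.span_univ]

theorem epi_of_components_surjective {ι : Type} {D : ι → CochainComplex (ModuleCat.{u} R) ℤ}
    [HasCoproduct D] {T : CochainComplex (ModuleCat.{u} R) ℤ} (g : ∀ a, D a ⟶ T)
    (h : ∀ n, ∃ a, Function.Surjective ((g a).f n)) : Epi (Sigma.desc g) := by
  have (n : ℤ) : Epi ((Sigma.desc g).f n) := by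
    obtain ⟨a, ha⟩ := h n
    have := (ModuleCat.epi_iff_surjective _).2 ha
    refine epi_of_epi_fac (f := (Sigma.ι D a).f n) (h := (g a).f n) ?_
    rw [← HomologicalComplex.comp_f, Sigma.ι_desc]
  exact HomologicalComplex.epi_of_epi_f _ this

/-- A single projective complex covers all complexes with terms of size at most #J, so extension
from its subobjects tests all of them. -/
theorem exists_epi_freeDisks {J : Type u} {T : CochainComplex (ModuleCat.{u} R) ℤ}
    (h : ∀ n, #(T.X n) ≤ #J) : ∃ b : freeDisks R J ⟶ T, Epi b := by
  choose f hf using fun n => exists_surjective_of_mk_le (R := R) (h n)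
  refine ⟨Sigma.desc fun n => ofDisk (ModuleCat.ofHom (f n)),
    epi_of_components_surjective _ fun n => ⟨n, ?_⟩⟩
  rw [ofDisk_f]
  exact (hf n).comp (ModuleCat.epi_iff_surjective (diskIso₀ n _).hom |>.1 inferInstance)

end Cells

/-! ### Splitting by transfinite assembly of partial sections -/

section Filtration

open Cardinal Limits

attribute [local irreducible] hUnitary

variable {R : Type u} [Ring R] {A : TwoSidedIdeal R}
  {S : ShortComplex (CochainComplex (ModuleCat.{u} R) ℤ)}

/-- Lift to X₂ on the projective cover `L`. On the kernel of L → T the lift lands in X₁, and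
extending that map to `L` gives a correction after which the lift descends to `T`. -/
theorem ExtendsFrom.exists_lift {L T : CochainComplex (ModuleCat.{u} R) ℤ} [Projective L]
    (hC : ExtendsFrom A L S.X₁) (hS : S.ShortExact) (hT : hUnitaryFlatComplex A T)
    (b : L ⟶ T) [Epi b] (t : T ⟶ S.X₃) : ∃ s : T ⟶ S.X₂, s ≫ S.g = t := by
  have := hS.epi_g
  have := hS.mono_f
  let a := Projective.factorThru (b ≫ t) S.g
  have ha : a ≫ S.g = b ≫ t := Projective.factorThru_comp _ _
  have hb : (ShortComplex.mk (kernel.ι b) b (kernel.condition b)).ShortExact :=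
    { exact := ShortComplex.exact_kernel b }
  let q := hS.exact.lift (kernel.ι b ≫ a) (by
    rw [Category.assoc, ha, kernel.condition_assoc, zero_comp])
  have hq : q ≫ S.f = kernel.ι b ≫ a := hS.exact.lift_f _ _
  obtain ⟨h, hh⟩ := hC _ _ _ _ _ hb hT q
  have hz : kernel.ι b ≫ (a - h ≫ S.f) = 0 := by
    rw [Preadditive.comp_sub, ← hq, ← Category.assoc, hh, sub_self]
  refine ⟨hb.exact.desc _ hz, ?_⟩
  rw [← cancel_epi b, hb.exact.g_desc_assoc, Preadditive.sub_comp, ha, Category.assoc, S.zero,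
    comp_zero, sub_zero]

theorem exists_isPureSubcomplex_complement {J : Type u} (hκ : ℵ₀ ≤ #J) (hR : #R ≤ #J)
    (hC : ExtendsFrom A (freeDisks R J) S.X₁) (hS : S.ShortExact)
    (h₃ : hUnitaryFlatComplex A S.X₃) {n : ℤ} (x : S.X₃.X n) :
    ∃ W : ∀ n, Submodule R (S.X₂.X n), IsSubcomplex S.X₂ W ∧
      (∀ n y, S.f.f n y ∈ W n → y = 0) ∧
      IsPureSubcomplex S.X₃ (fun n => (W n).map (S.g.f n).hom) ∧
      x ∈ (W n).map (S.g.f n).hom := by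
  obtain ⟨U, hUκ, hxU, hUd, hUe, hU⟩ := exists_pure_hull S.X₃ (acyclic_iff.1 h₃.2.1) hκ hR
    -- The family is {x} in degree n and empty in all other degrees.
    (fun m => {y | ∃ h : n = m, h ▸ x = y}) (fun m => by
      refine le_trans (Cardinal.mk_le_one_iff_set_subsingleton.2 ?_)
        (Cardinal.one_le_aleph0.trans hκ)
      rintro _ ⟨h, rfl⟩ _ ⟨_, rfl⟩
      rfl)
  have hpure : IsPureSubcomplex S.X₃ U := ⟨hUd, hUe, fun m => (hU m).isPureMap⟩
  obtain ⟨b, _⟩ := exists_epi_freeDisks (T := subcomplex hpure.isSubcomplex) hUκ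
  obtain ⟨s, hs⟩ := hC.exists_lift hS (hpure.hUnitaryFlatComplex h₃).1 b
    (subcomplexι hpure.isSubcomplex)
  have hs' (m : ℤ) (y) : S.g.f m (s.f m y) = y.1 := congrArg (fun c => (c.f m).hom y) hs
  have hmap : (fun m => (LinearMap.range (s.f m).hom).map (S.g.f m).hom) = U := by
    funext m
    ext z
    constructor
    · rintro ⟨_, ⟨y, rfl⟩, rfl⟩
      exact (hs' m y).symm ▸ y.2
    · intro hz
      exact ⟨_, ⟨⟨z, hz⟩, rfl⟩, hs' m ⟨z, hz⟩⟩
  -- The complement is the image of a section over the small hull of x: it meets X₁ trivially and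
  -- maps onto the hull.
  refine ⟨fun m => LinearMap.range (s.f m).hom, ?_, ?_, by rw [← hmap] at hpure; exact hpure, ?_⟩
  · rintro i j _ ⟨y, rfl⟩
    exact ⟨_, (hom_d_apply s i j y).symm⟩
  · rintro m y ⟨z, hz⟩
    apply shortExact_f_injective hS m
    have h0 : z.1 = 0 := by
      rw [← hs' m z]
      exact (congrArg _ hz).trans (g_f_apply S m y)
    obtain rfl : z = 0 := Subtype.ext h0
    rw [map_zero, ← hz, map_zero]
  · have : x ∈ U n := hxU n ⟨rfl, rfl⟩
    rwa [← congrFun hmap n] at this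

/-- The quotient of `0 → X₁ → X₂ → X₃ → 0` by a subcomplex of `X₂` and its image in `X₃`. -/
def quotientExtension (S : ShortComplex (CochainComplex (ModuleCat.{u} R) ℤ))
    {W : ∀ n, Submodule R (S.X₂.X n)} {V : ∀ n, Submodule R (S.X₃.X n)}
    (hW : IsSubcomplex S.X₂ W) (hV : IsSubcomplex S.X₃ V)
    (h : ∀ n, (W n).map (S.g.f n).hom = V n) :
    ShortComplex (CochainComplex (ModuleCat.{u} R) ℤ) :=
  ShortComplex.mk (X₁ := S.X₁) (X₂ := quotientComplex hW) (X₃ := quotientComplex hV)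
    (S.f ≫ quotientπ hW)
    { f n := ModuleCat.ofHom (Submodule.mapQ _ _ (S.g.f n).hom (Submodule.map_le_iff_le_comap.1
        (h n).le))
      comm' i j _ := ModuleCat.hom_ext (Submodule.linearMap_qext _ (LinearMap.ext fun x =>
        congrArg (V j).mkQ (hom_d_apply S.g i j x))) }
    (by
      ext n x
      exact congrArg (V n).mkQ (g_f_apply S n x))

theorem shortExact_quotientExtension (hS : S.ShortExact)
    {W : ∀ n, Submodule R (S.X₂.X n)} {V : ∀ n, Submodule R (S.X₃.X n)}
    (hW : IsSubcomplex S.X₂ W) (hV : IsSubcomplex S.X₃ V)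
    (h : ∀ n, (W n).map (S.g.f n).hom = V n) (hdisj : ∀ n y, S.f.f n y ∈ W n → y = 0) :
    (quotientExtension S hW hV h).ShortExact := by
  refine shortExact_of_degreewise (fun n => ?_) (fun n => ?_) (fun n x hx => ?_)
  · refine (injective_iff_map_eq_zero ((S.f ≫ quotientπ hW).f n).hom).2 fun y hy => ?_
    exact hdisj n y ((quotientπ_eq_zero_iff hW n _).1 hy)
  · intro z
    obtain ⟨z, rfl⟩ := quotientπ_surjective hV n z
    obtain ⟨x, rfl⟩ := shortExact_g_surjective hS n z
    exact ⟨(quotientπ hW).f n x, rfl⟩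
  · obtain ⟨x, rfl⟩ := quotientπ_surjective hW n x
    have hx' : S.g.f n x ∈ (W n).map (S.g.f n).hom :=
      h n ▸ (quotientπ_eq_zero_iff hV n _).1 hx
    obtain ⟨w, hw, hwx⟩ := hx'
    obtain ⟨y, hy⟩ := shortExact_exists hS n (x - w) (by
      rw [map_sub, sub_eq_zero]
      exact hwx.symm)
    refine ⟨y, ?_⟩
    change (quotientπ hW).f n (S.f.f n y) = (quotientπ hW).f n x
    rw [hy, map_sub, (quotientπ_eq_zero_iff hW n w).2 hw, sub_zero]

/-- A subcomplex of `X₂` that maps isomorphically onto `X₃` gives a section. -/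
theorem exists_section_of_complement (hS : S.ShortExact) {W : ∀ n, Submodule R (S.X₂.X n)}
    (hW : IsSubcomplex S.X₂ W) (hdisj : ∀ n y, S.f.f n y ∈ W n → y = 0)
    (htop : ∀ n x, x ∈ (W n).map (S.g.f n).hom) : ∃ s : S.X₃ ⟶ S.X₂, s ≫ S.g = 𝟙 S.X₃ := by
  have hinj (n : ℤ) (w : S.X₂.X n) (hw : w ∈ W n) (hz : S.g.f n w = 0) : w = 0 := by
    obtain ⟨y, rfl⟩ := shortExact_exists hS n w hz
    rw [hdisj n y hw, map_zero]
  let e (n : ℤ) : W n ≃ₗ[R] S.X₃.X n := LinearEquiv.ofBijective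
    ((S.g.f n).hom.comp (W n).subtype)
    ⟨(injective_iff_map_eq_zero _).2 fun w hw => Subtype.ext (hinj n w.1 w.2 hw),
      fun x => let ⟨w, hw, hwx⟩ := htop n x; ⟨⟨w, hw⟩, hwx⟩⟩
  have he (n : ℤ) (x : S.X₃.X n) : S.g.f n ((e n).symm x).1 = x := (e n).apply_symm_apply x
  refine ⟨{ f n := ModuleCat.ofHom ((W n).subtype.comp (e n).symm.toLinearMap)
            comm' i j _ := ModuleCat.hom_ext (LinearMap.ext fun x => ?_) }, ?_⟩
  · refine sub_eq_zero.1 (hinj j _ (Submodule.sub_mem _ (hW i j _ ((e i).symm x).2)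
      ((e j).symm (S.X₃.d i j x)).2) ?_)
    refine (map_sub (S.g.f j).hom _ _).trans (sub_eq_zero.2 ?_)
    exact ((hom_d_apply S.g i j _).symm.trans (congrArg _ (he i x))).trans (he j _).symm
  · ext n x
    exact he n x

theorem ExtendsFrom.exists_section {J : Type u} (hκ : ℵ₀ ≤ #J) (hR : #R ≤ #J)
    (hC : ExtendsFrom A (freeDisks R J) S.X₁) (hS : S.ShortExact)
    (h₃ : hUnitaryFlatComplex A S.X₃) : ∃ s : S.X₃ ⟶ S.X₂, s ≫ S.g = 𝟙 S.X₃ := by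
  let P : Set (∀ n, Submodule R (S.X₂.X n)) := {W | IsSubcomplex S.X₂ W ∧
    (∀ n y, S.f.f n y ∈ W n → y = 0) ∧
    IsPureSubcomplex S.X₃ (fun n => (W n).map (S.g.f n).hom)}
  have hbot : (fun _ => ⊥) ∈ P := by
    refine ⟨(IsPureSubcomplex.bot (X := S.X₂)).isSubcomplex, fun n y hy => ?_, ?_⟩
    · exact shortExact_f_injective hS n (((Submodule.mem_bot R).1 hy).trans (map_zero _).symm)
    · simp only [Submodule.map_bot]
      exact IsPureSubcomplex.bot
  -- Elements of `P` are graphs of partial sections over pure exact subcomplexes of X₃; unions of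
  -- chains stay in `P`.
  obtain ⟨W, ⟨hW, hdisj, hV⟩, hmax⟩ : ∃ W, Maximal (· ∈ P) W := by
    refine (zorn_le_nonempty₀ P (fun c hcP hc W₀ hW₀ => ?_) _ hbot).imp fun _ h => h.2
    have : Nonempty c := ⟨⟨W₀, hW₀⟩⟩
    have hdir : Directed (· ≤ ·) (Subtype.val : c → ∀ n, Submodule R (S.X₂.X n)) :=
      hc.directed
    have mem (n : ℤ) (x : S.X₂.X n) : x ∈ ⨆ a : c, a.1 n ↔ ∃ a : c, x ∈ a.1 n :=
      Submodule.mem_iSup_of_directed _ fun a b =>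
        let ⟨d, had, hbd⟩ := hdir a b
        ⟨d, had n, hbd n⟩
    refine ⟨fun n => ⨆ a : c, a.1 n, ⟨fun i j x hx => ?_, fun n y hy => ?_, ?_⟩,
      fun W hWc n => le_iSup (fun a : c => a.1 n) ⟨W, hWc⟩⟩
    · obtain ⟨a, ha⟩ := (mem i x).1 hx
      exact (mem j _).2 ⟨a, (hcP a.2).1 i j x ha⟩
    · obtain ⟨a, ha⟩ := (mem n _).1 hy
      exact (hcP a.2).2.1 n y ha
    · simp only [Submodule.map_iSup]
      exact IsPureSubcomplex.iSup (V := fun (a : c) n => (a.1 n).map (S.g.f n).hom)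
        (fun a b => let ⟨d, had, hbd⟩ := hdir a b
          ⟨d, fun n => Submodule.map_mono (had n), fun n => Submodule.map_mono (hbd n)⟩)
        fun a => (hcP a.2).2.2
  refine exists_section_of_complement hS hW hdisj fun n x => ?_
  -- As `W` meets X₁ trivially, dividing by it keeps X₁ as kernel, so `hC` applies again; the new
  -- base is still flat. A partial section over the class of x pulls back to an enlargement of `W`.
  have hS' := shortExact_quotientExtension hS hW hV.isSubcomplex (fun _ => rfl) hdisj
  obtain ⟨W', hW', hdisj', hV', hx⟩ := exists_isPureSubcomplex_complement hκ hR
    (S := quotientExtension S hW hV.isSubcomplex (fun _ => rfl)) hC hS'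
    (hV.hUnitaryFlatComplex h₃).2 ((quotientπ hV.isSubcomplex).f n x)
  let W'' : ∀ n, Submodule R (S.X₂.X n) := fun n => (W' n).comap ((quotientπ hW).f n).hom
  have hmap : (fun n => (W'' n).map (S.g.f n).hom) = fun n =>
      ((W' n).map ((quotientExtension S hW hV.isSubcomplex (fun _ => rfl)).g.f n).hom).comap
        ((quotientπ hV.isSubcomplex).f n).hom := by
    funext n
    ext z
    constructor
    · rintro ⟨w, hw, rfl⟩
      exact ⟨_, hw, rfl⟩
    · rintro ⟨w, hw, hwz⟩
      obtain ⟨w, rfl⟩ := quotientπ_surjective hW n w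
      have : (quotientπ hV.isSubcomplex).f n (S.g.f n w - z) = 0 := by
        rw [map_sub, sub_eq_zero]
        exact hwz
      obtain ⟨v, hv, hvz⟩ := (quotientπ_eq_zero_iff hV.isSubcomplex n _).1 this
      refine ⟨w - v, ?_, ?_⟩
      · change (quotientπ hW).f n (w - v) ∈ W' n
        rw [map_sub, (quotientπ_eq_zero_iff hW n v).2 hv, sub_zero]
        exact hw
      · exact (map_sub (S.g.f n).hom w v).trans ((congrArg _ hvz).trans (sub_sub_cancel _ _))
  have hle : W ≤ W'' := fun n w hw => by
    have : (quotientπ hW).f n w = 0 := (quotientπ_eq_zero_iff hW n w).2 hw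
    exact Submodule.mem_comap.2 (this ▸ zero_mem (W' n))
  have hmem : W'' ∈ P := by
    refine ⟨fun i j w hw => ?_, fun n y hy => hdisj' n y hy, ?_⟩
    · have : (quotientComplex hW).d i j ((quotientπ hW).f i w) ∈ W' j := hW' i j _ hw
      rwa [hom_d_apply] at this
    · rw [hmap]
      exact hV.comap hV'
  have hx'' : x ∈ (W'' n).map (S.g.f n).hom := by
    rw [congrFun hmap n]
    exact hx
  exact Submodule.map_mono (hmax hmem hle n) hx''

end Filtration

/-! ### Pushouts of extensions -/

section Pushouts

open Limits

variable {𝒜 : Type v} [Category.{w} 𝒜] [Abelian 𝒜] {S : ShortComplex 𝒜}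

theorem shortExact_of_isPushout (hS : S.ShortExact) {Y E : 𝒜} {q : S.X₁ ⟶ Y} {j : S.X₂ ⟶ E}
    {i : Y ⟶ E} (sq : IsPushout S.f q j i) :
    ∃ (p : E ⟶ S.X₃) (w : i ≫ p = 0), j ≫ p = S.g ∧ (ShortComplex.mk i p w).ShortExact := by
  have hf := hS.mono_f
  have := hS.epi_g
  let p := sq.desc S.g 0 (by rw [S.zero, comp_zero])
  have hp : j ≫ p = S.g := sq.inl_desc _ _ _
  have w : i ≫ p = 0 := sq.inr_desc _ _ _
  have hz {T : 𝒜} (k : E ⟶ T) (hk : i ≫ k = 0) : S.f ≫ j ≫ k = 0 := by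
    rw [sq.w_assoc, hk, comp_zero]
  refine ⟨p, w, hp,
    { exact := ShortComplex.exact_of_g_is_cokernel _ (CokernelCofork.IsColimit.ofπ _ _
        (fun k hk => hS.exact.desc (j ≫ k) (hz k hk)) (fun k hk => ?_) fun k hk m hm => ?_)
      mono_f := MorphismProperty.of_isPushout (P := MorphismProperty.monomorphisms 𝒜) sq.flip hf
      epi_g := epi_of_epi_fac hp }⟩
  · refine sq.hom_ext ?_ ?_
    · rw [reassoc_of% hp, hS.exact.g_desc]
    · rw [reassoc_of% w, zero_comp, hk]
  · rw [← cancel_epi S.g, hS.exact.g_desc, ← hp, Category.assoc]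
    exact congrArg (j ≫ ·) hm

theorem exists_shortExact_pushout (hS : S.ShortExact) {Y : 𝒜} (q : S.X₁ ⟶ Y) :
    ∃ (E : 𝒜) (j : S.X₂ ⟶ E) (i : Y ⟶ E) (p : E ⟶ S.X₃) (w : i ≫ p = 0),
      S.f ≫ j = q ≫ i ∧ (ShortComplex.mk i p w).ShortExact :=
  have sq := IsPushout.of_hasPushout S.f q
  let ⟨p, w, _, h⟩ := shortExact_of_isPushout hS sq
  ⟨_, _, _, p, w, sq.w, h⟩

end Pushouts

/-! ### Disks on flat modules, shifts, cones and coproducts -/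

section DiskComplexes

open Limits

attribute [local irreducible] hUnitary

variable {R : Type u} [Ring R] {A : TwoSidedIdeal R} {n : ℤ}

/-- The cycles are `F` in degree n + 1 and zero elsewhere, hence retracts of `F` in every degree. -/
theorem hUnitaryFlatComplex_disk {F : ModuleCat.{u} R} (hF : hUnitaryFlat A F) :
    hUnitaryFlatComplex A (disk n F) := by
  have hinj : Function.Injective ((disk n F).d n (n + 1)) := by
    rw [disk_d]
    exact (ConcreteCategory.bijective_of_isIso ((diskIso₀ n F).hom ≫ (diskIso₁ n F).inv)).1
  have hsurj : Function.Surjective ((disk n F).d n (n + 1)) := by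
    rw [disk_d]
    exact (ConcreteCategory.bijective_of_isIso ((diskIso₀ n F).hom ≫ (diskIso₁ n F).inv)).2
  have hzero (k : ℤ) (h₁ : k ≠ n + 1) (z : (disk n F).X k) (hz : (disk n F).d k (k + 1) z = 0) :
      z = 0 := by
    by_cases h₀ : k = n
    · subst h₀
      exact hinj (hz.trans (map_zero _).symm)
    · have := ModuleCat.subsingleton_of_isZero
        (HomologicalComplex.isZero_double_X (𝟙 F) (upRel n) k h₀ h₁)
      exact Subsingleton.elim _ _
  refine hUnitaryFlatComplex_iff.2 ⟨acyclic_iff.2 ?_, fun k => ?_⟩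
  · rintro i j _ hij rfl z hz
    by_cases h₁ : j = n + 1
    · subst h₁
      obtain rfl : i = n := by omega
      exact hsurj z
    · obtain rfl := hzero j h₁ z hz
      exact ⟨0, map_zero _⟩
  · by_cases h₁ : k = n + 1
    · subst h₁
      refine hUnitaryFlat_of_retract
        { i := ModuleCat.ofHom (Submodule.subtype _) ≫ (diskIso₁ n F).hom
          r := ModuleCat.ofHom ((diskIso₁ n F).inv.hom.codRestrict _ fun x => ?_)
          retract := ModuleCat.hom_ext (LinearMap.ext fun z => Subtype.ext ?_) } hF
      · rw [disk_d_eq_zero (by omega)]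
        rfl
      · exact congrArg (fun c => c.hom z.1) (diskIso₁ n F).hom_inv_id
    · have : Subsingleton (cycleModule (disk n F) k) :=
        ⟨fun a b => Subtype.ext ((hzero k h₁ _ a.2).trans (hzero k h₁ _ b.2).symm)⟩
      refine hUnitaryFlat_of_retract { i := 0, r := 0, retract := ?_ } hF
      exact ModuleCat.hom_ext (LinearMap.ext fun _ => Subsingleton.elim _ _)

/-- The map of disks induced by a map of modules. -/
noncomputable def diskMap (n : ℤ) {C D : ModuleCat.{u} R} (f : C ⟶ D) : disk n C ⟶ disk n D :=
  ofDisk (f ≫ (diskIso₀ n D).inv)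

theorem diskMap_f {C D : ModuleCat.{u} R} (f : C ⟶ D) :
    (diskMap n f).f n = (diskIso₀ n C).hom ≫ f ≫ (diskIso₀ n D).inv :=
  ofDisk_f _

theorem diskMap_f_succ {C D : ModuleCat.{u} R} (f : C ⟶ D) :
    (diskMap n f).f (n + 1) = (diskIso₁ n C).hom ≫ f ≫ (diskIso₁ n D).inv := by
  rw [diskMap, ofDisk_f_succ, disk_d, Category.assoc, Iso.inv_hom_id_assoc]

/-- The short complex of disks on a short complex of modules. -/
noncomputable def diskShortComplex (n : ℤ) (T : ShortComplex (ModuleCat.{u} R)) :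
    ShortComplex (CochainComplex (ModuleCat.{u} R) ℤ) :=
  ShortComplex.mk (diskMap n T.f) (diskMap n T.g) (fromDisk_ext (by
    simp [diskMap_f]))

theorem shortExact_diskShortComplex {T : ShortComplex (ModuleCat.{u} R)} (hT : T.ShortExact) :
    (diskShortComplex n T).ShortExact := by
  refine HomologicalComplex.shortExact_of_degreewise_shortExact _ fun k => ?_
  by_cases h₀ : k = n
  · subst h₀
    refine ShortComplex.shortExact_of_iso (ShortComplex.isoMk (diskIso₀ k T.X₁).symm
      (diskIso₀ k T.X₂).symm (diskIso₀ k T.X₃).symm ?_ ?_) hT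
    · change (diskIso₀ k T.X₁).inv ≫ (diskMap k T.f).f k = T.f ≫ (diskIso₀ k T.X₂).inv
      rw [diskMap_f, Iso.inv_hom_id_assoc]
    · change (diskIso₀ k T.X₂).inv ≫ (diskMap k T.g).f k = T.g ≫ (diskIso₀ k T.X₃).inv
      rw [diskMap_f, Iso.inv_hom_id_assoc]
  by_cases h₁ : k = n + 1
  · subst h₁
    refine ShortComplex.shortExact_of_iso (ShortComplex.isoMk (diskIso₁ n T.X₁).symm
      (diskIso₁ n T.X₂).symm (diskIso₁ n T.X₃).symm ?_ ?_) hT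
    · change (diskIso₁ n T.X₁).inv ≫ (diskMap n T.f).f (n + 1) = T.f ≫ (diskIso₁ n T.X₂).inv
      rw [diskMap_f_succ, Iso.inv_hom_id_assoc]
    · change (diskIso₁ n T.X₂).inv ≫ (diskMap n T.g).f (n + 1) = T.g ≫ (diskIso₁ n T.X₃).inv
      rw [diskMap_f_succ, Iso.inv_hom_id_assoc]
  · have hz (C : ModuleCat.{u} R) : IsZero ((disk n C).X k) :=
      HomologicalComplex.isZero_double_X (𝟙 C) (upRel n) k h₀ h₁
    exact
      { exact := ShortComplex.exact_of_isZero_X₂ _ (hz _)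
        mono_f := ⟨fun _ _ _ => (hz _).eq_of_tgt _ _⟩
        epi_g := ⟨fun _ _ _ => (hz _).eq_of_src _ _⟩ }

end DiskComplexes

section Shifts

open Limits CochainComplex HomComplex

attribute [local irreducible] hUnitary

variable {R : Type u} [Ring R] {A : TwoSidedIdeal R} {X : CochainComplex (ModuleCat.{u} R) ℤ}

theorem shift_d_eq_zero_iff (a i j k : ℤ) (hk : j + a = k) (x : X.X (i + a)) :
    (X⟦a⟧).d i j x = 0 ↔ X.d (i + a) k x = 0 := by
  subst hk
  rw [CochainComplex.shiftFunctor_obj_d']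
  rcases Int.even_or_odd a with h | h
  · rw [Int.negOnePow_even _ h, one_smul]
    rfl
  · rw [Int.negOnePow_odd _ h, Units.neg_smul, one_smul]
    exact neg_eq_zero

theorem hUnitaryFlatComplex_shift (hX : hUnitaryFlatComplex A X) (a : ℤ) :
    hUnitaryFlatComplex A (X⟦a⟧) := by
  have hd (i j k : ℤ) (hk : j + a = k) (x : X.X (i + a)) :=
    shift_d_eq_zero_iff (X := X) a i j k hk x
  refine hUnitaryFlatComplex_iff.2 ⟨acyclic_iff.2 ?_, fun k => ?_⟩
  · intro i j k hij hjk z hz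
    obtain ⟨y, hy⟩ := acyclic_iff.1 hX.2.1 (i + a) (j + a) (k + a) (by omega) (by omega) z
      ((hd _ _ _ rfl z).1 hz)
    rw [CochainComplex.shiftFunctor_obj_d']
    rcases Int.even_or_odd a with h | h
    · rw [Int.negOnePow_even _ h, one_smul]
      exact ⟨y, hy⟩
    · rw [Int.negOnePow_odd _ h, Units.neg_smul, one_smul]
      exact ⟨-y, (neg_eq_iff_eq_neg.2 (map_neg (X.d (i + a) (j + a)).hom y)).trans hy⟩
  · let e : cycleModule (X⟦a⟧) k ≃ₗ[R] cycleModule X (k + a) :=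
      { toFun z := ⟨z.1, (hd k (k + 1) (k + a + 1) (by omega) z.1).1 z.2⟩
        invFun z := ⟨z.1, (hd k (k + 1) (k + a + 1) (by omega) z.1).2 z.2⟩
        map_add' _ _ := rfl
        map_smul' _ _ := rfl
        left_inv _ := rfl
        right_inv _ := rfl }
    exact hUnitaryFlat_of_retract (Retract.ofIso e.toModuleIso) (hX.2.2 (k + a))

variable {K L : CochainComplex (ModuleCat.{u} R) ℤ} (φ : K ⟶ L)

/-- The sequence `0 → L → Cone φ → K[1] → 0`. -/
noncomputable def coneShortComplex : ShortComplex (CochainComplex (ModuleCat.{u} R) ℤ) :=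
  ShortComplex.mk (X₂ := mappingCone φ) (X₃ := K⟦(1 : ℤ)⟧) (mappingCone.inr φ)
    (mappingCone.triangle φ).mor₃ (mappingCone.inr_triangleδ φ)

theorem coneShortComplex_g_apply (n : ℤ) (x : (mappingCone φ).X n) :
    (coneShortComplex φ).g.f n x = -((mappingCone.fst φ).1.v n (n + 1) rfl x) := by
  have : (coneShortComplex φ).g.f n = -((mappingCone.fst φ).1.v n (n + 1) rfl) := by
    simp [coneShortComplex, mappingCone.triangle, Cochain.rightShift_v _ 1 0 (zero_add 1) n n
      (add_zero n) (n + 1) rfl]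
    exact congrArg Neg.neg (Category.comp_id ((mappingCone.fst φ).1.v n (n + 1) rfl))
  exact congrArg (fun c => c.hom x) this

theorem shortExact_coneShortComplex : (coneShortComplex φ).ShortExact := by
  have hs (n : ℤ) (x : K.X (n + 1)) : ∃ y, (coneShortComplex φ).g.f n y = x := by
    refine ⟨-((mappingCone.inl φ).v (n + 1) n (by omega) x), ?_⟩
    refine (coneShortComplex_g_apply φ n _).trans ?_
    rw [map_neg, neg_neg]
    exact congrArg (fun c => c.hom x) (mappingCone.inl_v_fst_v φ (n + 1) n rfl)
  refine shortExact_of_degreewise (fun n => ?_) (fun n x => ?_) (fun n x hx => ?_)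
  · refine Function.LeftInverse.injective (g := (mappingCone.snd φ).v n n (add_zero n)) fun y => ?_
    exact congrArg (fun c => c.hom y) (mappingCone.inr_f_snd_v φ n)
  · exact hs n x
  · refine ⟨(mappingCone.snd φ).v n n (add_zero n) x, ?_⟩
    replace hx := neg_eq_zero.1 ((coneShortComplex_g_apply φ n x).symm.trans hx)
    have := congrArg (fun c => c.hom x) (mappingCone.id_X φ n (n + 1) rfl)
    refine Eq.trans ?_ this
    refine (zero_add _).symm.trans (congrArg (· + _) ?_)
    exact ((congrArg ((mappingCone.inl φ).v (n + 1) n (by omega)).hom hx).trans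
      (map_zero _)).symm

end Shifts

section CoproductLifts

open Limits

variable {R : Type u} [Ring R] {A : TwoSidedIdeal R}

/-- Lifts are chosen on each summand. Closure of flat complexes under coproducts thus needs no
computation of cycles. -/
theorem LiftsToTestDisks.sigma {ι : Type} {D : ι → CochainComplex (ModuleCat.{u} R) ℤ}
    [HasCoproduct D] (h : ∀ a, LiftsToTestDisks A (D a)) : LiftsToTestDisks A (∐ D) := by
  have key {E Q : CochainComplex (ModuleCat.{u} R) ℤ} (p : E ⟶ Q)
      (hp : ∀ a (q : D a ⟶ Q), ∃ e, e ≫ p = q) (q : ∐ D ⟶ Q) : ∃ e, e ≫ p = q := by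
    choose e he using fun a => hp a (Sigma.ι D a ≫ q)
    exact ⟨Sigma.desc e, Sigma.hom_ext _ _ fun a => by rw [Sigma.ι_desc_assoc, he]⟩
  exact
    { disk n := key _ fun a => (h a).disk n
      sphere n _ _ _ _ _ _ g hg := key _ fun a => (h a).sphere n g hg
      zero n q := Sigma.hom_ext _ _ fun a => by rw [(h a).zero n (Sigma.ι D a ≫ q), comp_zero] }

end CoproductLifts

/-! ### The right orthogonal of the flat complexes -/

section DgCotorsion

open Limits CochainComplex HomComplex

attribute [local irreducible] hUnitary

variable {R : Type u} [Ring R] {A : TwoSidedIdeal R} {X Y : CochainComplex (ModuleCat.{u} R) ℤ}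

/-- Push the sequence out along `q`. The result is an extension of a flat complex by `Y`, so it
stays in ℂ(𝔐(A)) and splits; a retraction gives the extension of `q`. -/
theorem exists_extension_of_rightPerp
    (hY : rightPerp (hUnitaryComplex A) (hUnitaryFlatComplex A) Y)
    {S : ShortComplex (CochainComplex (ModuleCat.{u} R) ℤ)} (hS : S.ShortExact)
    (h₃ : hUnitaryFlatComplex A S.X₃) (q : S.X₁ ⟶ Y) : ∃ h : S.X₂ ⟶ Y, S.f ≫ h = q := by
  obtain ⟨E, j, i, p, w, comm, hE⟩ := exists_shortExact_pushout hS q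
  obtain ⟨σ⟩ := hY.2 _ h₃ E i p w (hUnitaryComplex_X₂ hE hY.1 h₃) hE
  refine ⟨j ≫ σ.r, ?_⟩
  have hr : i ≫ σ.r = 𝟙 Y := σ.f_r
  rw [reassoc_of% comm, hr, Category.comp_id]

/-- Apply the disk construction to a module extension of a flat `F` by Y^n. The map from the disk on
Y^n to `Y` extends, and its component in degree n is a retraction. -/
theorem hUnitaryCotorsion_of_rightPerp
    (hY : rightPerp (hUnitaryComplex A) (hUnitaryFlatComplex A) Y) (n : ℤ) :
    hUnitaryCotorsion A (Y.X n) := by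
  refine ⟨(hY.1 n).1, fun F hF E i p zero _ hS => ?_⟩
  obtain ⟨h, hh⟩ : ∃ h : disk n E ⟶ Y, diskMap n i ≫ h = ofDisk (𝟙 (Y.X n)) :=
    exists_extension_of_rightPerp hY (shortExact_diskShortComplex (n := n) hS)
      (hUnitaryFlatComplex_disk hF) (ofDisk (𝟙 (Y.X n)))
  have hn : i ≫ (diskIso₀ n E).inv ≫ h.f n = 𝟙 (Y.X n) := by
    rw [← cancel_epi (diskIso₀ n (Y.X n)).hom, ← ofDisk_f (𝟙 (Y.X n)), ← hh, HomologicalComplex.comp_f,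
      diskMap_f, Category.assoc, Category.assoc]
  exact ⟨ShortComplex.Splitting.ofExactOfRetraction _ hS.exact ((diskIso₀ n E).inv ≫ h.f n) hn
    hS.epi_g⟩

theorem homComplex_acyclic_iff : (HomComplex X Y).Acyclic ↔ ∀ (m n : ℤ), m + 1 = n →
    ∀ z : Cocycle X Y n, ∃ y : Cochain X Y m, δ m n y = z.1 := by
  have key (m n : ℤ) (hmn : m + 1 = n) : (HomComplex X Y).ExactAt n ↔
      ∀ z : Cocycle X Y n, ∃ y : Cochain X Y m, δ m n y = z.1 := by
    rw [HomologicalComplex.exactAt_iff' _ m n (n + 1) (by simp; omega) (by simp),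
      ShortComplex.ab_exact_iff]
    exact ⟨fun h z => h z.1 (z.δ_eq_zero (n + 1)),
      fun h z hz => h (Cocycle.mk z (n + 1) rfl hz)⟩
  exact ⟨fun h m n hmn => (key m n hmn).1 (h n),
    fun h n => (key (n - 1) n (by omega)).2 (h _ _ (by omega))⟩

/-- A cocycle of degree n is a chain map X[-n] → Y. It extends over the cone of the identity, whose
quotient X[-n][1] is flat, and so it is null-homotopic. -/
theorem homComplex_acyclic_of_rightPerp
    (hY : rightPerp (hUnitaryComplex A) (hUnitaryFlatComplex A) Y)
    (hX : hUnitaryFlatComplex A X) : (HomComplex X Y).Acyclic := by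
  refine homComplex_acyclic_iff.2 fun m n hmn z => ?_
  have hX' := hUnitaryFlatComplex_shift hX (-n)
  let f : X⟦-n⟧ ⟶ Y := Cocycle.homOf (z.leftShift (-n) 0 (by omega))
  obtain ⟨h, hh⟩ : ∃ h : mappingCone (𝟙 (X⟦-n⟧)) ⟶ Y, mappingCone.inr (𝟙 (X⟦-n⟧)) ≫ h = f :=
    exists_extension_of_rightPerp hY (shortExact_coneShortComplex (𝟙 (X⟦-n⟧)))
      (hUnitaryFlatComplex_shift hX' 1) f
  have hδ : δ (-1) 0 ((mappingCone.inl (𝟙 (X⟦-n⟧))).comp (Cochain.ofHom h) (add_zero _)) =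
      z.1.leftShift (-n) 0 (by omega) := by
    rw [δ_comp_ofHom, mappingCone.δ_inl, ← Cochain.ofHom_comp, Category.assoc, hh,
      Category.id_comp]
    exact Cocycle.cochain_ofHom_homOf_eq_coe _
  -- The sign cancels the one produced when δ passes through the unshift.
  refine ⟨(-n).negOnePow • Cochain.leftUnshift ((mappingCone.inl (𝟙 (X⟦-n⟧))).comp
    (Cochain.ofHom h) (add_zero _)) m (by omega), ?_⟩
  rw [δ_units_smul, Cochain.δ_leftUnshift _ m (by omega) n 0 (by omega), smul_smul,
    Int.units_mul_self, one_smul, hδ]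
  exact Cochain.leftUnshift_leftShift _ _ _ _

theorem relExtVanishes_of_dgCotorsion (hY : dgCotorsionComplex A Y)
    (hX : hUnitaryFlatComplex A X) : RelExtVanishes (hUnitaryComplex A) X Y := by
  intro E i p w hE hS
  have hσ (n : ℤ) : Nonempty
      ((ShortComplex.mk i p w).map (HomologicalComplex.eval _ _ n)).Splitting :=
    (hY.2.1 n).2 (X.X n) (hX.flat n) (E.X n) (i.f n) (p.f n)
      (by rw [← HomologicalComplex.comp_f, w, HomologicalComplex.zero_f]) (hE n).1
      (shortExact_eval hS n)
  let σ n := (hσ n).some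
  -- The degreewise section s and retraction r give the cocycle s ≫ d ≫ r measuring how far s is
  -- from a chain map. Writing it as δ h makes s - h ≫ i a chain map.
  obtain ⟨h, hh⟩ := homComplex_acyclic_iff.1 (hY.2.2 X hX) 0 1 rfl
    (cocycleOfDegreewiseSplit (ShortComplex.mk i p w) σ)
  let s (n : ℤ) : X.X n ⟶ E.X n := (σ n).s
  let r (n : ℤ) : E.X n ⟶ Y.X n := (σ n).r
  have hs (n : ℤ) : s n ≫ p.f n = 𝟙 _ := (σ n).s_g
  have hrs (n : ℤ) : r n ≫ i.f n + p.f n ≫ s n = 𝟙 _ := (σ n).id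
  have hd (n : ℤ) : s n ≫ E.d n (n + 1) ≫ r (n + 1) =
      h.v n n (add_zero n) ≫ Y.d n (n + 1) - X.d n (n + 1) ≫ h.v (n + 1) (n + 1) (add_zero _) := by
    rw [← δ_zero_cochain_v h n (n + 1) rfl, hh]
    rfl
  have comm (n : ℤ) : s n ≫ E.d n (n + 1) =
      (h.v n n (add_zero n) ≫ Y.d n (n + 1) -
        X.d n (n + 1) ≫ h.v (n + 1) (n + 1) (add_zero _)) ≫ i.f (n + 1) +
      X.d n (n + 1) ≫ s (n + 1) := by
    rw [← hd, ← Category.comp_id (s n ≫ E.d n (n + 1)), ← hrs (n + 1), Preadditive.comp_add]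
    simp only [Category.assoc]
    rw [← p.comm_assoc, reassoc_of% hs n]
  let t : X ⟶ E :=
    { f n := s n - h.v n n (add_zero n) ≫ i.f n
      comm' n m hnm := by
        obtain rfl : n + 1 = m := hnm
        rw [Preadditive.sub_comp, comm, Preadditive.comp_sub, Preadditive.sub_comp,
          Category.assoc, Category.assoc, Category.assoc, i.comm]
        abel }
  have ht : t ≫ p = 𝟙 X := by
    ext1 n
    change (s n - h.v n n (add_zero n) ≫ i.f n) ≫ p.f n = 𝟙 _
    rw [Preadditive.sub_comp, hs, Category.assoc, ← HomologicalComplex.comp_f, w]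
    simp
  exact ⟨ShortComplex.Splitting.ofExactOfSection _ hS.exact t ht hS.mono_f⟩

theorem rightPerp_eq_dgCotorsionComplex :
    rightPerp (hUnitaryComplex A) (hUnitaryFlatComplex A) = dgCotorsionComplex A := by
  ext Y
  exact ⟨fun h => ⟨h.1, hUnitaryCotorsion_of_rightPerp h, fun _ hX =>
    homComplex_acyclic_of_rightPerp h hX⟩,
    fun h => ⟨h.1, fun _ hX => relExtVanishes_of_dgCotorsion h hX⟩⟩

end DgCotorsion

/-! ### Completeness and the left orthogonal -/

section CompleteCotorsionPair

open Limits Cardinal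

attribute [local irreducible] hUnitary

variable {R : Type u} [Ring R] (A : TwoSidedIdeal R)

theorem enoughInjectivesPair :
    EnoughInjectivesPair (hUnitaryComplex A) (hUnitaryFlatComplex A) (dgCotorsionComplex A) := by
  intro Y hY
  -- An infinite index type of cardinality at least that of `R`, as the pure hulls require.
  let J := R ⊕ ULift.{u} ℕ
  obtain ⟨C, F, i, p, w, hS, hF, hC⟩ := exists_shortExact_extendsFrom A (freeDisks R J) Y
  have hCP : hUnitaryComplex A C := hUnitaryComplex_X₂ hS hY hF
  refine ⟨C, F, i, p, w, hCP, hF.1, ?_, hF, hS⟩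
  rw [← rightPerp_eq_dgCotorsionComplex]
  refine ⟨hCP, fun X hX E i' p' w' _ hS' => ?_⟩
  obtain ⟨s, hs⟩ := ExtendsFrom.exists_section (J := J) (S := ShortComplex.mk i' p' w')
    (by simp [J]) (by simp [J]) hC hS' hX
  exact ⟨ShortComplex.Splitting.ofExactOfSection _ hS'.exact s hs hS'.mono_f⟩

variable {A} in
theorem exists_epi_from_hUnitaryFlatComplex {Z : CochainComplex (ModuleCat.{u} R) ℤ}
    (hZ : hUnitaryComplex A Z) :
    ∃ (F : CochainComplex (ModuleCat.{u} R) ℤ) (p : F ⟶ Z), hUnitaryFlatComplex A F ∧ Epi p := by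
  choose G p hG hp using fun n => exists_epi_from_hUnitaryFlat (hZ n).1
  refine ⟨∐ fun n => disk n (G n), Sigma.desc fun n => ofDisk (p n),
    (LiftsToTestDisks.sigma fun n =>
      (hUnitaryFlatComplex_disk (hG n)).liftsToTestDisks).hUnitaryFlatComplex,
    epi_of_components_surjective _ fun n => ⟨n, ?_⟩⟩
  rw [ofDisk_f]
  exact (ModuleCat.epi_iff_surjective _).1 (epi_comp _ _)

/-- Salce's argument: embed the kernel of a flat cover F → Z in a dg-cotorsion C with flat cokernel
F'. The pushout is an extension of F' by F, hence flat, and it is also an extension of Z by C. -/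
theorem enoughProjectivesPair :
    EnoughProjectivesPair (hUnitaryComplex A) (hUnitaryFlatComplex A) (dgCotorsionComplex A) := by
  intro Z hZ
  obtain ⟨F, p, hF, _⟩ := exists_epi_from_hUnitaryFlatComplex hZ
  have hS : (ShortComplex.mk (kernel.ι p) p (kernel.condition p)).ShortExact :=
    { exact := ShortComplex.exact_kernel p }
  obtain ⟨C, F', i, q, w, hC, _, hCdg, hF', hS'⟩ :=
    enoughInjectivesPair A (kernel p) (hUnitaryComplex_X₁ hS hF hZ)
  have sq := IsPushout.of_hasPushout (kernel.ι p) i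
  obtain ⟨_, _, _, hT'⟩ := shortExact_of_isPushout hS' sq.flip
  obtain ⟨r, w', _, hT⟩ := shortExact_of_isPushout hS sq
  have hE := hUnitaryFlatComplex_X₂ hT' hF hF'
  exact ⟨C, _, _, r, w', hC, hE.1, hCdg, hE, hT⟩

theorem leftPerp_eq_hUnitaryFlatComplex :
    leftPerp (hUnitaryComplex A) (dgCotorsionComplex A) = hUnitaryFlatComplex A := by
  ext X
  refine ⟨fun h => ?_, fun h => ⟨h.1, fun _ hY => relExtVanishes_of_dgCotorsion hY h⟩⟩
  obtain ⟨C, F, i, p, w, _, hFP, hC, hF, hS⟩ := enoughProjectivesPair A X h.1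
  obtain ⟨σ⟩ := h.2 C hC F i p w hFP hS
  -- Orthogonality splits the flat approximation of X, which makes X a retract of a flat complex.
  exact hUnitaryFlatComplex_of_retract { i := σ.s, r := p, retract := σ.s_g } hF

end CompleteCotorsionPair

theorem mainTheorem5 (R : Type u) [Ring R] (A : TwoSidedIdeal R) :
    IsCompleteCotorsionPair (hUnitaryComplex A) (hUnitaryFlatComplex A)
      (dgCotorsionComplex A) where
  isCotorsionPair := ⟨rightPerp_eq_dgCotorsionComplex, leftPerp_eq_hUnitaryFlatComplex A⟩
  enoughInjectives := enoughInjectivesPair A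
  enoughProjectives := enoughProjectivesPair A
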